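/- Let $\Bbbk=\mathbb C(q)$, $z=q-q^{-1}$, $n\in\mathbb N=\{0,1,2,\dots\}$ and $I=\{-n,\dots,-1,1,\dots,n\}$. For $i,j\in I$ put $p(i)=1$ if $i<0$ and $p(i)=0$ if $i>0$ (in $\mathbb Z/2$), $p(i,j)=p(i)+p(j)$, $\operatorname{sgn}(i)=(-1)^{p(i)}$ and $\varphi(i,j)=\delta_{|i|,|j|}\operatorname{sgn}(j)$. Let $V$ be the superspace with basis $(v_i)_{i\in I}$, $\bar v_i=p(i)$, let $E_{ij}$ be the matrix units ($E_{ij}v_j=v_i$), let $(v_i^*)$ be the dual basis of $V^*$, and let $$\Theta=\sum_{i,j}\Theta_{ij}\otimes E_{ij}=\sum_{i,j} q^{\varphi(i,j)}E_{ii}\otimes E_{jj}+z\sum_{i<j}(-1)^{p(i)}(E_{ji}+E_{-j,-i})\otimes E_{ij}\in \operatorname{End}(V)^{\otimes 2}.$$ *Quantum isomeric superalgebra.* $U_q=U_q(\mathfrak q_n)$ is the associative $\Bbbk$-superalgebra generated by $u_{ij}$ ($i\le j$), of parity $p(i,j)$, with relations $u_{ii}u_{-i,-i}=1$ and $L^{12}L^{13}\Theta^{23}=\Theta^{23}L^{13}L^{12}$,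 where $L=\sum_{i\le j}u_{ij}\otimes E_{ij}$. It is a Hopf superalgebra with $\Delta(u_{ij})=\sum_{i\le k\le j}(-1)^{p(i,k)p(k,j)}u_{ik}\otimes u_{kj}$, $\varepsilon(u_{ij})=\delta_{ij}$ and $\sum_{i\le j} S(u_{ij})\otimes E_{ij}=L^{-1}$. Let $U_q\text{-smod}$ be the monoidal supercategory of $U_q$-supermodules; its morphisms are all sums of even and odd supermodule homomorphisms, a homomorphism $f$ of parity $\bar f$ being a linear map of that parity with $f(xv)=(-1)^{\bar f\bar x}xf(v)$, and $(f\otimes g)(v\otimes w)=(-1)^{\bar g\bar v}f(v)\otimes g(w)$. Regard $V$ as a $U_q$-supermodule through $u_{ij}\mapsto\Theta_{ij}$, and $V^*$ as its dual, $(xf)(v)=(-1)^{\bar x\bar f}f(S(x)v)$. Put $$T=\mathrm{flip}\circ\Theta\colon V\otimes V\to V\otimes V,\quad \mathrm{flip}(v\otimes w)=(-1)^{\bar v\bar w}w\otimes v,\qquad J=\sum_{i\in I}(-1)^{p(i)}E_{-i,i}\colon V\to V,$$ $$\mathrm{ev}\colon V^*\otimes V\to\Bbbk,\ f\otimes v\mapsto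 f(v),\qquad \mathrm{coev}\colon \Bbbk\to V\otimes V^*,\ 1\mapsto \sum_{i\in I}v_i\otimes v_i^*.$$ *Quantum isomeric supercategory.* $\mathcal Q(z)$ is the strict $\Bbbk$-linear monoidal supercategory generated by objects $\uparrow,\downarrow$, even morphisms $x_+,x_-\colon\uparrow\uparrow\to\uparrow\uparrow$ (positive and negative up crossing), $y_-\colon\uparrow\downarrow\to\downarrow\uparrow$ (negative right crossing), $c\colon\downarrow\uparrow\to\mathbf 1$ (left cap), $d\colon\mathbf 1\to\uparrow\downarrow$ (left cup), and an odd morphism $t\colon\uparrow\to\uparrow$ (Clifford token), subject to the following relations, where $y_+=(c\otimes 1_{\uparrow\downarrow})\circ(1_\downarrow\otimes x_+\otimes 1_\downarrow)\circ(1_{\downarrow\uparrow}\otimes d)$ and $r=c\circ y_-$: $$x_-x_+=x_+x_-=1_{\uparrow\uparrow},\quad y_+y_-=1_{\uparrow\downarrow},\quad y_-y_+=1_{\downarrow\uparrow},\quad (x_+\otimes1)(1\otimes x_+)(x_+\otimes1)=(1\otimes x_+)(x_+\otimes1)(1\otimes x_+),$$ $$x_+-x_-=z\,1_{\uparrow\uparrow},\quad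 t^2=-1_\uparrow,\quad x_+(t\otimes1_\uparrow)=(1_\uparrow\otimes t)x_+,\quad r(t\otimes1_\downarrow)d=0=rd,$$ $$(1_\uparrow\otimes c)(d\otimes1_\uparrow)=1_\uparrow,\quad (c\otimes1_\downarrow)(1_\downarrow\otimes d)=1_\downarrow.$$ **Theorem.** For each $n\in\mathbb N$ there exists a unique monoidal superfunctor $\mathbf F_n\colon\mathcal Q(z)\to U_q\text{-smod}$ such that $$\mathbf F_n(\uparrow)=V,\quad \mathbf F_n(\downarrow)=V^*,\quad \mathbf F_n(x_+)=T,\quad \mathbf F_n(c)=\mathrm{ev},\quad \mathbf F_n(t)=J .$$ Here a monoidal superfunctor comes with its even coherence isomorphisms, through which the conditions on $x_+$ and $c$ are read, and uniqueness means: any two such superfunctors, even if $\mathbf F(\uparrow)=V$ and $\mathbf F(\downarrow)=V^*$ are only given as even isomorphisms, are related by a unique even monoidal natural isomorphism compatible with the identifications of the images of $\uparrow$ and $\downarrow$ with $V$ and $V^*$. Furthermore, $T$ is invertible, $\mathbf F_n(x_-)=T^{-1}$, $\mathbf F_n(d)=\mathrm{coev}$, and $$\mathbf F_n(y_-)\colon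 v_i\otimes v_j^*\mapsto(-1)^{p(i)p(j)}q^{-\varphi(i,j)}v_j^*\otimes v_i-z\delta_{ij}\sum_{k>i}(-1)^{p(i,k)}q^{2|i|-2|k|}v_k^*\otimes v_k-z\delta_{i,-j}\sum_{k>j}(-1)^{p(k)}q^{2|i|-2|k|}v_k^*\otimes v_{-k}.$$ -/

import Mathlib

noncomputable section

open CategoryTheory
open scoped TensorProduct

universe u v w

namespace Isomeric

/-! ## Superspaces -/

/-- The sign `(-1)^r` of a parity `r ∈ ℤ/2`. -/
def sgn {k : Type u} [CommRing k] (r : ZMod 2) : k := if r = 0 then 1 else -1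

section sgn
variable {k : Type u} [CommRing k]

@[simp] theorem sgn_zero : sgn (k := k) 0 = 1 := by simp [sgn]

@[simp] theorem sgn_one : sgn (k := k) 1 = -1 := by simp [sgn]

theorem zmod2_cases (r : ZMod 2) : r = 0 ∨ r = 1 := by
  revert r; decide

theorem sgn_add (r s : ZMod 2) : sgn (k := k) (r + s) = sgn r * sgn s := by
  have h : (1 : ZMod 2) + 1 = 0 := by decide
  rcases zmod2_cases r with rfl | rfl <;> rcases zmod2_cases s with rfl | rfl <;> simp [h]

@[simp] theorem sgn_mul_self (r : ZMod 2) : sgn (k := k) r * sgn r = 1 := by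
  rcases zmod2_cases r with rfl | rfl <;> simp

end sgn

/-- A `ℤ/2`-grading `M = M₀ ⊕ M₁` on a module, turning it into a superspace. -/
structure Grading (k : Type u) (M : Type v) [CommRing k] [AddCommGroup M] [Module k M] where
  /-- The homogeneous elements of parity `r`. -/
  gr : ZMod 2 → Submodule k M
  isCompl : IsCompl (gr 0) (gr 1)

namespace Grading

variable {k : Type u} [CommRing k]
variable {M M' M'' N N' N'' : Type u} [AddCommGroup M] [Module k M] [AddCommGroup M'] [Module k M']
  [AddCommGroup M''] [Module k M'']
  [AddCommGroup N] [Module k N] [AddCommGroup N'] [Module k N'] [AddCommGroup N''] [Module k N'']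

/-- The projection of a superspace onto its homogeneous component of parity `r`. -/
def proj (G : Grading k M) (r : ZMod 2) : M →ₗ[k] M :=
  if r = 0 then (G.gr 0).projection (G.gr 1) G.isCompl
  else (G.gr 1).projection (G.gr 0) G.isCompl.symm

variable (G : Grading k M) (G' : Grading k M') (G'' : Grading k M'')
  (H : Grading k N) (H' : Grading k N') (H'' : Grading k N'')

theorem proj_mem (r : ZMod 2) (x : M) : G.proj r x ∈ G.gr r := by
  rcases zmod2_cases r with rfl | rfl
  · simp [proj]
  · simp [proj]

theorem proj_add_proj (x : M) : G.proj 0 x + G.proj 1 x = x := by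
  simpa [proj] using Submodule.projection_add_projection_eq_self G.isCompl x

theorem proj_of_mem {r : ZMod 2} {x : M} (h : x ∈ G.gr r) : G.proj r x = x := by
  rcases zmod2_cases r with rfl | rfl
  · simpa [proj] using Submodule.projection_apply_left G.isCompl ⟨x, h⟩
  · simpa [proj] using Submodule.projection_apply_left G.isCompl.symm ⟨x, h⟩

theorem proj_of_mem_ne {r s : ZMod 2} {x : M} (h : x ∈ G.gr s) (hrs : r ≠ s) : G.proj r x = 0 := by
  have key := G.proj_add_proj x
  have h1 := G.proj_of_mem h
  rcases zmod2_cases r with rfl | rfl <;> rcases zmod2_cases s with rfl | rfl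
  · exact absurd rfl hrs
  · rw [h1] at key; simpa using key
  · rw [h1] at key; simpa using key
  · exact absurd rfl hrs

theorem proj_apply_of_mem {s : ZMod 2} {x : M} (h : x ∈ G.gr s) (r : ZMod 2) :
    G.proj r x = if r = s then x else 0 := by
  split_ifs with hrs
  · subst hrs; exact G.proj_of_mem h
  · exact G.proj_of_mem_ne h hrs

/-- Two linear maps agreeing on homogeneous elements are equal. -/
theorem hom_ext {f g : M →ₗ[k] N} (h : ∀ s, ∀ x ∈ G.gr s, f x = g x) : f = g := by
  ext x
  rw [← G.proj_add_proj x, map_add, map_add, h 0 _ (G.proj_mem 0 x), h 1 _ (G.proj_mem 1 x)]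

/-- A grading from two complementary families of projections. -/
def ofProj (gr : ZMod 2 → Submodule k M) (P : ZMod 2 → M →ₗ[k] M)
    (hmem : ∀ r x, P r x ∈ gr r) (hsum : ∀ x, P 0 x + P 1 x = x)
    (hz : ∀ r, ∀ x ∈ gr (r + 1), P r x = 0) : Grading k M where
  gr := gr
  isCompl := by
    constructor
    · rw [Submodule.disjoint_def]
      intro x h0 h1
      have e : (1 : ZMod 2) + 1 = 0 := by decide
      have a := hz 0 x (by simpa using h1)
      have b := hz 1 x (by rw [e]; exact h0)
      rw [← hsum x, a, b, add_zero]
    · rw [codisjoint_iff, eq_top_iff]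
      intro x _
      rw [← hsum x]
      exact Submodule.add_mem_sup (hmem 0 x) (hmem 1 x)

/-- The base ring, concentrated in even degree. -/
def base (k : Type u) [CommRing k] : Grading k k where
  gr r := if r = 0 then ⊤ else ⊥
  isCompl := by simpa using isCompl_top_bot

theorem base_zero (x : k) : x ∈ (base k).gr 0 := by simp [base]

/-! ### Homogeneous linear maps -/

/-- The linear maps of parity `r`: those shifting the parity of homogeneous vectors by `r`. -/
def homGr (r : ZMod 2) : Submodule k (M →ₗ[k] N) where
  carrier := {f | ∀ s, ∀ x ∈ G.gr s, f x ∈ H.gr (s + r)}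
  add_mem' hf hg s x hx := add_mem (hf s x hx) (hg s x hx)
  zero_mem' _ _ _ := zero_mem _
  smul_mem' c _ hf s x hx := Submodule.smul_mem _ c (hf s x hx)

/-- The component of parity `r` of a linear map between superspaces. -/
def component (r : ZMod 2) : (M →ₗ[k] N) →ₗ[k] (M →ₗ[k] N) where
  toFun f := H.proj (0 + r) ∘ₗ f ∘ₗ G.proj 0 + H.proj (1 + r) ∘ₗ f ∘ₗ G.proj 1
  map_add' f g := by ext x; simp; abel
  map_smul' c f := by ext x; simp

theorem component_apply_of_mem (r : ZMod 2) (f : M →ₗ[k] N) {s : ZMod 2} {x : M}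
    (h : x ∈ G.gr s) : component G H r f x = H.proj (s + r) (f x) := by
  simp only [component, LinearMap.coe_mk, AddHom.coe_mk, LinearMap.add_apply, LinearMap.comp_apply]
  rw [G.proj_apply_of_mem h, G.proj_apply_of_mem h]
  rcases zmod2_cases s with rfl | rfl <;> simp

theorem component_mem (r : ZMod 2) (f : M →ₗ[k] N) : component G H r f ∈ homGr G H r := by
  intro s x hx
  rw [component_apply_of_mem G H r f hx]
  exact H.proj_mem _ _

theorem component_add_component (f : M →ₗ[k] N) : component G H 0 f + component G H 1 f = f := by
  apply G.hom_ext
  intro s x hx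
  rw [LinearMap.add_apply, component_apply_of_mem G H _ f hx, component_apply_of_mem G H _ f hx]
  have e : (1 : ZMod 2) + 1 = 0 := by decide
  rcases zmod2_cases s with rfl | rfl
  · simpa using H.proj_add_proj (f x)
  · rw [add_zero, e, add_comm]; exact H.proj_add_proj (f x)

theorem component_of_mem {r s : ZMod 2} {f : M →ₗ[k] N} (h : f ∈ homGr G H s) :
    component G H r f = if r = s then f else 0 := by
  apply G.hom_ext
  intro t x hx
  rw [component_apply_of_mem G H r f hx, H.proj_apply_of_mem (h t x hx)]
  simp only [add_right_inj]
  split_ifs <;> simp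

theorem comp_mem_homGr {r s : ZMod 2} {f : M →ₗ[k] M'} {g : M' →ₗ[k] M''}
    (hf : f ∈ homGr G G' r) (hg : g ∈ homGr G' G'' s) : g ∘ₗ f ∈ homGr G G'' (r + s) := by
  intro t x hx
  rw [← add_assoc]
  exact hg _ _ (hf _ _ hx)

theorem id_mem_homGr : (LinearMap.id : M →ₗ[k] M) ∈ homGr G G 0 := by
  intro t x hx
  simpa using hx

theorem disjoint_homGr : Disjoint (homGr G H 0) (homGr G H 1) := by
  rw [Submodule.disjoint_def]
  intro f h0 h1
  rw [← component_add_component G H f, component_of_mem G H h1, component_of_mem G H h0]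
  simp

/-! ### Parity operators -/

/-- The operator `v ↦ (-1)^{r v̄} v`. -/
def par (r : ZMod 2) : M →ₗ[k] M := G.proj 0 + sgn (k := k) r • G.proj 1

theorem par_apply_of_mem (r : ZMod 2) {s : ZMod 2} {x : M} (h : x ∈ G.gr s) :
    G.par r x = sgn (k := k) (r * s) • x := by
  simp only [par, LinearMap.add_apply, LinearMap.smul_apply]
  rw [G.proj_apply_of_mem h, G.proj_apply_of_mem h]
  rcases zmod2_cases s with rfl | rfl <;> simp

theorem par_mem (r : ZMod 2) : G.par r ∈ homGr G G 0 := by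
  intro s x hx
  rw [par_apply_of_mem G r hx, add_zero]
  exact Submodule.smul_mem _ _ hx

@[simp] theorem par_zero : G.par 0 = LinearMap.id := by
  apply G.hom_ext
  intro s x hx
  rw [par_apply_of_mem G _ hx]; simp

theorem par_comp_par (r s : ZMod 2) : G.par r ∘ₗ G.par s = G.par (r + s) := by
  apply G.hom_ext
  intro t x hx
  rw [LinearMap.comp_apply, par_apply_of_mem G _ hx, map_smul, par_apply_of_mem G _ hx,
    par_apply_of_mem G _ hx, smul_smul, ← sgn_add, add_mul, add_comm]

theorem par_comp_of_mem {s : ZMod 2} {f : M →ₗ[k] N} (h : f ∈ homGr G H s) (r : ZMod 2) :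
    H.par r ∘ₗ f = sgn (k := k) (r * s) • (f ∘ₗ G.par r) := by
  apply G.hom_ext
  intro t x hx
  rw [LinearMap.comp_apply, par_apply_of_mem H _ (h t x hx), LinearMap.smul_apply,
    LinearMap.comp_apply, par_apply_of_mem G _ hx, map_smul, smul_smul, ← sgn_add, mul_add,
    add_comm]

/-! ### Tensor products -/

/-- The tensor product of superspaces: `v ⊗ w` has parity `v̄ + w̄`. -/
def tensorGr (r : ZMod 2) : Submodule k (M ⊗[k] N) :=
  Submodule.span k {x | ∃ s t, s + t = r ∧ ∃ v ∈ G.gr s, ∃ w ∈ H.gr t, v ⊗ₜ[k] w = x}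

theorem tmul_mem_tensorGr {s t : ZMod 2} {v : M} {w : N} (hv : v ∈ G.gr s) (hw : w ∈ H.gr t) :
    v ⊗ₜ[k] w ∈ tensorGr G H (s + t) :=
  Submodule.subset_span ⟨s, t, rfl, v, hv, w, hw, rfl⟩

/-- The grading on the tensor product of two superspaces. -/
def tensor : Grading k (M ⊗[k] N) :=
  ofProj (tensorGr G H)
    (fun r => TensorProduct.map (G.proj 0) (H.proj r) + TensorProduct.map (G.proj 1) (H.proj (1 + r)))
    (by
      intro r x
      induction x using TensorProduct.induction_on with
      | zero => simp
      | add x y hx hy => rw [map_add]; exact add_mem hx hy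
      | tmul v w =>
        simp only [LinearMap.add_apply, TensorProduct.map_tmul]
        refine add_mem ?_ ?_
        · simpa using tmul_mem_tensorGr G H (G.proj_mem 0 v) (H.proj_mem r w)
        · have := tmul_mem_tensorGr G H (G.proj_mem 1 v) (H.proj_mem (1 + r) w)
          have e : (1 : ZMod 2) + (1 + r) = r := by clear this; revert r; decide
          rwa [e] at this)
    (by
      intro x
      induction x using TensorProduct.induction_on with
      | zero => simp
      | add x y hx hy =>
        conv_rhs => rw [← hx, ← hy]
        simp only [map_add]; abel
      | tmul v w =>
        have e : (1 : ZMod 2) + 1 = 0 := by decide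
        simp only [LinearMap.add_apply, TensorProduct.map_tmul, e, add_zero]
        conv_rhs => rw [← G.proj_add_proj v, ← H.proj_add_proj w]
        simp only [TensorProduct.add_tmul, TensorProduct.tmul_add]; abel)
    (by
      intro r x hx
      induction hx using Submodule.span_induction with
      | zero => simp
      | add x y _ _ hx hy => rw [map_add, hx, hy, add_zero]
      | smul c x _ hx => rw [map_smul, hx, smul_zero]
      | mem x hx =>
        obtain ⟨s, t, hst, v, hv, w, hw, rfl⟩ := hx
        simp only [LinearMap.add_apply, TensorProduct.map_tmul]
        rw [G.proj_apply_of_mem hv, G.proj_apply_of_mem hv, H.proj_apply_of_mem hw,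
          H.proj_apply_of_mem hw]
        have h1 : (0 = s → r = t → False) := by rintro rfl rfl; clear hv hw; revert hst; revert r; decide
        have h2 : (1 = s → 1 + r = t → False) := by rintro rfl rfl; clear hv hw h1; revert hst; revert r; decide
        split_ifs <;> simp_all)

theorem tensor_gr (r : ZMod 2) : (tensor G H).gr r = tensorGr G H r := rfl

theorem tmul_mem {s t : ZMod 2} {v : M} {w : N} (hv : v ∈ G.gr s) (hw : w ∈ H.gr t) :
    v ⊗ₜ[k] w ∈ (tensor G H).gr (s + t) := tmul_mem_tensorGr G H hv hw

/-- To check that a map out of a tensor product is homogeneous, test it on pure tensors of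
homogeneous vectors. -/
theorem mem_homGr_tensor {r : ZMod 2} {f : M ⊗[k] N →ₗ[k] M'}
    (h : ∀ s t, ∀ v ∈ G.gr s, ∀ w ∈ H.gr t, f (v ⊗ₜ[k] w) ∈ G'.gr (s + t + r)) :
    f ∈ homGr (tensor G H) G' r := by
  intro s x hx
  rw [tensor_gr] at hx
  induction hx using Submodule.span_induction with
  | zero => simp
  | add x y _ _ hx hy => rw [map_add]; exact add_mem hx hy
  | smul c x _ hx => rw [map_smul]; exact Submodule.smul_mem _ _ hx
  | mem x hx =>
    obtain ⟨s, t, rfl, v, hv, w, hw, rfl⟩ := hx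
    exact h s t v hv w hw

theorem tensor_hom_ext {f g : M ⊗[k] N →ₗ[k] M'}
    (h : ∀ s t, ∀ v ∈ G.gr s, ∀ w ∈ H.gr t, f (v ⊗ₜ[k] w) = g (v ⊗ₜ[k] w)) : f = g := by
  apply TensorProduct.ext
  apply G.hom_ext
  intro s v hv
  apply H.hom_ext
  intro t w hw
  exact h s t v hv w hw

/-- The tensor product of linear maps of superspaces, with the sign rule
`(f ⊗ g) (v ⊗ w) = (-1)^{ḡ v̄} f v ⊗ g w` for homogeneous `g`, `v`. -/
def tensorMap : (M →ₗ[k] M') →ₗ[k] (N →ₗ[k] N') →ₗ[k] (M ⊗[k] N →ₗ[k] M' ⊗[k] N') :=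
  LinearMap.mk₂ k
    (fun f g => TensorProduct.map f (component H H' 0 g)
      + TensorProduct.map (f ∘ₗ G.par 1) (component H H' 1 g))
    (by intro f f' g; simp only [LinearMap.add_comp, TensorProduct.map_add_left]; abel)
    (by intro c f g; simp only [LinearMap.smul_comp, TensorProduct.map_smul_left, smul_add])
    (by intro f g g'; simp only [map_add, TensorProduct.map_add_right]; abel)
    (by intro c f g; simp only [map_smul, TensorProduct.map_smul_right, smul_add])

theorem tensorMap_of_mem (f : M →ₗ[k] M') {r : ZMod 2} {g : N →ₗ[k] N'} (hg : g ∈ homGr H H' r) :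
    tensorMap G H H' f g = TensorProduct.map (f ∘ₗ G.par r) g := by
  simp only [tensorMap, LinearMap.mk₂_apply]
  rw [component_of_mem H H' hg, component_of_mem H H' hg]
  rcases zmod2_cases r with rfl | rfl <;> simp

theorem tensorMap_tmul (f : M →ₗ[k] M') {r : ZMod 2} {g : N →ₗ[k] N'} (hg : g ∈ homGr H H' r)
    {s : ZMod 2} {v : M} (hv : v ∈ G.gr s) (w : N) :
    tensorMap G H H' f g (v ⊗ₜ[k] w) = sgn (k := k) (r * s) • (f v ⊗ₜ[k] g w) := by
  rw [tensorMap_of_mem G H H' f hg, TensorProduct.map_tmul, LinearMap.comp_apply,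
    par_apply_of_mem G r hv, map_smul, TensorProduct.smul_tmul']

theorem tensorMap_mem {r s : ZMod 2} {f : M →ₗ[k] M'} {g : N →ₗ[k] N'}
    (hf : f ∈ homGr G G' r) (hg : g ∈ homGr H H' s) :
    tensorMap G H H' f g ∈ homGr (tensor G H) (tensor G' H') (r + s) := by
  apply mem_homGr_tensor
  intro a b v hv w hw
  rw [tensorMap_tmul G H H' f hg hv]
  apply Submodule.smul_mem
  have := tmul_mem G' H' (hf a v hv) (hg b w hw)
  have e : a + r + (b + s) = a + b + (r + s) := by ring
  rwa [e] at this

theorem tensorMap_comp {r s : ZMod 2} (f' : M' →ₗ[k] M'') {g' : N' →ₗ[k] N''}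
    {f : M →ₗ[k] M'} (g : N →ₗ[k] N') (hg' : g' ∈ homGr H' H'' r) (hf : f ∈ homGr G G' s) :
    tensorMap G' H' H'' f' g' ∘ₗ tensorMap G H H' f g
      = sgn (k := k) (r * s) • tensorMap G H H'' (f' ∘ₗ f) (g' ∘ₗ g) := by
  have key : ∀ t, ∀ g ∈ homGr H H' t, tensorMap G' H' H'' f' g' ∘ₗ tensorMap G H H' f g
      = sgn (k := k) (r * s) • tensorMap G H H'' (f' ∘ₗ f) (g' ∘ₗ g) := by
    intro t g hg
    apply tensor_hom_ext G H
    intro a b v hv w hw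
    rw [LinearMap.smul_apply, LinearMap.comp_apply, tensorMap_tmul G H H' f hg hv, map_smul,
      tensorMap_tmul G' H' H'' f' hg' (hf a v hv), smul_smul,
      tensorMap_tmul G H H'' _ (comp_mem_homGr H H' H'' hg hg') hv, smul_smul, ← sgn_add, ← sgn_add]
    congr 2
    ring
  rw [← component_add_component H H' g]
  simp only [map_add, LinearMap.comp_add, smul_add]
  rw [key 0 _ (component_mem H H' 0 g), key 1 _ (component_mem H H' 1 g)]

theorem tensorMap_id : tensorMap G H H (LinearMap.id : M →ₗ[k] M) LinearMap.id = LinearMap.id := by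
  rw [tensorMap_of_mem G H H _ (id_mem_homGr H)]
  simp

/-- The superflip `v ⊗ w ↦ (-1)^{v̄ w̄} w ⊗ v`. -/
def flip : M ⊗[k] N →ₗ[k] N ⊗[k] M :=
  ∑ r : ZMod 2, (TensorProduct.comm k M N).toLinearMap ∘ₗ TensorProduct.map (G.proj r) (H.par r)

theorem flip_tmul {r s : ZMod 2} {v : M} {w : N} (hv : v ∈ G.gr r) (hw : w ∈ H.gr s) :
    flip G H (v ⊗ₜ[k] w) = sgn (k := k) (r * s) • (w ⊗ₜ[k] v) := by
  simp only [flip, LinearMap.sum_apply, LinearMap.comp_apply, TensorProduct.map_tmul]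
  rw [Finset.sum_eq_single r]
  · rw [G.proj_of_mem hv, par_apply_of_mem H r hw]
    simp [TensorProduct.smul_tmul']
  · intro b _ hb
    rw [G.proj_of_mem_ne hv hb]; simp
  · simp

/-! ### Duals -/

/-- The grading on the dual space: a functional of parity `r` vanishes on the vectors of
parity different from `r`. -/
def dual : Grading k (Module.Dual k M) :=
  ofProj (fun r => homGr G (base k) r)
    (fun r => component G (base k) r)
    (fun r f => component_mem G (base k) r f)
    (fun f => component_add_component G (base k) f)
    (fun r f hf => by
      rw [component_of_mem G (base k) hf]
      have : ¬ (r = r + 1) := by clear hf; revert r; decide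
      simp [this])

/-- The supertranspose `(a^* f)(v) = (-1)^{ā f̄} f (a v)` of an endomorphism `a`. -/
def transpose : Module.End k M →ₗ[k] Module.End k (Module.Dual k M) where
  toFun a :=
    { toFun := fun f => f ∘ₗ component G G 0 a + (dual G).par 1 f ∘ₗ component G G 1 a
      map_add' := by intro f g; simp only [map_add, LinearMap.add_comp]; abel
      map_smul' := by intro c f; simp only [map_smul, LinearMap.smul_comp, smul_add, RingHom.id_apply] }
  map_add' a b := by
    ext f x
    simp only [map_add, LinearMap.comp_add, LinearMap.coe_mk, AddHom.coe_mk, LinearMap.add_apply]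
    abel
  map_smul' c a := by
    ext f x
    simp

theorem transpose_of_mem {r : ZMod 2} {a : Module.End k M} (ha : a ∈ homGr G G r)
    (f : Module.Dual k M) : transpose G a f = (dual G).par r f ∘ₗ a := by
  simp only [transpose, LinearMap.coe_mk, AddHom.coe_mk]
  rw [component_of_mem G G ha, component_of_mem G G ha]
  rcases zmod2_cases r with rfl | rfl <;> simp

theorem transpose_apply {r s : ZMod 2} {a : Module.End k M} (ha : a ∈ homGr G G r)
    {f : Module.Dual k M} (hf : f ∈ (dual G).gr s) :
    transpose G a f = sgn (k := k) (r * s) • (f ∘ₗ a) := by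
  rw [transpose_of_mem G ha, par_apply_of_mem _ r hf, LinearMap.smul_comp]

theorem dual_comp_mem {r s : ZMod 2} {a : Module.End k M} (ha : a ∈ homGr G G r)
    {f : Module.Dual k M} (hf : f ∈ (dual G).gr s) : f ∘ₗ a ∈ (dual G).gr (r + s) :=
  comp_mem_homGr G G (base k) ha hf

theorem transpose_mem {r : ZMod 2} {a : Module.End k M} (ha : a ∈ homGr G G r) :
    transpose G a ∈ homGr (dual G) (dual G) r := by
  intro s f hf
  rw [transpose_apply G ha hf, add_comm]
  exact Submodule.smul_mem _ _ (dual_comp_mem G ha hf)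

theorem transpose_comp {r s : ZMod 2} {a b : Module.End k M} (ha : a ∈ homGr G G r)
    (hb : b ∈ homGr G G s) :
    transpose G a * transpose G b = sgn (k := k) (r * s) • transpose G (b * a) := by
  apply (dual G).hom_ext
  intro t f hf
  have hba : b * a ∈ homGr G G (r + s) := comp_mem_homGr G G G ha hb
  rw [LinearMap.smul_apply, transpose_apply G hba hf, Module.End.mul_apply,
    transpose_apply G hb hf, map_smul, transpose_apply G ha (dual_comp_mem G hb hf), smul_smul,
    smul_smul, ← sgn_add, ← sgn_add]
  refine congrArg₂ (· • ·) (congrArg _ ?_) rfl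
  ring

theorem transpose_one : transpose G (1 : Module.End k M) = 1 := by
  ext f : 1
  have : (1 : Module.End k M) ∈ homGr G G 0 := id_mem_homGr G
  rw [transpose_of_mem G this]
  simp [Module.End.one_eq_id]

end Grading

/-! ## The quantum isomeric superalgebra -/

/-- The index set `I = {-n, …, -1, 1, …, n}`, with the order of the integers. -/
abbrev Idx (n : ℕ) : Type := {i : ℤ // i ∈ (Finset.Icc (-(n : ℤ)) n).erase 0}

namespace Idx
variable {n : ℕ}

instance : Neg (Idx n) where
  neg i := ⟨-i.1, by
    have := i.2
    simp only [Finset.mem_erase, Finset.mem_Icc] at this ⊢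
    omega⟩

@[simp] theorem val_neg (i : Idx n) : (-i).1 = -i.1 := rfl

theorem val_ne_zero (i : Idx n) : i.1 ≠ 0 := (Finset.mem_erase.1 i.2).1

theorem neg_neg' (i : Idx n) : - -i = i := Subtype.ext (neg_neg i.1)

/-- The parity `p(i)`. -/
def p (i : Idx n) : ZMod 2 := if i.1 < 0 then 1 else 0

/-- `φ(i,j) = δ_{|i|,|j|} sgn(j)`. -/
def phi (i j : Idx n) : ℤ := if |i.1| = |j.1| then (if j.1 < 0 then -1 else 1) else 0

end Idx

section
variable {K : Type u} [Field K] (q : Kˣ) (n : ℕ)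

/-- `z = q - q⁻¹`. -/
def zq : K := (q : K) - ((q⁻¹ : Kˣ) : K)

variable {n}

/-- The matrices `Θ_{ij}` for which
`Θ = ∑_{i,j} Θ_{ij} ⊗ E_{ij}
   = ∑_{i,j} q^{φ(i,j)} E_{ii} ⊗ E_{jj} + z ∑_{i<j} (-1)^{p(i)} (E_{ji} + E_{-j,-i}) ⊗ E_{ij}`. -/
def Theta (i j : Idx n) : Matrix (Idx n) (Idx n) K :=
  if i = j then Matrix.diagonal fun k => ((q ^ Idx.phi k i : Kˣ) : K)
  else if i < j then
    (zq q * sgn i.p) • (Matrix.single j i (1 : K) + Matrix.single (-j) (-i) (1 : K))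
  else 0

variable (n)

/-- The generators `u_{ij}`, `i ≤ j`. -/
abbrev UqGen : Type := {ij : Idx n × Idx n // ij.1 ≤ ij.2}

variable (K) {n} in
/-- The generator `u_{ij}` of the free algebra, with `u_{ij} = 0` for `i > j`. -/
def freeU (i j : Idx n) : FreeAlgebra K (UqGen n) :=
  if h : i ≤ j then FreeAlgebra.ι K ⟨(i, j), h⟩ else 0

/-- The defining relations of `U_q(𝔮_n)`. The relation `yb i b k d` compares the coefficients of
`E_{ib} ⊗ E_{kd}` on the two sides of `L¹² L¹³ Θ²³ = Θ²³ L¹³ L¹²`. Here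
`L¹² L¹³ = ∑ (-1)^{p(i,j) p(k,l)} u_{ij} u_{kl} ⊗ E_{ij} ⊗ E_{kl}`,
`L¹³ L¹² = ∑ u_{ld} u_{jb} ⊗ E_{jb} ⊗ E_{ld}`,
the coefficient of `E_{jb} ⊗ E_{ld}` in `Θ` is `Theta q l d j b`, and
`(E_{ij} ⊗ E_{kl}) (E_{jb} ⊗ E_{ld}) = (-1)^{p(k,l) p(j,b)} E_{ib} ⊗ E_{kd}`. -/
inductive UqRel : FreeAlgebra K (UqGen n) → FreeAlgebra K (UqGen n) → Prop
  | diag (i : Idx n) : UqRel (freeU K i i * freeU K (-i) (-i)) 1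
  | yb (i b k d : Idx n) : UqRel
      (∑ j, ∑ l, (sgn ((i.p + j.p) * (k.p + l.p)) * sgn ((k.p + l.p) * (j.p + b.p))
        * Theta q l d j b) • (freeU K i j * freeU K k l))
      (∑ j, ∑ l, (sgn ((k.p + l.p) * (j.p + b.p)) * Theta q k l i j)
        • (freeU K l d * freeU K j b))

/-- The quantum isomeric superalgebra `U_q(𝔮_n)`. -/
def Uq : Type u := RingQuot (UqRel q n)

instance : Ring (Uq q n) := inferInstanceAs (Ring (RingQuot (UqRel q n)))
instance : Algebra K (Uq q n) := inferInstanceAs (Algebra K (RingQuot (UqRel q n)))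

namespace Uq

/-- The quotient map from the free algebra. -/
def mk : FreeAlgebra K (UqGen n) →ₐ[K] Uq q n := RingQuot.mkAlgHom K (UqRel q n)

variable {n}

/-- The generator `u_{ij}` (zero for `i > j`). -/
def gen (i j : Idx n) : Uq q n := mk q n (freeU K i j)

theorem gen_of_lt {i j : Idx n} (h : j < i) : gen q i j = 0 := by
  simp [gen, freeU, not_le.2 h]

theorem gen_diag (i : Idx n) : gen q i i * gen q (-i) (-i) = 1 := by
  have := RingQuot.mkAlgHom_rel K (UqRel.diag (q := q) i)
  change mk q n _ = mk q n _ at this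
  simp only [map_mul, map_one] at this
  exact this

theorem gen_yb (i b k d : Idx n) :
    ∑ j, ∑ l, (sgn ((i.p + j.p) * (k.p + l.p)) * sgn ((k.p + l.p) * (j.p + b.p))
        * Theta q l d j b) • (gen q i j * gen q k l)
      = ∑ j, ∑ l, (sgn ((k.p + l.p) * (j.p + b.p)) * Theta q k l i j)
        • (gen q l d * gen q j b) := by
  have := RingQuot.mkAlgHom_rel K (UqRel.yb (q := q) i b k d)
  change mk q n _ = mk q n _ at this
  simp only [map_sum, map_smul, map_mul] at this
  exact this

/-- Families of operators that satisfy the defining relations. -/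
structure IsRep {A : Type v} [Ring A] [Algebra K A] (t : Idx n → Idx n → A) : Prop where
  lt : ∀ i j, j < i → t i j = 0
  diag : ∀ i, t i i * t (-i) (-i) = 1
  yb : ∀ i b k d, ∑ j, ∑ l, (sgn ((i.p + j.p) * (k.p + l.p)) * sgn ((k.p + l.p) * (j.p + b.p))
        * Theta q l d j b) • (t i j * t k l)
      = ∑ j, ∑ l, (sgn ((k.p + l.p) * (j.p + b.p)) * Theta q k l i j) • (t l d * t j b)

/-- The universal property of `U_q(𝔮_n)`. -/
def lift {A : Type v} [Ring A] [Algebra K A] (t : Idx n → Idx n → A) (h : IsRep q t) :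
    Uq q n →ₐ[K] A :=
  RingQuot.liftAlgHom K ⟨FreeAlgebra.lift K fun ij : UqGen n => t ij.1.1 ij.1.2, by
    have hu : ∀ i j, FreeAlgebra.lift K (fun ij : UqGen n => t ij.1.1 ij.1.2) (freeU K i j)
        = t i j := by
      intro i j
      by_cases hij : i ≤ j
      · simp [freeU, hij]
      · simp [freeU, hij, h.lt i j (not_le.1 hij)]
    intro x y hxy
    cases hxy with
    | diag i => simpa only [map_mul, hu, map_one] using h.diag i
    | yb i b k d => simpa only [map_sum, map_smul, map_mul, hu] using h.yb i b k d⟩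

@[simp] theorem lift_gen {A : Type v} [Ring A] [Algebra K A] (t : Idx n → Idx n → A)
    (h : IsRep q t) (i j : Idx n) : lift q t h (gen q i j) = t i j := by
  have : lift q t h (gen q i j) = FreeAlgebra.lift K (fun ij : UqGen n => t ij.1.1 ij.1.2)
      (freeU K i j) := RingQuot.liftAlgHom_mkAlgHom_apply K _ _ _
  rw [this]
  by_cases hij : i ≤ j
  · simp [freeU, hij]
  · simp [freeU, hij, h.lt i j (not_le.1 hij)]

theorem isRep_gen : IsRep q (gen q (n := n)) :=
  ⟨fun _ _ h => gen_of_lt q h, gen_diag q, gen_yb q⟩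

theorem IsRep.map {A : Type v} [Ring A] [Algebra K A] {B : Type w} [Ring B] [Algebra K B]
    {t : Idx n → Idx n → A} (h : IsRep q t) (f : A →ₐ[K] B) : IsRep q fun i j => f (t i j) where
  lt i j hij := by rw [h.lt i j hij, map_zero]
  diag i := by rw [← map_mul, h.diag, map_one]
  yb i b k d := by
    have := congrArg f (h.yb i b k d)
    simpa only [map_sum, map_smul, map_mul] using this

/-- The monomial in the generators with the given list of index pairs. -/
def monomial (l : List (Idx n × Idx n)) : Uq q n := (l.map fun ij => gen q ij.1 ij.2).prod

/-- The parity of a monomial, each `u_{ij}` having parity `p(i,j) = p(i) + p(j)`. -/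
def monomialParity (l : List (Idx n × Idx n)) : ZMod 2 := (l.map fun ij => ij.1.p + ij.2.p).sum

/-- The homogeneous component of parity `r` of `U_q(𝔮_n)`. -/
def gr (r : ZMod 2) : Submodule K (Uq q n) :=
  Submodule.span K {x | ∃ l, monomialParity l = r ∧ monomial q l = x}

theorem gen_mem_gr (i j : Idx n) : gen q i j ∈ gr q (i.p + j.p) :=
  Submodule.subset_span ⟨[(i, j)], by simp [monomialParity], by simp [monomial]⟩

theorem one_mem_gr : (1 : Uq q n) ∈ gr q 0 :=
  Submodule.subset_span ⟨[], by simp [monomialParity], by simp [monomial]⟩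

theorem mul_mem_gr {r s : ZMod 2} {x y : Uq q n} (hx : x ∈ gr q r) (hy : y ∈ gr q s) :
    x * y ∈ gr q (r + s) := by
  induction hx using Submodule.span_induction with
  | zero => simp
  | add a b _ _ ha hb => rw [add_mul]; exact add_mem ha hb
  | smul c a _ ha => rw [smul_mul_assoc]; exact Submodule.smul_mem _ _ ha
  | mem x hx =>
    induction hy using Submodule.span_induction with
    | zero => simp
    | add a b _ _ ha hb => rw [mul_add]; exact add_mem ha hb
    | smul c a _ ha => rw [mul_smul_comm]; exact Submodule.smul_mem _ _ ha
    | mem y hy =>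
      obtain ⟨l, rfl, rfl⟩ := hx
      obtain ⟨l', rfl, rfl⟩ := hy
      exact Submodule.subset_span ⟨l ++ l', by simp [monomialParity], by simp [monomial]⟩

/-! ### The inverse of `L` -/

/-- The matrix `L` of generators. -/
def L : Matrix (Idx n) (Idx n) (Uq q n) := Matrix.of fun i j => gen q i j

variable (n) in
/-- The ring of upper triangular matrices over `U_q(𝔮_n)` with `(i,j)` entry of parity `p(i,j)`. -/
def evenTriangular : Subring (Matrix (Idx n) (Idx n) (Uq q n)) where
  carrier := {X | (∀ i j, j < i → X i j = 0) ∧ ∀ i j : Idx n, X i j ∈ gr q (i.p + j.p)}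
  zero_mem' := ⟨fun _ _ _ => rfl, fun _ _ => zero_mem _⟩
  one_mem' := by
    refine ⟨fun i j h => Matrix.one_apply_ne (ne_of_gt h), fun i j => ?_⟩
    by_cases h : i = j
    · subst h
      rw [Matrix.one_apply_eq]
      have e : i.p + i.p = 0 := by generalize i.p = a; revert a; decide
      rw [e]
      exact one_mem_gr q
    · rw [Matrix.one_apply_ne h]; exact zero_mem _
  add_mem' := by
    rintro X Y ⟨h1, h2⟩ ⟨h3, h4⟩
    exact ⟨fun i j h => by rw [Matrix.add_apply, h1 i j h, h3 i j h, add_zero],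
      fun i j => add_mem (h2 i j) (h4 i j)⟩
  neg_mem' := by
    rintro X ⟨h1, h2⟩
    exact ⟨fun i j h => by rw [Matrix.neg_apply, h1 i j h, neg_zero], fun i j => neg_mem (h2 i j)⟩
  mul_mem' := by
    rintro X Y ⟨h1, h2⟩ ⟨h3, h4⟩
    refine ⟨fun i j h => ?_, fun i j => ?_⟩
    · rw [Matrix.mul_apply]
      apply Finset.sum_eq_zero
      intro m _
      rcases lt_or_ge m i with hm | hm
      · rw [h1 i m hm, zero_mul]
      · rw [h3 m j (lt_of_lt_of_le h hm), mul_zero]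
    · rw [Matrix.mul_apply]
      apply sum_mem
      intro m _
      have := mul_mem_gr q (h2 i m) (h4 m j)
      have e : i.p + m.p + (m.p + j.p) = i.p + j.p := by
        generalize i.p = a; generalize m.p = b; generalize j.p = c; revert a b c; decide
      rwa [e] at this

theorem L_mem : L q ∈ evenTriangular q n :=
  ⟨fun _ _ h => gen_of_lt q h, fun i j => gen_mem_gr q i j⟩

theorem isNilpotent_of_strict {N : Matrix (Idx n) (Idx n) (Uq q n)}
    (h : ∀ i j, j ≤ i → N i j = 0) : IsNilpotent N := by
  have key : ∀ m : ℕ, ∀ i j : Idx n, j.1 < i.1 + m → (N ^ m) i j = 0 := by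
    intro m
    induction m with
    | zero =>
      intro i j hij
      rw [pow_zero, Matrix.one_apply_ne]
      rintro rfl
      simp at hij
    | succ m ih =>
      intro i j hij
      rw [pow_succ, Matrix.mul_apply]
      apply Finset.sum_eq_zero
      intro k _
      by_cases hk : k.1 < i.1 + m
      · rw [ih i k hk, zero_mul]
      · rw [h k j (by change j.1 ≤ k.1; push_cast at hij; omega), mul_zero]
  refine ⟨2 * n + 1, ?_⟩
  ext i j
  rw [key _ i j, Matrix.zero_apply]
  have hi := i.2
  have hj := j.2
  simp only [Finset.mem_erase, Finset.mem_Icc] at hi hj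
  push_cast
  omega

/-- `L` is invertible, with inverse of the same shape. -/
theorem exists_inverse_L : ∃ S ∈ evenTriangular q n, S * L q = 1 ∧ L q * S = 1 := by
  let D : Matrix (Idx n) (Idx n) (Uq q n) := Matrix.diagonal fun i => gen q (-i) (-i)
  let D' : Matrix (Idx n) (Idx n) (Uq q n) := Matrix.diagonal fun i => gen q i i
  have hg : ∀ i : Idx n, gen q (-i) (-i) * gen q i i = 1 := by
    intro i
    have := gen_diag q (-i)
    rwa [Idx.neg_neg'] at this
  have hDD' : D * D' = 1 := by
    simp only [D, D', Matrix.diagonal_mul_diagonal, hg, Matrix.diagonal_one]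
  have hD'D : D' * D = 1 := by
    simp only [D, D', Matrix.diagonal_mul_diagonal, gen_diag, Matrix.diagonal_one]
  have hp : ∀ a : ZMod 2, a + a = 0 := by decide
  have hD : D ∈ evenTriangular q n := by
    refine ⟨fun i j h => Matrix.diagonal_apply_ne _ (ne_of_gt h), fun i j => ?_⟩
    by_cases h : i = j
    · subst h
      simp only [D, Matrix.diagonal_apply_eq]
      have := gen_mem_gr q (-i) (-i)
      rwa [hp] at this ⊢
    · simp only [D, Matrix.diagonal_apply_ne _ h]; exact zero_mem _
  let N := 1 - D * L q
  have hN : N ∈ evenTriangular q n := sub_mem (one_mem _) (mul_mem hD (L_mem q))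
  have hN' : IsNilpotent N := by
    apply isNilpotent_of_strict
    intro i j hij
    rcases lt_or_eq_of_le hij with h | rfl
    · exact hN.1 i j h
    · simp only [N, D, Matrix.sub_apply, Matrix.diagonal_mul, Matrix.one_apply_eq, L, Matrix.of_apply,
        hg, sub_self]
  obtain ⟨m, hm⟩ := hN'
  let Gs := ∑ a ∈ Finset.range m, N ^ a
  have hGs : Gs ∈ evenTriangular q n := sum_mem fun a _ => pow_mem hN a
  have h1 : Gs * (D * L q) = 1 := by
    have := geom_sum_mul_neg N m
    rw [hm, sub_zero] at this
    have e : 1 - N = D * L q := by simp [N]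
    rwa [e] at this
  have h2 : (D * L q) * Gs = 1 := by
    have := mul_neg_geom_sum N m
    rw [hm, sub_zero] at this
    have e : 1 - N = D * L q := by simp [N]
    rwa [e] at this
  refine ⟨Gs * D, mul_mem hGs hD, by rw [mul_assoc, h1], ?_⟩
  calc L q * (Gs * D) = (D' * D) * (L q * (Gs * D)) := by rw [hD'D, one_mul]
    _ = D' * ((D * L q) * Gs) * D := by simp only [mul_assoc]
    _ = 1 := by rw [h2, mul_one, hD'D]

/-- The values `S(u_{ij})` of the antipode on the generators: the entries of `L⁻¹`. -/
def antipodeGen (i j : Idx n) : Uq q n := (Ring.inverse (L q)) i j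

theorem inverse_L_spec : Ring.inverse (L q (n := n)) ∈ evenTriangular q n ∧
    Ring.inverse (L q (n := n)) * L q = 1 ∧ L q * Ring.inverse (L q (n := n)) = 1 := by
  obtain ⟨S, hS, h1, h2⟩ := exists_inverse_L q (n := n)
  let U : (Matrix (Idx n) (Idx n) (Uq q n))ˣ := ⟨L q, S, h2, h1⟩
  have : Ring.inverse (L q (n := n)) = S := Ring.inverse_unit U
  rw [this]
  exact ⟨hS, h1, h2⟩

end Uq

end

/-! ## The natural representation -/

section
variable {K : Type u} [Field K] (q : Kˣ)

namespace YangBaxter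

/-- The parity of an integer index. -/
def pI (a : ℤ) : ZMod 2 := if a < 0 then 1 else 0

/-- `φ` for integer indices. -/
def phiI (a b : ℤ) : ℤ := if |a| = |b| then (if b < 0 then -1 else 1) else 0

/-- The action of `Θ` on a pair of basis vectors, paired with a test function. -/
def R (a b : ℤ) (g : ℤ → ℤ → K) : K :=
  ((q ^ phiI a b : Kˣ) : K) * g a b + (if a < b then zq q * sgn (pI a) * g b a else 0)
    + (if -a < b then zq q * sgn (pI (-a)) * g (-b) (-a) else 0)

theorem pI_pos {a : ℤ} (h : 0 < a) : pI a = 0 := by simp [pI, not_lt.2 h.le]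
theorem pI_neg {a : ℤ} (h : 0 < a) : pI (-a) = 1 := by simp [pI, h]

variable {q} in
theorem sgn_cases (a : ZMod 2) : sgn (k := K) a = 1 ∨ sgn (k := K) a = -1 := by
  rcases zmod2_cases a with rfl | rfl <;> simp

theorem phiI_lt {a b : ℤ} (ha : 0 < a) (h : a < b) : phiI a b = 0 ∧ phiI a (-b) = 0 ∧
    phiI (-a) b = 0 ∧ phiI (-a) (-b) = 0 ∧ phiI b a = 0 ∧ phiI b (-a) = 0 ∧
    phiI (-b) a = 0 ∧ phiI (-b) (-a) = 0 := by
  simp only [phiI, abs_neg, abs_of_pos ha, abs_of_pos (ha.trans h), h.ne, h.ne', if_false, and_self]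

section
variable {a b : ℤ} (g : ℤ → ℤ → K)

theorem R_pp_lt (ha : 0 < a) (h : a < b) :
    R q a b g = g a b + zq q * g b a - zq q * g (-b) (-a) := by
  have := phiI_lt ha h
  rw [R, if_pos h, if_pos (by omega), pI_pos ha, pI_neg ha, this.1]
  simp; ring

theorem R_pp_gt (hb : 0 < b) (h : b < a) :
    R q a b g = g a b - zq q * g (-b) (-a) := by
  have := phiI_lt hb h
  have ha : 0 < a := by omega
  rw [R, if_neg (by omega), if_pos (by omega), pI_neg ha, this.2.2.2.2.1]
  simp; ring

theorem R_pp_eq (ha : 0 < a) :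
    R q a a g = q * g a a - zq q * g (-a) (-a) := by
  rw [R, if_neg (by omega), if_pos (by omega), pI_neg ha, phiI, if_pos rfl, if_neg (by omega)]
  simp; ring

theorem R_pn_lt (ha : 0 < a) (h : a < b) : R q a (-b) g = g a (-b) := by
  have := phiI_lt ha h
  rw [R, if_neg (by omega), if_neg (by omega), this.2.1]
  simp

theorem R_pn_gt (hb : 0 < b) (h : b < a) :
    R q a (-b) g = g a (-b) - zq q * g b (-a) := by
  have := phiI_lt hb h
  have ha : 0 < a := by omega
  rw [R, if_neg (by omega), if_pos (by omega), pI_neg ha, this.2.2.2.2.2.1]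
  simp; ring

theorem R_pn_eq (ha : 0 < a) : R q a (-a) g = (q : K)⁻¹ * g a (-a) := by
  rw [R, if_neg (by omega), if_neg (by omega), phiI, if_pos (by simp), if_pos (by omega)]
  simp

theorem R_np_lt (ha : 0 < a) (h : a < b) :
    R q (-a) b g = g (-a) b - zq q * g b (-a) + zq q * g (-b) a := by
  have := phiI_lt ha h
  rw [R, if_pos (by omega), if_pos (by omega), neg_neg, pI_neg ha, pI_pos ha, this.2.2.1]
  simp; ring

theorem R_np_gt (hb : 0 < b) (h : b < a) :
    R q (-a) b g = g (-a) b - zq q * g b (-a) := by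
  have ha : 0 < a := by omega
  have : phiI (-a) b = 0 := by
    simp only [phiI, abs_neg, abs_of_pos ha, abs_of_pos hb, h.ne', if_false]
  rw [R, if_pos (by omega), if_neg (by omega), pI_neg ha, this]
  simp; ring

theorem R_np_eq (ha : 0 < a) :
    R q (-a) a g = q * g (-a) a - zq q * g a (-a) := by
  rw [R, if_pos (by omega), if_neg (by omega), pI_neg ha, phiI, if_pos (by simp),
    if_neg (by omega)]
  simp; ring

theorem R_nn_lt (ha : 0 < a) (h : a < b) : R q (-a) (-b) g = g (-a) (-b) := by
  have := phiI_lt ha h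
  rw [R, if_neg (by omega), if_neg (by omega), this.2.2.2.1]
  simp

theorem R_nn_gt (hb : 0 < b) (h : b < a) :
    R q (-a) (-b) g = g (-a) (-b) - zq q * g (-b) (-a) := by
  have ha : 0 < a := by omega
  have : phiI (-a) (-b) = 0 := by
    simp only [phiI, abs_neg, abs_of_pos ha, abs_of_pos hb, h.ne', if_false]
  rw [R, if_pos (by omega), if_neg (by omega), pI_neg ha, this]
  simp; ring

theorem R_nn_eq (ha : 0 < a) : R q (-a) (-a) g = (q : K)⁻¹ * g (-a) (-a) := by
  rw [R, if_neg (by omega), if_neg (by omega), phiI, if_pos rfl, if_pos (by omega)]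
  simp

end

set_option maxHeartbeats 4000000 in
/-- The Yang--Baxter equation for `Θ`, on basis vectors. -/
theorem ybe (F : ℤ → ℤ → ℤ → K) (y b d : ℤ) (hy : y ≠ 0) (hb : b ≠ 0) (hd : d ≠ 0) :
    R q b d (fun j l => R q y l (fun w k => R q w j (fun x i =>
        sgn ((pI i + pI j) * (pI k + pI l)) * sgn ((pI k + pI l) * (pI j + pI b)) * F x i k)))
      = R q y b (fun w j => R q w d (fun x l => R q j l (fun i k =>
        sgn ((pI k + pI l) * (pI j + pI b)) * F x i k))) := by
  have e2 : (1 : ZMod 2) + 1 = 0 := by decide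
  have hq : (q : K) ≠ 0 := q.ne_zero
  have main : ∀ a b c : ℤ, 0 < a → 0 < b → 0 < c → ∀ s t r : Bool,
      ∀ y' b' d', y' = (if s then a else -a) → b' = (if t then b else -b) →
      d' = (if r then c else -c) →
      R q b' d' (fun j l => R q y' l (fun w k => R q w j (fun x i =>
        sgn ((pI i + pI j) * (pI k + pI l)) * sgn ((pI k + pI l) * (pI j + pI b')) * F x i k)))
      = R q y' b' (fun w j => R q w d' (fun x l => R q j l (fun i k =>
        sgn ((pI k + pI l) * (pI j + pI b')) * F x i k))) := by
    intro a b c ha hb hc s t r y' b' d' e1 e3 e4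
    have na := pI_neg ha
    have nb := pI_neg hb
    have nc := pI_neg hc
    have pa := pI_pos ha
    have pb := pI_pos hb
    have pc := pI_pos hc
    subst e1 e3 e4
    rcases lt_trichotomy a b with h1 | h1 | h1 <;> rcases lt_trichotomy b c with h2 | h2 | h2 <;>
    rcases lt_trichotomy a c with h3 | h3 | h3 <;> try (exfalso; omega)
    all_goals try subst h1
    all_goals try subst h2
    all_goals try subst h3
    all_goals cases s <;> cases t <;> cases r
    all_goals
      simp only [Bool.false_eq_true, if_true, if_false, R_pp_lt, R_pp_gt, R_pp_eq, R_pn_lt, R_pn_gt,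
        R_pn_eq, R_np_lt, R_np_gt, R_np_eq, R_nn_lt, R_nn_gt, R_nn_eq,
        *]
    all_goals
      simp only [sgn_zero, sgn_one, add_zero, zero_add, mul_zero, mul_one, one_mul, zq,
        Units.val_inv_eq_inv_val]
    all_goals try field_simp
    all_goals try ring
  have hs : ∀ x : ℤ, x = if decide (0 < x) then |x| else -|x| := by
    intro x
    by_cases hx : 0 < x
    · simp [hx, abs_of_pos]
    · simp [hx, abs_of_nonpos (not_lt.1 hx)]
  exact main |y| |b| |d| (abs_pos.2 hy) (abs_pos.2 hb) (abs_pos.2 hd) _ _ _ y b d (hs y) (hs b) (hs d)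

end YangBaxter

end

section
variable {K : Type u} [Field K] (q : Kˣ)

namespace YangBaxter

variable {n : ℕ}

theorem theta_apply (r1 c1 r2 c2 : Idx n) : Theta q r2 c2 r1 c1
    = (if r1 = c1 ∧ r2 = c2 then ((q ^ phiI c1.1 c2.1 : Kˣ) : K) else 0)
      + (if r1 = c2 ∧ r2 = c1 then (if c1.1 < c2.1 then zq q * sgn (pI c1.1) else 0) else 0)
      + (if r1 = -c2 ∧ r2 = -c1 then (if -c1.1 < c2.1 then zq q * sgn (pI (-c1.1)) else 0) else 0) := by
  have hneg : ∀ a b : Idx n, -a = b ↔ a = -b := by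
    intro a b
    constructor
    · rintro rfl; exact (Idx.neg_neg' a).symm
    · rintro rfl; exact Idx.neg_neg' b
  have hz : ∀ (A B : Prop) [Decidable A] [Decidable B] (X : K), (A → ¬ B) →
      (if A then (if B then X else 0) else 0) = 0 := by
    intro A B _ _ X hAB
    split_ifs with h1 h2
    · exact absurd h2 (hAB h1)
    · rfl
    · rfl
  unfold Theta
  by_cases h : r2 = c2
  · subst h
    rw [if_pos rfl, Matrix.diagonal_apply]
    rw [hz _ _ _ (by rintro ⟨rfl, rfl⟩; exact lt_irrefl _),
      hz _ _ _ (by rintro ⟨rfl, h'⟩; rw [h']; exact lt_irrefl _), add_zero, add_zero]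
    by_cases h4 : r1 = c1
    · subst h4; simp [Idx.phi, phiI]
    · simp [h4]
  · rw [if_neg h, if_neg (show ¬ (r1 = c1 ∧ r2 = c2) from fun hh => h hh.2), zero_add]
    by_cases hlt : r2 < c2
    · rw [if_pos hlt]
      have hlt' : r2.1 < c2.1 := hlt
      simp only [Matrix.smul_apply, Matrix.add_apply, Matrix.single_apply, smul_eq_mul, mul_add,
        mul_ite, mul_one, mul_zero]
      congr 1
      · by_cases h5 : c2 = r1 ∧ r2 = c1
        · obtain ⟨rfl, rfl⟩ := h5
          simp [hlt', Idx.p, pI]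
        · rw [if_neg h5, if_neg (by rintro ⟨rfl, rfl⟩; exact h5 ⟨rfl, rfl⟩)]
      · by_cases h5 : -c2 = r1 ∧ -r2 = c1
        · obtain ⟨rfl, rfl⟩ := h5
          simp [hlt', Idx.p, pI, Idx.neg_neg']
        · rw [if_neg h5, if_neg (by rintro ⟨rfl, rfl⟩; exact h5 ⟨rfl, Idx.neg_neg' _⟩)]
    · rw [if_neg hlt, Matrix.zero_apply]
      rw [hz _ _ _ (by rintro ⟨rfl, rfl⟩; exact hlt),
        hz _ _ _ (by rintro ⟨rfl, rfl⟩; exact hlt), add_zero]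

theorem sum_theta (c1 c2 : Idx n) (g : ℤ → ℤ → K) :
    ∑ r1 : Idx n, ∑ r2 : Idx n, Theta q r2 c2 r1 c1 * g r1.1 r2.1 = R q c1.1 c2.1 g := by
  simp only [theta_apply, add_mul, Finset.sum_add_distrib, ite_mul, zero_mul, ite_and,
    Finset.sum_ite_eq', Finset.mem_univ, if_true, Finset.sum_ite_irrel, Finset.sum_const_zero]
  simp [R]

theorem phiI_neg (a b : ℤ) (hb : b ≠ 0) : phiI a b + phiI a (-b) = 0 := by
  unfold phiI
  rw [abs_neg]
  split_ifs <;> omega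

end YangBaxter

open YangBaxter in
/-- The matrices `Θ_{ij}` satisfy the defining relations of `U_q(𝔮_n)`. -/
theorem isRep_Theta {n : ℕ} : Uq.IsRep q (Theta q (n := n)) where
  lt i j h := by simp [Theta, ne_of_gt h, not_lt.2 h.le]
  diag i := by
    have h : ∀ k : Idx n, ((q ^ Idx.phi k i : Kˣ) : K) * ((q ^ Idx.phi k (-i) : Kˣ) : K) = 1 := by
      intro k
      rw [← Units.val_mul, ← zpow_add]
      have := phiI_neg k.1 i.1 i.val_ne_zero
      change (↑(q ^ (phiI k.1 i.1 + phiI k.1 (-i.1))) : K) = 1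
      rw [this]; simp
    simp only [Theta, if_true, Matrix.diagonal_mul_diagonal, h, Matrix.diagonal_one]
  yb i b k d := by
    ext x y
    have key := ybe q (fun a b c => if a = x.1 then if b = i.1 then if c = k.1 then (1 : K) else 0
      else 0 else 0) y.1 b.1 d.1 y.val_ne_zero b.val_ne_zero d.val_ne_zero
    simp only [← sum_theta] at key
    have hv : ∀ a c : Idx n, a.1 = c.1 ↔ a = c := fun a c => Subtype.ext_iff.symm
    simp only [hv, mul_ite, mul_one, mul_zero, Finset.sum_ite_eq', Finset.mem_univ, if_true,
      Finset.sum_ite_irrel, Finset.sum_const_zero] at key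
    simp only [Matrix.sum_apply, Matrix.smul_apply, Matrix.mul_apply, smul_eq_mul]
    refine Eq.trans (Finset.sum_congr rfl fun j _ => Finset.sum_congr rfl fun l _ => ?_)
      (key.trans ?_)
    · rw [Finset.mul_sum, Finset.mul_sum]
      refine Finset.sum_congr rfl fun w _ => ?_
      simp only [Idx.p, pI]
      ring
    · simp only [Finset.mul_sum]
      rw [Finset.sum_comm]
      refine Finset.sum_congr rfl fun j _ => ?_
      rw [Finset.sum_comm]
      refine Finset.sum_congr rfl fun l _ => Finset.sum_congr rfl fun w _ => ?_
      simp only [Idx.p, pI]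
      ring

end

/-! ## Operators on tensor products and duals -/

section
variable {K : Type u} [Field K] (q : Kˣ) {n : ℕ}

theorem Idx.p_neg (i : Idx n) : (-i).p = i.p + 1 := by
  have h := i.val_ne_zero
  have e : (1 : ZMod 2) + 1 = 0 := by decide
  unfold Idx.p
  rw [Idx.val_neg]
  rcases lt_or_gt_of_ne h with h | h
  · rw [if_neg (by omega), if_pos h, e]
  · rw [if_pos (by omega), if_neg (by omega), zero_add]

/-- `Θ` is even. -/
theorem theta_parity (r1 c1 r2 c2 : Idx n) :
    Theta q r2 c2 r1 c1 = 0 ∨ r1.p + c1.p = r2.p + c2.p := by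
  have e : ∀ a b : ZMod 2, a + b = b + a := add_comm
  by_cases h1 : r1 = c1 ∧ r2 = c2
  · obtain ⟨rfl, rfl⟩ := h1
    right
    generalize r1.p = a; generalize r2.p = b; revert a b; decide
  by_cases h2 : r1 = c2 ∧ r2 = c1
  · obtain ⟨rfl, rfl⟩ := h2
    exact Or.inr (e _ _)
  by_cases h3 : r1 = -c2 ∧ r2 = -c1
  · obtain ⟨rfl, rfl⟩ := h3
    right
    rw [Idx.p_neg, Idx.p_neg]; ring
  · left
    rw [YangBaxter.theta_apply, if_neg h1, if_neg h2, if_neg h3]; simp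

theorem sum4_comm {A : Type v} [AddCommMonoid A] (f : Idx n → Idx n → Idx n → Idx n → A) :
    ∑ j, ∑ l, ∑ m, ∑ r, f j l m r = ∑ m, ∑ r, ∑ j, ∑ l, f j l m r := by
  calc ∑ j, ∑ l, ∑ m, ∑ r, f j l m r = ∑ j, ∑ m, ∑ l, ∑ r, f j l m r :=
        Finset.sum_congr rfl fun _ _ => Finset.sum_comm
    _ = ∑ m, ∑ j, ∑ l, ∑ r, f j l m r := Finset.sum_comm
    _ = ∑ m, ∑ j, ∑ r, ∑ l, f j l m r :=
        Finset.sum_congr rfl fun _ _ => Finset.sum_congr rfl fun _ _ => Finset.sum_comm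
    _ = ∑ m, ∑ r, ∑ j, ∑ l, f j l m r := Finset.sum_congr rfl fun _ _ => Finset.sum_comm

variable {M N : Type u} [AddCommGroup M] [Module K M] [AddCommGroup N] [Module K N]

/-- The operators by which `Δ(u_{ij}) = ∑_k (-1)^{p(i,k) p(k,j)} u_{ik} ⊗ u_{kj}` acts on a tensor
product, where `u_{ij}` acts on the factors by `a i j` and `b i j`. -/
def tensorOps (G : Grading K M) (H : Grading K N) (a : Idx n → Idx n → Module.End K M)
    (b : Idx n → Idx n → Module.End K N) (i j : Idx n) : Module.End K (M ⊗[K] N) :=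
  ∑ m : Idx n, sgn (k := K) ((i.p + m.p) * (m.p + j.p)) • G.tensorMap H H (a i m) (b m j)

variable (G : Grading K M) (H : Grading K N) {a : Idx n → Idx n → Module.End K M}
    {b : Idx n → Idx n → Module.End K N}

theorem tensorOps_mem (ha' : ∀ i j : Idx n, a i j ∈ G.homGr G (i.p + j.p))
    (hb' : ∀ i j : Idx n, b i j ∈ H.homGr H (i.p + j.p)) (i j : Idx n) :
    tensorOps G H a b i j ∈ (G.tensor H).homGr (G.tensor H) (i.p + j.p) := by
  refine sum_mem fun m _ => Submodule.smul_mem _ _ ?_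
  have := Grading.tensorMap_mem G G H H (ha' i m) (hb' m j)
  have e : i.p + m.p + (m.p + j.p) = i.p + j.p := by
    generalize i.p = x; generalize m.p = y; generalize j.p = z; revert x y z; decide
  rwa [e] at this

theorem tensorOps_mul (ha' : ∀ i j : Idx n, a i j ∈ G.homGr G (i.p + j.p))
    (hb' : ∀ i j : Idx n, b i j ∈ H.homGr H (i.p + j.p)) (i j k l : Idx n) :
    tensorOps G H a b i j * tensorOps G H a b k l = ∑ m : Idx n, ∑ r : Idx n,
      sgn (k := K) ((i.p + m.p) * (m.p + j.p) + (k.p + r.p) * (r.p + l.p)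
        + (m.p + j.p) * (k.p + r.p)) • G.tensorMap H H (a i m * a k r) (b m j * b r l) := by
  simp only [tensorOps, Finset.sum_mul, Finset.mul_sum]
  rw [Finset.sum_comm]
  refine Finset.sum_congr rfl fun m _ => Finset.sum_congr rfl fun r _ => ?_
  rw [smul_mul_smul_comm]
  have := Grading.tensorMap_comp G G H H H (a i m) (b r l) (hb' m j) (ha' k r)
  rw [Module.End.mul_eq_comp, this, smul_smul, ← sgn_add, ← sgn_add]
  rfl

theorem isRep_tensorOps (ha : Uq.IsRep q a) (hb : Uq.IsRep q b)
    (ha' : ∀ i j : Idx n, a i j ∈ G.homGr G (i.p + j.p))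
    (hb' : ∀ i j : Idx n, b i j ∈ H.homGr H (i.p + j.p)) : Uq.IsRep q (tensorOps G H a b) where
  lt i j h := by
    refine Finset.sum_eq_zero fun m _ => ?_
    rcases lt_or_ge m i with hm | hm
    · rw [ha.lt i m hm]; simp
    · rw [hb.lt m j (lt_of_lt_of_le h hm)]; simp
  diag i := by
    rw [tensorOps_mul G H ha' hb', Finset.sum_eq_single i, Finset.sum_eq_single (-i)]
    · rw [ha.diag, hb.diag]
      have e : (i.p + i.p) * (i.p + i.p) + ((-i).p + (-i).p) * ((-i).p + (-i).p)
          + (i.p + i.p) * ((-i).p + (-i).p) = 0 := by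
        generalize i.p = x; generalize (-i).p = y; revert x y; decide
      rw [e, sgn_zero, one_smul]
      exact Grading.tensorMap_id G H
    · intro r _ hr
      rcases lt_or_gt_of_ne hr with h | h
      · rw [ha.lt _ _ h]; simp
      · rw [hb.lt _ _ h]; simp
    · simp
    · intro r _ hr
      refine Finset.sum_eq_zero fun _ _ => ?_
      rcases lt_or_gt_of_ne hr with h | h
      · rw [ha.lt _ _ h]; simp
      · rw [hb.lt _ _ h]; simp
    · simp
  yb i b' k d := by
    have hd2 : ∀ x : ZMod 2, x + x = 0 := by decide
    have step1 : ∀ m r : Idx n, ∑ j, ∑ l, (sgn ((i.p + j.p) * (k.p + l.p))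
          * sgn ((k.p + l.p) * (j.p + b'.p)) * Theta q l d j b') •
          sgn (k := K) ((i.p + m.p) * (m.p + j.p) + (k.p + r.p) * (r.p + l.p)
            + (m.p + j.p) * (k.p + r.p)) • G.tensorMap H H (a i m * a k r) (b m j * b r l)
        = ∑ j, ∑ l, (sgn ((i.p + j.p) * (j.p + b'.p) + (l.p + d.p) * ((i.p + j.p) + (k.p + l.p))) *
          (sgn ((i.p + m.p) * (k.p + r.p)) * sgn ((k.p + r.p) * (m.p + j.p)) * Theta q r l m j)) •
          G.tensorMap H H (a i m * a k r) (b l d * b j b') := by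
      intro m r
      have h := congrArg (fun t => sgn (k := K) ((i.p + m.p) * (k.p + r.p)
        + (i.p + m.p) * (r.p + m.p + b'.p + d.p) + (k.p + r.p) * (r.p + d.p)) •
          G.tensorMap H H (a i m * a k r) t) (hb.yb m b' r d)
      simp only [map_sum, map_smul, Finset.smul_sum, smul_smul] at h
      refine Eq.trans ?_ (h.trans ?_)
      · refine Finset.sum_congr rfl fun j _ => Finset.sum_congr rfl fun l _ => ?_
        rw [smul_smul]
        congr 1
        rcases theta_parity q j b' l d with h0 | h0
        · simp [h0]
        · rw [mul_right_comm, ← sgn_add, ← sgn_add, ← sgn_add, ← mul_assoc, ← sgn_add]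
          congr 2
          have hl : l.p = j.p + b'.p + d.p := by rw [h0, add_assoc, hd2, add_zero]
          rw [hl]
          generalize i.p = x1; generalize m.p = x2; generalize j.p = x3; generalize k.p = x4
          generalize r.p = x5; generalize b'.p = x6; generalize d.p = x7
          clear h0 hl
          revert x1 x2 x3 x4 x5 x6 x7
          decide
      · refine Finset.sum_congr rfl fun j _ => Finset.sum_congr rfl fun l _ => ?_
        congr 1
        rcases theta_parity q m j r l with h0 | h0
        · simp [h0]
        · rw [← mul_assoc, ← mul_assoc, ← mul_assoc, ← sgn_add, ← sgn_add, ← sgn_add]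
          congr 2
          have hl : l.p = m.p + j.p + r.p := by
            rw [h0, add_comm r.p, add_assoc, hd2, add_zero]
          rw [hl]
          generalize i.p = x1; generalize m.p = x2; generalize j.p = x3; generalize k.p = x4
          generalize r.p = x5; generalize b'.p = x6; generalize d.p = x7
          clear h0 hl
          revert x1 x2 x3 x4 x5 x6 x7
          decide
    have step2 : ∀ j l : Idx n, ∑ m, ∑ r,
          (sgn ((i.p + j.p) * (j.p + b'.p) + (l.p + d.p) * ((i.p + j.p) + (k.p + l.p))) *
          (sgn ((i.p + m.p) * (k.p + r.p)) * sgn ((k.p + r.p) * (m.p + j.p)) * Theta q r l m j)) •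
          G.tensorMap H H (a i m * a k r) (b l d * b j b')
        = ∑ m, ∑ r, (sgn ((k.p + r.p) * (m.p + b'.p)) * Theta q k r i m) •
          sgn (k := K) ((r.p + l.p) * (l.p + d.p) + (m.p + j.p) * (j.p + b'.p)
            + (l.p + d.p) * (m.p + j.p)) • G.tensorMap H H (a r l * a m j) (b l d * b j b') := by
      intro j l
      have h := congrArg (fun t => sgn (k := K) ((i.p + j.p) * (j.p + b'.p)
        + (l.p + d.p) * ((i.p + j.p) + (k.p + l.p))) •
          G.tensorMap H H t (b l d * b j b')) (ha.yb i j k l)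
      simp only [map_sum, map_smul, Finset.smul_sum, smul_smul, LinearMap.sum_apply,
        LinearMap.smul_apply] at h
      refine h.trans ?_
      refine Finset.sum_congr rfl fun m _ => Finset.sum_congr rfl fun r _ => ?_
      rw [smul_smul]
      congr 1
      rcases theta_parity q i m k r with h0 | h0
      · simp [h0]
      · rw [mul_right_comm, ← mul_assoc, ← sgn_add, ← sgn_add]
        congr 2
        have hl : r.p = i.p + m.p + k.p := by
          rw [h0, add_comm k.p, add_assoc, hd2, add_zero]
        rw [hl]
        generalize i.p = x1; generalize m.p = x2; generalize j.p = x3; generalize k.p = x4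
        generalize l.p = x5; generalize b'.p = x6; generalize d.p = x7
        clear h0 hl
        revert x1 x2 x3 x4 x5 x6 x7
        decide
    simp only [tensorOps_mul G H ha' hb', Finset.smul_sum]
    rw [sum4_comm]
    simp only [step1]
    rw [sum4_comm]
    simp only [step2]
    rw [sum4_comm]
    refine Finset.sum_congr rfl fun m _ => Finset.sum_congr rfl fun r _ => ?_
    rw [Finset.sum_comm]

end

section
variable {K : Type u} [Field K] (q : Kˣ) {n : ℕ}

theorem Idx.p_of_le {i j : Idx n} (h : i ≤ j) : (i.p + j.p) * j.p = 0 := by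
  have h' : i.1 ≤ j.1 := h
  have e : (1 : ZMod 2) + 1 = 0 := by decide
  unfold Idx.p
  by_cases hj : j.1 < 0
  · rw [if_pos hj, if_pos (by omega), e, zero_mul]
  · rw [if_neg hj, mul_zero]

namespace LegMatrix

theorem sign_left (i b k d j l : ZMod 2) (h1 : (i + j) * j = 0) (h2 : (k + l) * l = 0)
    (h3 : j + b = l + d) : (i + j) * (k + l) + (k + l) * (j + b) + (b + d + k * d + i * b + i * d + b * d)
      = (i + j) * k + (j + b) * b := by
  revert i b k d j l; decide

theorem sign_left' (i b k d j l : ZMod 2) (h1 : (i + j) * j = 0) (h2 : (k + l) * l = 0)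
    (h3 : j + b = l + d) : (k + l) * (j + b)
      = (b + d + k * d + i * b + i * d + b * d) + ((i + j) * l + (j + b) * b) := by
  revert i b k d j l; decide

theorem sign_right (i b k d j l : ZMod 2) (h1 : (j + b) * b = 0) (h2 : (l + d) * d = 0)
    (h3 : i + j = k + l) : (k + l) * (j + b) + (b + d + k * d + i * b + i * d + b * d)
      = (i + j) * j + (j + b) * d := by
  revert i b k d j l; decide

theorem sign_right' (i b k d j l : ZMod 2) (h1 : (j + b) * b = 0) (h2 : (l + d) * d = 0)
    (h3 : i + j = k + l) : (k + l) * (j + b) + (l + d) * (j + b)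
      = (b + d + k * d + i * b + i * d + b * d) + ((i + j) * j + (j + b) * l) := by
  revert i b k d j l; decide

variable {A : Type v} [Ring A] [Algebra K A]

variable (K) in
/-- `X¹²`. -/
def leg12 (X : Matrix (Idx n) (Idx n) A) : Matrix (Idx n × Idx n) (Idx n × Idx n) A :=
  Matrix.of fun x y => if x.2 = y.2 then sgn (k := K) ((x.1.p + y.1.p) * x.2.p) • X x.1 y.1 else 0

/-- `X¹³`. -/
def leg13 (X : Matrix (Idx n) (Idx n) A) : Matrix (Idx n × Idx n) (Idx n × Idx n) A :=
  Matrix.of fun x y => if x.1 = y.1 then X x.2 y.2 else 0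

variable (A) in
/-- `Θ²³`. -/
def leg23 : Matrix (Idx n × Idx n) (Idx n × Idx n) A :=
  Matrix.of fun x y => (sgn ((x.1.p + y.1.p) * y.1.p) * Theta q x.2 y.2 x.1 y.1) • (1 : A)

theorem leg12_mul (X Y : Matrix (Idx n) (Idx n) A) :
    leg12 K X * leg12 K Y = leg12 K (X * Y) := by
  ext ⟨i, k⟩ ⟨j, l⟩
  simp only [leg12, Matrix.mul_apply, Matrix.of_apply, Fintype.sum_prod_type]
  by_cases h : k = l
  · subst h
    simp only [if_true, Finset.smul_sum]
    refine Finset.sum_congr rfl fun m _ => ?_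
    rw [Finset.sum_eq_single k]
    · rw [if_pos rfl, if_pos rfl, smul_mul_smul_comm, ← sgn_add]
      congr 2
      generalize i.p = a; generalize k.p = b; generalize m.p = c; generalize j.p = d
      revert a b c d; decide
    · intro r _ hr; rw [if_neg (Ne.symm hr), zero_mul]
    · simp
  · rw [if_neg h]
    refine Finset.sum_eq_zero fun m _ => Finset.sum_eq_zero fun r _ => ?_
    by_cases hr : k = r
    · subst hr; rw [if_neg h, mul_zero]
    · rw [if_neg hr, zero_mul]

theorem leg13_mul (X Y : Matrix (Idx n) (Idx n) A) : leg13 X * leg13 Y = leg13 (X * Y) := by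
  ext ⟨i, k⟩ ⟨j, l⟩
  simp only [leg13, Matrix.mul_apply, Matrix.of_apply, Fintype.sum_prod_type]
  by_cases h : i = j
  · subst h
    rw [if_pos rfl, Finset.sum_eq_single i]
    · simp
    · intro r _ hr
      simp [Ne.symm hr]
    · simp
  · rw [if_neg h]
    refine Finset.sum_eq_zero fun m _ => Finset.sum_eq_zero fun r _ => ?_
    by_cases hr : i = m
    · subst hr; rw [if_neg h, mul_zero]
    · rw [if_neg hr, zero_mul]

theorem leg12_one : leg12 K (1 : Matrix (Idx n) (Idx n) A) = 1 := by
  ext ⟨i, k⟩ ⟨j, l⟩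
  simp only [leg12, Matrix.of_apply, Matrix.one_apply, Prod.mk.injEq]
  by_cases h : k = l <;> by_cases h' : i = j <;> simp [h, h']
  subst h'
  have : i.p + i.p = 0 := by generalize i.p = a; revert a; decide
  simp [this]

theorem leg13_one : leg13 (1 : Matrix (Idx n) (Idx n) A) = 1 := by
  ext ⟨i, k⟩ ⟨j, l⟩
  simp only [leg13, Matrix.of_apply, Matrix.one_apply, Prod.mk.injEq]
  by_cases h : k = l <;> by_cases h' : i = j <;> simp [h, h']

theorem leg12_leg13 (X Y : Matrix (Idx n) (Idx n) A) (i k j l : Idx n) :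
    (leg12 K X * leg13 Y) (i, k) (j, l) = sgn (k := K) ((i.p + j.p) * k.p) • (X i j * Y k l) := by
  simp only [leg12, leg13, Matrix.mul_apply, Matrix.of_apply, Fintype.sum_prod_type]
  rw [Finset.sum_eq_single j, Finset.sum_eq_single k]
  · rw [if_pos rfl, if_pos rfl, smul_mul_assoc]
  · intro r _ hr; rw [if_neg (Ne.symm hr), zero_mul]
  · simp
  · intro r _ hr
    refine Finset.sum_eq_zero fun m _ => ?_
    rw [if_neg hr, mul_zero]
  · simp

theorem leg13_leg12 (X Y : Matrix (Idx n) (Idx n) A) (i k j l : Idx n) :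
    (leg13 Y * leg12 K X) (i, k) (j, l) = sgn (k := K) ((i.p + j.p) * l.p) • (Y k l * X i j) := by
  simp only [leg12, leg13, Matrix.mul_apply, Matrix.of_apply, Fintype.sum_prod_type]
  rw [Finset.sum_eq_single i, Finset.sum_eq_single l]
  · rw [if_pos rfl, if_pos rfl, mul_smul_comm]
  · intro r _ hr; rw [if_neg hr, mul_zero]
  · simp
  · intro r _ hr
    refine Finset.sum_eq_zero fun m _ => ?_
    rw [if_neg (Ne.symm hr), zero_mul]
  · simp

theorem mul_leg23 (X : Matrix (Idx n × Idx n) (Idx n × Idx n) A) (i k b d : Idx n) :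
    (X * leg23 q A : Matrix (Idx n × Idx n) (Idx n × Idx n) A) (i, k) (b, d)
      = ∑ j, ∑ l, (sgn ((j.p + b.p) * b.p) * Theta q l d j b) • X (i, k) (j, l) := by
  simp only [leg23, Matrix.mul_apply, Matrix.of_apply, Fintype.sum_prod_type, mul_smul_comm, mul_one]

theorem leg23_mul (X : Matrix (Idx n × Idx n) (Idx n × Idx n) A) (i k b d : Idx n) :
    (leg23 q A * X : Matrix (Idx n × Idx n) (Idx n × Idx n) A) (i, k) (b, d)
      = ∑ j, ∑ l, (sgn ((i.p + j.p) * j.p) * Theta q k l i j) • X (j, l) (b, d) := by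
  simp only [leg23, Matrix.mul_apply, Matrix.of_apply, Fintype.sum_prod_type, smul_mul_assoc, one_mul]

theorem relation {t : Idx n → Idx n → A} (h : Uq.IsRep q t) :
    leg12 K (Matrix.of t) * leg13 (Matrix.of t) * leg23 q A
      = leg23 q A * (leg13 (Matrix.of t) * leg12 K (Matrix.of t)) := by
  ext ⟨i, k⟩ ⟨b, d⟩
  rw [mul_leg23, leg23_mul]
  have key := congrArg (fun x => sgn (k := K) (b.p + d.p + k.p * d.p + i.p * b.p + i.p * d.p
    + b.p * d.p) • x) (h.yb i b k d)
  simp only [Finset.smul_sum, smul_smul] at key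
  refine Eq.trans ?_ (key.trans ?_)
  · refine Finset.sum_congr rfl fun j _ => Finset.sum_congr rfl fun l _ => ?_
    rw [leg12_leg13, smul_smul]
    simp only [Matrix.of_apply]
    rcases lt_or_ge j i with h1 | h1
    · rw [h.lt _ _ h1]; simp
    rcases lt_or_ge l k with h2 | h2
    · rw [h.lt _ _ h2]; simp
    rcases theta_parity q j b l d with h3 | h3
    · rw [h3]; simp
    congr 1
    rw [mul_right_comm, ← sgn_add, ← mul_assoc, ← sgn_add, ← sgn_add,
      add_comm ((j.p + b.p) * b.p), ← sign_left _ _ _ _ _ _ (Idx.p_of_le h1) (Idx.p_of_le h2) h3,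
      add_comm]
  · refine Finset.sum_congr rfl fun j _ => Finset.sum_congr rfl fun l _ => ?_
    rw [leg13_leg12, smul_smul]
    simp only [Matrix.of_apply]
    rcases lt_or_ge b j with h1 | h1
    · rw [h.lt _ _ h1]; simp
    rcases lt_or_ge d l with h2 | h2
    · rw [h.lt _ _ h2]; simp
    rcases theta_parity q i j k l with h3 | h3
    · rw [h3]; simp
    congr 1
    rw [mul_right_comm, ← sgn_add, ← mul_assoc, ← sgn_add,
      ← sign_right _ _ _ _ _ _ (Idx.p_of_le h1) (Idx.p_of_le h2) h3, add_comm]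

theorem relation_inv {t : Idx n → Idx n → A} (h : Uq.IsRep q t) {S : Matrix (Idx n) (Idx n) A}
    (h1 : S * Matrix.of t = 1) (h2 : Matrix.of t * S = 1) :
    leg23 q A * (leg12 K S * leg13 S) = leg13 S * leg12 K S * leg23 q A := by
  have a1 : leg12 K S * leg12 K (Matrix.of t) = 1 := by rw [leg12_mul, h1, leg12_one]
  have a2 : leg12 K (Matrix.of t) * leg12 K S = 1 := by rw [leg12_mul, h2, leg12_one]
  have b1 : leg13 S * leg13 (Matrix.of t) = 1 := by rw [leg13_mul, h1, leg13_one]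
  have b2 : leg13 (Matrix.of t) * leg13 S = 1 := by rw [leg13_mul, h2, leg13_one]
  have r := relation q h
  calc leg23 q A * (leg12 K S * leg13 S)
      = (leg13 S * ((leg12 K S * leg12 K (Matrix.of t)) * leg13 (Matrix.of t))) * leg23 q A
          * (leg12 K S * leg13 S) := by rw [a1, one_mul, b1, one_mul]
    _ = leg13 S * leg12 K S * (leg12 K (Matrix.of t) * leg13 (Matrix.of t) * leg23 q A)
          * (leg12 K S * leg13 S) := by simp only [mul_assoc]
    _ = leg13 S * leg12 K S * (leg23 q A * (leg13 (Matrix.of t) * leg12 K (Matrix.of t)))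
          * (leg12 K S * leg13 S) := by rw [r]
    _ = leg13 S * leg12 K S * leg23 q A * (leg13 (Matrix.of t)
          * ((leg12 K (Matrix.of t) * leg12 K S) * leg13 S)) := by simp only [mul_assoc]
    _ = leg13 S * leg12 K S * leg23 q A := by rw [a2, one_mul, b2, mul_one]

end LegMatrix

variable {M : Type u} [AddCommGroup M] [Module K M]

open LegMatrix in
theorem isRep_transpose (G : Grading K M) {t : Idx n → Idx n → Module.End K M}
    (h : Uq.IsRep q t) {S : Matrix (Idx n) (Idx n) (Module.End K M)}
    (h1 : S * Matrix.of t = 1) (h2 : Matrix.of t * S = 1)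
    (hlt : ∀ i j, j < i → S i j = 0) (hS : ∀ i j : Idx n, S i j ∈ G.homGr G (i.p + j.p)) :
    Uq.IsRep q fun i j => G.transpose (S i j) where
  lt i j hij := by rw [hlt i j hij, map_zero]
  diag i := by
    have hp : ∀ a : ZMod 2, a + a = 0 := by decide
    have d1 : ∀ i, S i i * t i i = 1 := by
      intro i
      have := congrFun (congrFun h1 i) i
      rw [Matrix.mul_apply, Finset.sum_eq_single i] at this
      · simpa using this
      · intro m _ hm
        rcases lt_or_gt_of_ne hm with hm | hm
        · rw [hlt _ _ hm, zero_mul]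
        · rw [Matrix.of_apply, h.lt _ _ hm, mul_zero]
      · simp
    have e : ∀ i, S i i = t (-i) (-i) := by
      intro i
      calc S i i = S i i * (t i i * t (-i) (-i)) := by rw [h.diag, mul_one]
        _ = t (-i) (-i) := by rw [← mul_assoc, d1, one_mul]
    rw [Grading.transpose_comp G (hS i i) (hS (-i) (-i)), hp, zero_mul, sgn_zero, one_smul, e i,
      d1, Grading.transpose_one]
  yb i b k d := by
    have key := congrFun (congrFun (relation_inv q h h1 h2) (i, k)) (b, d)
    rw [mul_leg23, leg23_mul] at key
    have key := congrArg (fun x => sgn (k := K) (b.p + d.p + k.p * d.p + i.p * b.p + i.p * d.p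
      + b.p * d.p) • G.transpose x) key.symm
    simp only [map_sum, map_smul, Finset.smul_sum, leg12_leg13, leg13_leg12, smul_smul] at key
    refine Eq.trans ?_ (key.trans ?_)
    · refine Finset.sum_congr rfl fun j _ => Finset.sum_congr rfl fun l _ => ?_
      rw [Grading.transpose_comp G (hS i j) (hS k l), smul_smul]
      rcases lt_or_ge j i with h1 | h1
      · rw [hlt _ _ h1]; simp
      rcases lt_or_ge l k with h2 | h2
      · rw [hlt _ _ h2]; simp
      rcases theta_parity q j b l d with h3 | h3
      · rw [h3]; simp
      congr 1
      have e := sign_left' _ _ _ _ _ _ (Idx.p_of_le h1) (Idx.p_of_le h2) h3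
      calc _ = sgn ((k.p + l.p) * (j.p + b.p)) * Theta q l d j b
            * (sgn ((i.p + j.p) * (k.p + l.p)) * sgn ((i.p + j.p) * (k.p + l.p))) := by ring
        _ = _ := by
          rw [sgn_mul_self, mul_one, e, sgn_add _ ((i.p + j.p) * l.p + _), sgn_add ((i.p + j.p) * l.p)]
          ring
    · refine Finset.sum_congr rfl fun j _ => Finset.sum_congr rfl fun l _ => ?_
      rw [Grading.transpose_comp G (hS l d) (hS j b), smul_smul]
      rcases lt_or_ge b j with h1 | h1
      · rw [hlt _ _ h1]; simp
      rcases lt_or_ge d l with h2 | h2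
      · rw [hlt _ _ h2]; simp
      rcases theta_parity q i j k l with h3 | h3
      · rw [h3]; simp
      congr 1
      have e := sign_right' _ _ _ _ _ _ (Idx.p_of_le h1) (Idx.p_of_le h2) h3
      rw [mul_right_comm (sgn ((k.p + l.p) * (j.p + b.p))), ← sgn_add ((k.p + l.p) * (j.p + b.p)), e,
        sgn_add _ ((i.p + j.p) * j.p + _), sgn_add ((i.p + j.p) * j.p)]
      ring

end

/-! ## Monoidal supercategories -/

/-- A `k`-linear supercategory: the morphism spaces are superspaces, identities are even and
composition is parity preserving. -/
class Supercategory (k : Type u) [CommRing k] (C : Type v) [Category.{w} C] [Preadditive C]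
    [Linear k C] where
  /-- The morphisms of parity `r`. -/
  gr : ∀ X Y : C, ZMod 2 → Submodule k (X ⟶ Y)
  isCompl : ∀ X Y : C, IsCompl (gr X Y 0) (gr X Y 1)
  id_mem : ∀ X : C, 𝟙 X ∈ gr X X 0
  comp_mem : ∀ {X Y Z : C} {r s : ZMod 2} {f : X ⟶ Y} {g : Y ⟶ Z},
    f ∈ gr X Y r → g ∈ gr Y Z s → f ≫ g ∈ gr X Z (r + s)

/-- A monoidal supercategory. Note that `f ≫ g` is `g ∘ f`. -/
class MonoidalSupercategory (k : Type u) [CommRing k] (C : Type v) [Category.{w} C]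
    [Preadditive C] [Linear k C] [Supercategory k C] where
  /-- The tensor product of objects. -/
  tensorObj : C → C → C
  /-- The unit object. -/
  unit : C
  /-- The tensor product of morphisms. -/
  tensorHom : ∀ {X Y X' Y' : C},
    (X ⟶ Y) →ₗ[k] (X' ⟶ Y') →ₗ[k] (tensorObj X X' ⟶ tensorObj Y Y')
  tensor_mem : ∀ {X Y X' Y' : C} {r s : ZMod 2} {f : X ⟶ Y} {g : X' ⟶ Y'},
    f ∈ Supercategory.gr (k := k) X Y r → g ∈ Supercategory.gr (k := k) X' Y' s →
      tensorHom f g ∈ Supercategory.gr (k := k) (tensorObj X X') (tensorObj Y Y') (r + s)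
  tensor_id : ∀ X Y : C, tensorHom (𝟙 X) (𝟙 Y) = 𝟙 (tensorObj X Y)
  /-- The super interchange law. -/
  interchange : ∀ {X Y Z X' Y' Z' : C} {r s : ZMod 2} (f : X ⟶ Y) (f' : Y ⟶ Z) (g' : X' ⟶ Y')
    (g : Y' ⟶ Z'), f ∈ Supercategory.gr (k := k) X Y r →
      g ∈ Supercategory.gr (k := k) Y' Z' s →
    tensorHom f g' ≫ tensorHom f' g = sgn (k := k) (r * s) • tensorHom (f ≫ f') (g' ≫ g)
  /-- The associator. -/
  assoc : ∀ X Y Z : C, tensorObj (tensorObj X Y) Z ≅ tensorObj X (tensorObj Y Z)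
  /-- The left unitor. -/
  leftUnitor : ∀ X : C, tensorObj unit X ≅ X
  /-- The right unitor. -/
  rightUnitor : ∀ X : C, tensorObj X unit ≅ X
  assoc_even : ∀ X Y Z : C, (assoc X Y Z).hom ∈ Supercategory.gr (k := k) _ _ 0
  leftUnitor_even : ∀ X : C, (leftUnitor X).hom ∈ Supercategory.gr (k := k) _ _ 0
  rightUnitor_even : ∀ X : C, (rightUnitor X).hom ∈ Supercategory.gr (k := k) _ _ 0
  assoc_naturality : ∀ {X X' Y Y' Z Z' : C} (f : X ⟶ X') (g : Y ⟶ Y') (h : Z ⟶ Z'),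
    tensorHom (tensorHom f g) h ≫ (assoc X' Y' Z').hom
      = (assoc X Y Z).hom ≫ tensorHom f (tensorHom g h)
  leftUnitor_naturality : ∀ {X Y : C} (f : X ⟶ Y),
    tensorHom (𝟙 unit) f ≫ (leftUnitor Y).hom = (leftUnitor X).hom ≫ f
  rightUnitor_naturality : ∀ {X Y : C} (f : X ⟶ Y),
    tensorHom f (𝟙 unit) ≫ (rightUnitor Y).hom = (rightUnitor X).hom ≫ f
  pentagon : ∀ W X Y Z : C,
    tensorHom (assoc W X Y).hom (𝟙 Z) ≫ (assoc W (tensorObj X Y) Z).hom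
        ≫ tensorHom (𝟙 W) (assoc X Y Z).hom
      = (assoc (tensorObj W X) Y Z).hom ≫ (assoc W X (tensorObj Y Z)).hom
  triangle : ∀ X Y : C,
    (assoc X unit Y).hom ≫ tensorHom (𝟙 X) (leftUnitor Y).hom
      = tensorHom (rightUnitor X).hom (𝟙 Y)

open Supercategory MonoidalSupercategory

/-- A monoidal superfunctor: a superfunctor with even coherence isomorphisms
`ε : 1 ≅ F 1` and `μ : F X ⊗ F Y ≅ F (X ⊗ Y)`. -/
structure MonoidalSuperfunctor (k : Type u) [CommRing k]
    (C : Type*) [Category C] [Preadditive C] [Linear k C] [Supercategory k C]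
    [MonoidalSupercategory k C]
    (D : Type*) [Category D] [Preadditive D] [Linear k D] [Supercategory k D]
    [MonoidalSupercategory k D] extends C ⥤ D where
  map_add : ∀ {X Y : C} (f g : X ⟶ Y), map (f + g) = map f + map g
  map_smul : ∀ {X Y : C} (c : k) (f : X ⟶ Y), map (c • f) = c • map f
  map_mem : ∀ {X Y : C} {r : ZMod 2} {f : X ⟶ Y}, f ∈ gr (k := k) X Y r →
    map f ∈ gr (k := k) (obj X) (obj Y) r
  ε : unit k ≅ obj (unit k)
  μ : ∀ X Y : C, tensorObj k (obj X) (obj Y) ≅ obj (tensorObj k X Y)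
  ε_even : ε.hom ∈ gr (k := k) _ _ 0
  μ_even : ∀ X Y : C, (μ X Y).hom ∈ gr (k := k) _ _ 0
  μ_naturality : ∀ {X Y X' Y' : C} (f : X ⟶ Y) (g : X' ⟶ Y'),
    tensorHom (k := k) (map f) (map g) ≫ (μ Y Y').hom
      = (μ X X').hom ≫ map (tensorHom (k := k) f g)
  associativity : ∀ X Y Z : C,
    tensorHom (k := k) (μ X Y).hom (𝟙 (obj Z)) ≫ (μ (tensorObj k X Y) Z).hom
        ≫ map (assoc (k := k) X Y Z).hom
      = (assoc (k := k) (obj X) (obj Y) (obj Z)).hom ≫ tensorHom (k := k) (𝟙 (obj X)) (μ Y Z).hom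
        ≫ (μ X (tensorObj k Y Z)).hom
  left_unitality : ∀ X : C, (leftUnitor (k := k) (obj X)).hom
    = tensorHom (k := k) ε.hom (𝟙 (obj X)) ≫ (μ (unit k) X).hom ≫ map (leftUnitor (k := k) X).hom
  right_unitality : ∀ X : C, (rightUnitor (k := k) (obj X)).hom
    = tensorHom (k := k) (𝟙 (obj X)) ε.hom ≫ (μ X (unit k)).hom ≫ map (rightUnitor (k := k) X).hom

/-- An (even) isomorphism of monoidal superfunctors. -/
@[ext]
structure MonoidalSuperNatIso {k : Type u} [CommRing k]
    {C : Type*} [Category C] [Preadditive C] [Linear k C] [Supercategory k C]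
    [MonoidalSupercategory k C]
    {D : Type*} [Category D] [Preadditive D] [Linear k D] [Supercategory k D]
    [MonoidalSupercategory k D] (F G : MonoidalSuperfunctor k C D) where
  /-- The components. -/
  app : ∀ X : C, F.obj X ≅ G.obj X
  even : ∀ X : C, (app X).hom ∈ gr (k := k) _ _ 0
  naturality : ∀ {X Y : C} (f : X ⟶ Y), F.map f ≫ (app Y).hom = (app X).hom ≫ G.map f
  unit : F.ε.hom ≫ (app (MonoidalSupercategory.unit k)).hom = G.ε.hom
  tensor : ∀ X Y : C, (F.μ X Y).hom ≫ (app (tensorObj k X Y)).hom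
    = tensorHom (k := k) (app X).hom (app Y).hom ≫ (G.μ X Y).hom

/-! ## Supermodules over the quantum isomeric superalgebra -/

/-- A left `U_q(𝔮_n)`-supermodule. -/
structure SMod {K : Type u} [Field K] (q : Kˣ) (n : ℕ) where
  /-- The underlying vector space. -/
  carrier : Type u
  [addCommGroup : AddCommGroup carrier]
  [module : Module K carrier]
  /-- The `ℤ/2`-grading. -/
  grading : Grading K carrier
  /-- The action. -/
  act : Uq q n →ₐ[K] Module.End K carrier
  act_mem : ∀ {r : ZMod 2} {x : Uq q n}, x ∈ Uq.gr q r → act x ∈ grading.homGr grading r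

attribute [instance] SMod.addCommGroup SMod.module

namespace SMod

section
variable {K : Type u} [Field K] {q : Kˣ} {n : ℕ}

/-- To check a property of the homogeneous elements of `U_q(𝔮_n)`, test it on products. -/
theorem gr_induction {P : ∀ r : ZMod 2, Uq q n → Prop} (one : P 0 1)
    (gen_mul : ∀ i j (r : ZMod 2) x, P r x → P (i.p + j.p + r) (Uq.gen q i j * x))
    (zero : ∀ r, P r 0) (add : ∀ r x y, P r x → P r y → P r (x + y))
    (smul : ∀ r (c : K) x, P r x → P r (c • x)) {r : ZMod 2} {x : Uq q n}
    (hx : x ∈ Uq.gr q r) : P r x := by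
  induction hx using Submodule.span_induction with
  | zero => exact zero r
  | add a b _ _ ha hb => exact add r a b ha hb
  | smul c a _ ha => exact smul r c a ha
  | mem x hx =>
    obtain ⟨l, rfl, rfl⟩ := hx
    induction l with
    | nil => exact one
    | cons ij l ih => exact gen_mul ij.1 ij.2 _ _ ih

theorem act_mem_of_gen {M : Type u} [AddCommGroup M] [Module K M] (G : Grading K M)
    (act : Uq q n →ₐ[K] Module.End K M)
    (h : ∀ i j : Idx n, act (Uq.gen q i j) ∈ G.homGr G (i.p + j.p))
    {r : ZMod 2} {x : Uq q n} (hx : x ∈ Uq.gr q r) : act x ∈ G.homGr G r := by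
  refine gr_induction (P := fun r x => act x ∈ G.homGr G r) ?_ ?_ ?_ ?_ ?_ hx
  · rw [map_one]; exact Grading.id_mem_homGr G
  · intro i j r x hx
    rw [map_mul, add_comm]
    exact Grading.comp_mem_homGr G G G hx (h i j)
  · intro r; rw [map_zero]; exact zero_mem _
  · intro r x y hx hy; rw [map_add]; exact add_mem hx hy
  · intro r c x hx; rw [map_smul]; exact Submodule.smul_mem _ _ hx

/-- The supermodule on which the generators `u_{ij}` act by given operators. -/
abbrev ofOps {M : Type u} [AddCommGroup M] [Module K M] (G : Grading K M)
    (t : Idx n → Idx n → Module.End K M) (ht : Uq.IsRep q t)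
    (hp : ∀ i j : Idx n, t i j ∈ G.homGr G (i.p + j.p)) : SMod q n where
  carrier := M
  grading := G
  act := Uq.lift q t ht
  act_mem := act_mem_of_gen G _ fun i j => by rw [Uq.lift_gen]; exact hp i j

/-- The operator by which the generator `u_{ij}` acts. -/
def op (M : SMod q n) (i j : Idx n) : Module.End K M.carrier := M.act (Uq.gen q i j)

theorem op_mem (M : SMod q n) (i j : Idx n) : M.op i j ∈ M.grading.homGr M.grading (i.p + j.p) :=
  M.act_mem (Uq.gen_mem_gr q i j)

theorem isRep_op (M : SMod q n) : Uq.IsRep q M.op := (Uq.isRep_gen q).map q M.act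

@[simp] theorem ofOps_op {M : Type u} [AddCommGroup M] [Module K M] (G : Grading K M)
    (t : Idx n → Idx n → Module.End K M) (ht : Uq.IsRep q t)
    (hp : ∀ i j : Idx n, t i j ∈ G.homGr G (i.p + j.p)) (i j : Idx n) :
    (ofOps (q := q) G t ht hp).op i j = t i j := by
  change Uq.lift q t ht (Uq.gen q i j) = t i j
  exact Uq.lift_gen q t ht i j

/-! ### Morphisms -/

/-- The homomorphisms of parity `r`: the linear maps `f` of parity `r` with
`f (x v) = (-1)^{r x̄} x f(v)` for homogeneous `x ∈ U_q(𝔮_n)`. -/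
def homU (M N : SMod q n) (r : ZMod 2) : Submodule K (M.carrier →ₗ[K] N.carrier) where
  carrier := {f | f ∈ M.grading.homGr N.grading r ∧
    ∀ t, ∀ x ∈ Uq.gr q t, f ∘ₗ M.act x = sgn (k := K) (r * t) • (N.act x ∘ₗ f)}
  add_mem' hf hg := ⟨add_mem hf.1 hg.1, fun t x hx => by
    rw [LinearMap.add_comp, LinearMap.comp_add, smul_add, hf.2 t x hx, hg.2 t x hx]⟩
  zero_mem' := ⟨zero_mem _, fun t x hx => by simp⟩
  smul_mem' c f hf := ⟨Submodule.smul_mem _ c hf.1, fun t x hx => by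
    rw [LinearMap.smul_comp, LinearMap.comp_smul, hf.2 t x hx, smul_comm]⟩

theorem mem_homU_of_op {M N : SMod q n} {r : ZMod 2} {f : M.carrier →ₗ[K] N.carrier}
    (hf : f ∈ M.grading.homGr N.grading r)
    (h : ∀ i j : Idx n, f ∘ₗ M.op i j = sgn (k := K) (r * (i.p + j.p)) • (N.op i j ∘ₗ f)) :
    f ∈ homU M N r := by
  refine ⟨hf, fun t x hx => ?_⟩
  refine gr_induction (P := fun t x => f ∘ₗ M.act x = sgn (k := K) (r * t) • (N.act x ∘ₗ f))
    ?_ ?_ ?_ ?_ ?_ hx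
  · simp [Module.End.one_eq_id]
  · intro i j s x hx
    calc f ∘ₗ M.act (Uq.gen q i j * x) = (f ∘ₗ M.op i j) ∘ₗ M.act x := by rw [map_mul]; rfl
      _ = sgn (k := K) (r * (i.p + j.p)) • (N.op i j ∘ₗ (f ∘ₗ M.act x)) := by
        rw [h, LinearMap.smul_comp, LinearMap.comp_assoc]
      _ = _ := by
        rw [hx, LinearMap.comp_smul, smul_smul, ← sgn_add, ← mul_add, map_mul]; rfl
  · intro s; simp
  · intro s x y hx hy
    rw [map_add, map_add, LinearMap.comp_add, LinearMap.add_comp, hx, hy, smul_add]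
  · intro s c x hx
    rw [map_smul, map_smul, LinearMap.comp_smul, LinearMap.smul_comp, hx, smul_comm]

theorem homU_op {M N : SMod q n} {r : ZMod 2} {f : M.carrier →ₗ[K] N.carrier}
    (hf : f ∈ homU M N r) (i j : Idx n) :
    f ∘ₗ M.op i j = sgn (k := K) (r * (i.p + j.p)) • (N.op i j ∘ₗ f) :=
  hf.2 _ _ (Uq.gen_mem_gr q i j)

theorem id_mem_homU (M : SMod q n) : LinearMap.id ∈ homU M M 0 :=
  ⟨Grading.id_mem_homGr _, fun t x _ => by simp⟩

theorem comp_mem_homU {M N P : SMod q n} {r s : ZMod 2} {f : M.carrier →ₗ[K] N.carrier}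
    {g : N.carrier →ₗ[K] P.carrier} (hf : f ∈ homU M N r) (hg : g ∈ homU N P s) :
    g ∘ₗ f ∈ homU M P (r + s) :=
  ⟨Grading.comp_mem_homGr _ _ _ hf.1 hg.1, fun t x hx => by
    rw [LinearMap.comp_assoc, hf.2 t x hx, LinearMap.comp_smul, ← LinearMap.comp_assoc,
      hg.2 t x hx, LinearMap.smul_comp, smul_smul, ← sgn_add, ← add_mul, LinearMap.comp_assoc]⟩

/-- All homomorphisms of supermodules: the sums of even and odd ones. -/
def homSub (M N : SMod q n) : Submodule K (M.carrier →ₗ[K] N.carrier) := homU M N 0 ⊔ homU M N 1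

theorem homU_le (M N : SMod q n) (r : ZMod 2) : homU M N r ≤ homSub M N := by
  rcases zmod2_cases r with rfl | rfl
  · exact le_sup_left
  · exact le_sup_right

theorem homSub_induction {M N : SMod q n} {P : (M.carrier →ₗ[K] N.carrier) → Prop}
    (h : ∀ r, ∀ f ∈ homU M N r, P f) (add : ∀ f g, P f → P g → P (f + g))
    {f : M.carrier →ₗ[K] N.carrier} (hf : f ∈ homSub M N) : P f := by
  obtain ⟨f0, h0, f1, h1, rfl⟩ := Submodule.mem_sup.1 hf
  exact add _ _ (h 0 f0 h0) (h 1 f1 h1)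

theorem comp_mem_homSub {M N P : SMod q n} {f : M.carrier →ₗ[K] N.carrier}
    {g : N.carrier →ₗ[K] P.carrier} (hf : f ∈ homSub M N) (hg : g ∈ homSub N P) :
    g ∘ₗ f ∈ homSub M P := by
  refine homSub_induction (P := fun f => g ∘ₗ f ∈ homSub M P) ?_ ?_ hf
  · intro r f hf
    refine homSub_induction (P := fun g => g ∘ₗ f ∈ homSub M P) ?_ ?_ hg
    · intro s g hg; exact homU_le _ _ _ (comp_mem_homU hf hg)
    · intro g g' h h'; rw [LinearMap.add_comp]; exact add_mem h h'
  · intro f f' h h'; rw [LinearMap.comp_add]; exact add_mem h h'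

/-- A homomorphism of supermodules, not necessarily homogeneous. -/
abbrev Hom (M N : SMod q n) : Type u := homSub M N

instance : Category (SMod q n) where
  Hom M N := Hom M N
  id M := ⟨LinearMap.id, homU_le _ _ 0 (id_mem_homU M)⟩
  comp f g := ⟨g.1 ∘ₗ f.1, comp_mem_homSub f.2 g.2⟩

/-- The linear map underlying a morphism. -/
def toLin {M N : SMod q n} (f : M ⟶ N) : M.carrier →ₗ[K] N.carrier := f.1

theorem hom_ext {M N : SMod q n} {f g : M ⟶ N} (h : toLin f = toLin g) : f = g := Subtype.ext h

/-- The morphism given by a homogeneous homomorphism. -/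
def ofLin {M N : SMod q n} (f : M.carrier →ₗ[K] N.carrier) {r : ZMod 2} (hf : f ∈ homU M N r) :
    M ⟶ N := ⟨f, homU_le _ _ r hf⟩

@[simp] theorem toLin_ofLin {M N : SMod q n} (f : M.carrier →ₗ[K] N.carrier) {r : ZMod 2}
    (hf : f ∈ homU M N r) : toLin (ofLin f hf) = f := rfl

@[simp] theorem toLin_id (M : SMod q n) : toLin (𝟙 M) = LinearMap.id := rfl

@[simp] theorem toLin_comp {M N P : SMod q n} (f : M ⟶ N) (g : N ⟶ P) :
    toLin (f ≫ g) = toLin g ∘ₗ toLin f := rfl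

instance (M N : SMod q n) : AddCommGroup (M ⟶ N) := inferInstanceAs (AddCommGroup (homSub M N))
instance (M N : SMod q n) : Module K (M ⟶ N) := inferInstanceAs (Module K (homSub M N))

@[simp] theorem toLin_add {M N : SMod q n} (f g : M ⟶ N) : toLin (f + g) = toLin f + toLin g := rfl

@[simp] theorem toLin_smul {M N : SMod q n} (c : K) (f : M ⟶ N) :
    toLin (c • f) = c • toLin f := rfl

instance : Preadditive (SMod q n) where
  homGroup M N := inferInstance
  add_comp M N P f f' g := hom_ext (by simp [LinearMap.comp_add])
  comp_add M N P f g g' := hom_ext (by simp [LinearMap.add_comp])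

instance : Linear K (SMod q n) where
  homModule M N := inferInstance
  smul_comp M N P c f g := hom_ext (by simp [LinearMap.comp_smul])
  comp_smul M N P f c g := hom_ext (by simp [LinearMap.smul_comp])

/-- `toLin` as a linear map. -/
def toLinₗ (M N : SMod q n) : (M ⟶ N) →ₗ[K] (M.carrier →ₗ[K] N.carrier) where
  toFun := toLin
  map_add' _ _ := rfl
  map_smul' _ _ := rfl

theorem isCompl_homU (M N : SMod q n) : IsCompl ((homU M N 0).comap (toLinₗ M N))
    ((homU M N 1).comap (toLinₗ M N)) := by
  constructor
  · rw [Submodule.disjoint_def]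
    intro f h0 h1
    have := Submodule.disjoint_def.1 (Grading.disjoint_homGr M.grading N.grading) (toLin f) h0.1 h1.1
    exact hom_ext this
  · rw [codisjoint_iff, eq_top_iff]
    intro f _
    obtain ⟨f0, h0, f1, h1, h⟩ := Submodule.mem_sup.1 f.2
    have : f = ofLin f0 h0 + ofLin f1 h1 := hom_ext h.symm
    rw [this]
    exact Submodule.add_mem_sup h0 h1

instance : Supercategory K (SMod q n) where
  gr M N r := (homU M N r).comap (toLinₗ M N)
  isCompl := isCompl_homU
  id_mem := id_mem_homU
  comp_mem hf hg := comp_mem_homU hf hg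

theorem mem_gr_iff {M N : SMod q n} {r : ZMod 2} {f : M ⟶ N} :
    f ∈ gr (k := K) M N r ↔ toLin f ∈ homU M N r := Iff.rfl

end

end SMod

namespace Grading
variable {k : Type u} [CommRing k]
variable {M M' N N' P P' : Type u} [AddCommGroup M] [Module k M] [AddCommGroup M'] [Module k M']
  [AddCommGroup N] [Module k N] [AddCommGroup N'] [Module k N']
  [AddCommGroup P] [Module k P] [AddCommGroup P'] [Module k P']
  (G : Grading k M) (G' : Grading k M') (H : Grading k N) (H' : Grading k N') (L : Grading k P)
  (L' : Grading k P')

theorem tensorMap_even (f : M →ₗ[k] M') {g : N →ₗ[k] N'} (hg : g ∈ homGr H H' 0) :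
    tensorMap G H H' f g = TensorProduct.map f g := by
  rw [tensorMap_of_mem G H H' f hg, par_zero, LinearMap.comp_id]

theorem tensorMap_assoc (f : M →ₗ[k] M') (g : N →ₗ[k] N') (h : P →ₗ[k] P') :
    (TensorProduct.assoc k M' N' P').toLinearMap ∘ₗ
        tensorMap (G.tensor H) L L' (tensorMap G H H' f g) h
      = tensorMap G (H.tensor L) (H'.tensor L') f (tensorMap H L L' g h) ∘ₗ
        (TensorProduct.assoc k M N P).toLinearMap := by
  have key : ∀ r, ∀ g ∈ homGr H H' r, ∀ s, ∀ h ∈ homGr L L' s,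
      (TensorProduct.assoc k M' N' P').toLinearMap ∘ₗ
        tensorMap (G.tensor H) L L' (tensorMap G H H' f g) h
      = tensorMap G (H.tensor L) (H'.tensor L') f (tensorMap H L L' g h) ∘ₗ
        (TensorProduct.assoc k M N P).toLinearMap := by
    intro r g hg s h hh
    apply TensorProduct.ext
    apply tensor_hom_ext G H
    intro a b u hu v hv
    ext w
    simp only [TensorProduct.mk_apply, LinearMap.comp_apply,
      LinearEquiv.coe_coe, TensorProduct.assoc_tmul, LinearMap.compr₂ₛₗ_apply]
    rw [tensorMap_tmul _ L L' _ hh (tmul_mem G H hu hv), tensorMap_tmul G H H' f hg hu,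
      tensorMap_tmul G _ _ f (tensorMap_mem H H' L L' hg hh) hu, tensorMap_tmul H L L' g hh hv]
    simp only [← TensorProduct.smul_tmul', TensorProduct.tmul_smul, map_smul,
      TensorProduct.assoc_tmul, smul_smul, ← sgn_add]
    congr 2
    ring
  rw [← component_add_component H H' g, ← component_add_component L L' h]
  have hg := fun r => component_mem H H' r g
  have hh := fun r => component_mem L L' r h
  simp only [map_add, LinearMap.add_apply, LinearMap.comp_add, LinearMap.add_comp]
  rw [key _ _ (hg 0) _ _ (hh 0), key _ _ (hg 0) _ _ (hh 1), key _ _ (hg 1) _ _ (hh 0),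
    key _ _ (hg 1) _ _ (hh 1)]

theorem tensorMap_lid (g : N →ₗ[k] N') :
    (TensorProduct.lid k N').toLinearMap ∘ₗ tensorMap (base k) H H' LinearMap.id g
      = g ∘ₗ (TensorProduct.lid k N).toLinearMap := by
  have key : ∀ r, ∀ g ∈ homGr H H' r,
      (TensorProduct.lid k N').toLinearMap ∘ₗ tensorMap (base k) H H' LinearMap.id g
      = g ∘ₗ (TensorProduct.lid k N).toLinearMap := by
    intro r g hg
    apply TensorProduct.ext'
    intro c x
    rw [LinearMap.comp_apply, tensorMap_tmul _ H H' _ hg (base_zero c)]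
    simp
  rw [← component_add_component H H' g]
  simp only [map_add, LinearMap.comp_add, LinearMap.add_comp]
  rw [key _ _ (component_mem H H' 0 g), key _ _ (component_mem H H' 1 g)]

theorem tensorMap_rid (f : M →ₗ[k] M') :
    (TensorProduct.rid k M').toLinearMap ∘ₗ tensorMap G (base k) (base k) f LinearMap.id
      = f ∘ₗ (TensorProduct.rid k M).toLinearMap := by
  rw [tensorMap_even G _ _ f (id_mem_homGr _)]
  apply TensorProduct.ext'
  intro x c
  simp

theorem symm_mem_homGr (e : M ≃ₗ[k] N) (h : e.toLinearMap ∈ homGr G H 0) :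
    e.symm.toLinearMap ∈ homGr H G 0 := by
  have key : ∀ s, H.proj s ∘ₗ e.toLinearMap = e.toLinearMap ∘ₗ G.proj s := by
    intro s
    apply G.hom_ext
    intro t x hx
    have := h t x hx
    rw [add_zero] at this
    rw [LinearMap.comp_apply, LinearMap.comp_apply, H.proj_apply_of_mem this,
      G.proj_apply_of_mem hx]
    split_ifs <;> simp
  intro s x hx
  have h1 := LinearMap.congr_fun (key s) (e.symm x)
  simp only [LinearMap.comp_apply, LinearEquiv.coe_coe, LinearEquiv.apply_symm_apply] at h1
  rw [H.proj_of_mem hx] at h1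
  rw [add_zero, LinearEquiv.coe_coe, (LinearEquiv.symm_apply_eq e).2 h1]
  exact G.proj_mem _ _

end Grading

namespace SMod

section
variable {K : Type u} [Field K] {q : Kˣ} {n : ℕ}

/-! ### Objects -/

theorem isRep_unit : Uq.IsRep q fun i j : Idx n => if i = j then (1 : Module.End K K) else 0 where
  lt i j h := if_neg (ne_of_gt h)
  diag i := by simp
  yb i b k d := by
    have e : ∀ a : ZMod 2, a + a = 0 := by decide
    rw [Finset.sum_eq_single i, Finset.sum_eq_single k, Finset.sum_eq_single b,
      Finset.sum_eq_single d]
    · simp [e]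
    · intro l _ hl; simp [hl]
    · simp
    · intro j _ hj; simp [hj]
    · simp
    · intro l _ hl; simp [Ne.symm hl]
    · simp
    · intro j _ hj; simp [Ne.symm hj]
    · simp

variable (q n) in
/-- The trivial supermodule, on which `U_q(𝔮_n)` acts by the counit `ε(u_{ij}) = δ_{ij}`. -/
@[reducible] def one : SMod q n :=
  ofOps (q := q) (Grading.base K) (fun i j => if i = j then 1 else 0) isRep_unit (by
    intro i j
    by_cases h : i = j
    · subst h
      have e : ∀ a : ZMod 2, a + a = 0 := by decide
      simp only [if_true]
      rw [e]
      exact Grading.id_mem_homGr _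
    · rw [if_neg h]; exact zero_mem _)

/-- The grading on `K^{n|n}`, where the basis vector `v_i` has parity `p(i)`. -/
def gradingV (K : Type u) [Field K] (n : ℕ) : Grading K (Idx n → K) :=
  Grading.ofProj
    (fun r =>
      { carrier := {v | ∀ i, i.p ≠ r → v i = 0}
        add_mem' := fun {v w} hv hw i hi => by rw [Pi.add_apply, hv i hi, hw i hi, add_zero]
        zero_mem' := fun _ _ => rfl
        smul_mem' := fun c v hv i hi => by rw [Pi.smul_apply, hv i hi, smul_zero] })
    (fun r =>
      { toFun := fun v i => if i.p = r then v i else 0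
        map_add' := fun v w => by ext i; by_cases h : i.p = r <;> simp [h]
        map_smul' := fun c v => by ext i; by_cases h : i.p = r <;> simp [h] })
    (fun r v i hi => if_neg hi)
    (fun v => by
      ext i
      rcases zmod2_cases i.p with h | h <;> simp [h])
    (fun r v hv => by
      ext i
      change (if i.p = r then v i else 0) = 0
      split_ifs with h
      · refine hv i ?_
        rw [h]; clear h hv; revert r; decide
      · rfl)

theorem mem_gradingV {r : ZMod 2} {v : Idx n → K} :
    v ∈ (gradingV K n).gr r ↔ ∀ i, i.p ≠ r → v i = 0 := Iff.rfl

theorem single_mem (i : Idx n) (c : K) : Pi.single i c ∈ (gradingV K n).gr i.p := by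
  intro j hj
  rw [Pi.single_apply, if_neg]
  rintro rfl
  exact hj rfl

theorem toLin'_Theta_mem (i j : Idx n) : Matrix.toLin' (Theta q i j) ∈
    (gradingV K n).homGr (gradingV K n) (i.p + j.p) := by
  intro s v hv a ha
  rw [Matrix.toLin'_apply, Matrix.mulVec, dotProduct]
  refine Finset.sum_eq_zero fun c _ => ?_
  rcases theta_parity q a c i j with h | h
  · rw [h, zero_mul]
  · rw [hv c, mul_zero]
    rintro rfl
    apply ha
    rw [← h, add_left_comm]
    generalize a.p = x; generalize c.p = y; revert x y; decide

theorem isRep_V : Uq.IsRep q fun i j : Idx n => Matrix.toLin' (Theta q i j) :=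
  (isRep_Theta q).map q (Matrix.toLinAlgEquiv' : _ ≃ₐ[K] _).toAlgHom

variable (q n) in
/-- The natural supermodule `V`, on which `u_{ij}` acts by `Θ_{ij}`. -/
@[reducible] def V : SMod q n :=
  ofOps (q := q) (gradingV K n) (fun i j => Matrix.toLin' (Theta q i j)) isRep_V toLin'_Theta_mem

/-- The tensor product of supermodules. -/
@[reducible] def tensor (M N : SMod q n) : SMod q n :=
  ofOps (q := q) (M.grading.tensor N.grading) (tensorOps M.grading N.grading M.op N.op)
    (isRep_tensorOps q _ _ M.isRep_op N.isRep_op M.op_mem N.op_mem)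
    (tensorOps_mem _ _ M.op_mem N.op_mem)

/-- The dual supermodule, with `(x f)(v) = (-1)^{x̄ f̄} f(S(x) v)`. -/
@[reducible] def dual (M : SMod q n) : SMod q n :=
  ofOps (q := q) M.grading.dual
    (fun i j => M.grading.transpose (M.act (Uq.antipodeGen q i j)))
    (by
      obtain ⟨hS, h1, h2⟩ := Uq.inverse_L_spec q (n := n)
      refine isRep_transpose q M.grading M.isRep_op
        (S := Matrix.of fun i j => M.act (Uq.antipodeGen q i j)) ?_ ?_ ?_ ?_
      · ext i j : 1
        have := congrArg M.act (congrFun (congrFun h1 i) j)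
        rw [Matrix.mul_apply, map_sum] at this
        simp only [map_mul] at this
        rw [Matrix.mul_apply]
        refine this.trans ?_
        rw [Matrix.one_apply, Matrix.one_apply]
        split_ifs <;> simp
      · ext i j : 1
        have := congrArg M.act (congrFun (congrFun h2 i) j)
        rw [Matrix.mul_apply, map_sum] at this
        simp only [map_mul] at this
        rw [Matrix.mul_apply]
        refine this.trans ?_
        rw [Matrix.one_apply, Matrix.one_apply]
        split_ifs <;> simp
      · intro i j h
        change M.act (Uq.antipodeGen q i j) = 0
        rw [Uq.antipodeGen, hS.1 i j h, map_zero]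
      · intro i j
        exact M.act_mem (hS.2 i j))
    (fun i j => Grading.transpose_mem _ (M.act_mem ((Uq.inverse_L_spec q).1.2 i j)))

@[simp] theorem one_op (i j : Idx n) : (one q n).op i j = if i = j then 1 else 0 := ofOps_op ..
@[simp] theorem V_op (i j : Idx n) : (V q n).op i j = Matrix.toLin' (Theta q i j) := ofOps_op ..
theorem tensor_op (M N : SMod q n) (i j : Idx n) :
    (tensor M N).op i j = tensorOps M.grading N.grading M.op N.op i j := ofOps_op ..
theorem dual_op (M : SMod q n) (i j : Idx n) :
    (dual M).op i j = M.grading.transpose (M.act (Uq.antipodeGen q i j)) := ofOps_op ..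

end

end SMod

namespace SMod

section
variable {K : Type u} [Field K] {q : Kˣ} {n : ℕ}

theorem comp_sum' {A B C : Type u} [AddCommGroup A] [Module K A] [AddCommGroup B] [Module K B]
    [AddCommGroup C] [Module K C] (f : B →ₗ[K] C) (g : Idx n → A →ₗ[K] B) :
    f ∘ₗ ∑ m, g m = ∑ m, f ∘ₗ g m := by
  ext x; simp

theorem sum_comp' {A B C : Type u} [AddCommGroup A] [Module K A] [AddCommGroup B] [Module K B]
    [AddCommGroup C] [Module K C] (f : A →ₗ[K] B) (g : Idx n → B →ₗ[K] C) :
    (∑ m, g m) ∘ₗ f = ∑ m, g m ∘ₗ f := by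
  ext x; simp

/-! ### The monoidal structure -/

theorem tensorMap_mem_homU {M M' N N' : SMod q n} {r s : ZMod 2}
    {f : M.carrier →ₗ[K] M'.carrier} {g : N.carrier →ₗ[K] N'.carrier}
    (hf : f ∈ homU M M' r) (hg : g ∈ homU N N' s) :
    Grading.tensorMap M.grading N.grading N'.grading f g
      ∈ homU (tensor M N) (tensor M' N') (r + s) := by
  apply mem_homU_of_op
  · exact Grading.tensorMap_mem _ _ _ _ hf.1 hg.1
  intro i j
  rw [tensor_op, tensor_op, tensorOps, tensorOps, comp_sum', sum_comp',
    Finset.smul_sum]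
  refine Finset.sum_congr rfl fun m _ => ?_
  rw [LinearMap.comp_smul, LinearMap.smul_comp,
    Grading.tensorMap_comp M.grading M.grading N.grading N.grading N'.grading f _ hg.1
      (M.op_mem i m),
    Grading.tensorMap_comp M.grading M'.grading N.grading N'.grading N'.grading _ g
      (N'.op_mem m j) hf.1, homU_op hf, homU_op hg]
  simp only [map_smul, LinearMap.smul_apply, smul_smul, ← sgn_add]
  refine congrArg₂ (· • ·) (congrArg _ ?_) rfl
  generalize i.p = a; generalize j.p = b; generalize m.p = c
  clear hf hg; revert r s a b c; decide

theorem tensorMap_mem_homSub {M M' N N' : SMod q n}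
    {f : M.carrier →ₗ[K] M'.carrier} {g : N.carrier →ₗ[K] N'.carrier}
    (hf : f ∈ homSub M M') (hg : g ∈ homSub N N') :
    Grading.tensorMap M.grading N.grading N'.grading f g
      ∈ homSub (tensor M N) (tensor M' N') := by
  refine homSub_induction (P := fun f => Grading.tensorMap M.grading N.grading N'.grading f g
      ∈ homSub (tensor M N) (tensor M' N')) ?_ ?_ hf
  · intro r f hf
    refine homSub_induction (P := fun g => Grading.tensorMap M.grading N.grading N'.grading f g
      ∈ homSub (tensor M N) (tensor M' N')) ?_ ?_ hg
    · intro s g hg; exact homU_le _ _ _ (tensorMap_mem_homU hf hg)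
    · intro g g' h h'; rw [map_add]; exact add_mem h h'
  · intro f f' h h'; rw [map_add, LinearMap.add_apply]; exact add_mem h h'

/-- The tensor product of morphisms, `(f ⊗ g)(v ⊗ w) = (-1)^{ḡ v̄} f v ⊗ g w`. -/
def tensorHom {M M' N N' : SMod q n} :
    (M ⟶ M') →ₗ[K] (N ⟶ N') →ₗ[K] (tensor M N ⟶ tensor M' N') :=
  LinearMap.mk₂ K
    (fun f g => ⟨Grading.tensorMap M.grading N.grading N'.grading (toLin f) (toLin g),
      tensorMap_mem_homSub f.2 g.2⟩)
    (fun f f' g => hom_ext (by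
      change Grading.tensorMap M.grading N.grading N'.grading (toLin f + toLin f') (toLin g) = _
      rw [map_add]; rfl))
    (fun c f g => hom_ext (by
      change Grading.tensorMap M.grading N.grading N'.grading (c • toLin f) (toLin g) = _
      rw [map_smul]; rfl))
    (fun f g g' => hom_ext (by
      change Grading.tensorMap M.grading N.grading N'.grading (toLin f) (toLin g + toLin g') = _
      rw [map_add]; rfl))
    (fun c f g => hom_ext (by
      change Grading.tensorMap M.grading N.grading N'.grading (toLin f) (c • toLin g) = _
      rw [map_smul]; rfl))

theorem toLin_tensorHom {M M' N N' : SMod q n} (f : M ⟶ M') (g : N ⟶ N') :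
    toLin (tensorHom f g)
      = Grading.tensorMap M.grading N.grading N'.grading (toLin f) (toLin g) := rfl

/-- The isomorphism given by an even isomorphism of the underlying spaces commuting with the
action. -/
def isoOfEquiv {M N : SMod q n} (e : M.carrier ≃ₗ[K] N.carrier)
    (h : e.toLinearMap ∈ homU M N 0) : M ≅ N where
  hom := ofLin e.toLinearMap h
  inv := ofLin (r := 0) e.symm.toLinearMap (by
    apply mem_homU_of_op (Grading.symm_mem_homGr _ _ e h.1)
    intro i j
    have := homU_op h i j
    rw [zero_mul, sgn_zero, one_smul] at this ⊢
    ext x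
    simp only [LinearMap.comp_apply, LinearEquiv.coe_coe]
    rw [LinearEquiv.symm_apply_eq]
    have h2 := LinearMap.congr_fun this (e.symm x)
    simp only [LinearMap.comp_apply, LinearEquiv.coe_coe, LinearEquiv.apply_symm_apply] at h2
    exact h2.symm)
  hom_inv_id := hom_ext (by ext x; simp)
  inv_hom_id := hom_ext (by ext x; simp)

@[simp] theorem toLin_isoOfEquiv_hom {M N : SMod q n} (e : M.carrier ≃ₗ[K] N.carrier)
    (h : e.toLinearMap ∈ homU M N 0) : toLin (isoOfEquiv e h).hom = e.toLinearMap := rfl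

theorem assoc_mem (M N P : SMod q n) :
    (TensorProduct.assoc K M.carrier N.carrier P.carrier).toLinearMap
      ∈ homU (tensor (tensor M N) P) (tensor M (tensor N P)) 0 := by
  apply mem_homU_of_op
  · apply Grading.mem_homGr_tensor
    intro s t x hx w hw
    rw [add_zero]
    rw [Grading.tensor_gr] at hx
    induction hx using Submodule.span_induction with
    | zero => simp
    | add x y _ _ hx hy => rw [TensorProduct.add_tmul, _root_.map_add]; exact add_mem hx hy
    | smul c x _ hx =>
      rw [← TensorProduct.smul_tmul', _root_.map_smul]; exact Submodule.smul_mem _ _ hx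
    | mem x hx =>
      obtain ⟨a, b, rfl, u, hu, v, hv, rfl⟩ := hx
      rw [add_assoc]
      exact Grading.tmul_mem _ _ hu (Grading.tmul_mem _ _ hv hw)
  · intro i j
    rw [zero_mul, sgn_zero, one_smul, tensor_op, tensor_op]
    simp only [tensorOps, comp_sum', sum_comp']
    have e1 : ∀ m : Idx n, (tensor M N).op i m = ∑ r : Idx n,
        sgn (k := K) ((i.p + r.p) * (r.p + m.p)) •
          Grading.tensorMap M.grading N.grading N.grading (M.op i r) (N.op r m) :=
      fun m => tensor_op M N i m
    have e2 : ∀ m : Idx n, (tensor N P).op m j = ∑ r : Idx n,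
        sgn (k := K) ((m.p + r.p) * (r.p + j.p)) •
          Grading.tensorMap N.grading P.grading P.grading (N.op m r) (P.op r j) :=
      fun m => tensor_op N P m j
    simp only [e1, e2, map_sum, _root_.map_smul, LinearMap.sum_apply, LinearMap.smul_apply,
      LinearMap.comp_smul, LinearMap.smul_comp, Finset.smul_sum, smul_smul, ← sgn_add,
      comp_sum', sum_comp']
    rw [Finset.sum_comm]
    refine Finset.sum_congr rfl fun r _ => Finset.sum_congr rfl fun m _ => ?_
    refine congrArg₂ (· • ·) (congrArg _ ?_) (Grading.tensorMap_assoc _ _ _ _ _ _ _ _)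
    generalize i.p = a; generalize j.p = b; generalize m.p = c; generalize r.p = d
    revert a b c d; decide

theorem lid_mem (M : SMod q n) : (TensorProduct.lid K M.carrier).toLinearMap
    ∈ homU (tensor (one q n) M) M 0 := by
  apply mem_homU_of_op
  · apply Grading.mem_homGr_tensor
    intro s t c hc v hv
    rw [add_zero]
    simp only [LinearEquiv.coe_coe, TensorProduct.lid_tmul]
    rcases zmod2_cases s with rfl | rfl
    · rw [zero_add]; exact Submodule.smul_mem _ _ hv
    · have : c = 0 := by simpa [Grading.base] using hc
      rw [this, zero_smul]; exact zero_mem _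
  · intro i j
    rw [zero_mul, sgn_zero, one_smul, tensor_op, tensorOps, Finset.sum_eq_single i]
    · have e : ∀ a : ZMod 2, a + a = 0 := by decide
      rw [one_op, if_pos rfl, e, zero_mul, sgn_zero, one_smul]
      exact Grading.tensorMap_lid _ _ _
    · intro m _ hm
      rw [one_op, if_neg (Ne.symm hm)]; simp
    · simp

theorem rid_mem (M : SMod q n) : (TensorProduct.rid K M.carrier).toLinearMap
    ∈ homU (tensor M (one q n)) M 0 := by
  apply mem_homU_of_op
  · apply Grading.mem_homGr_tensor
    intro s t v hv c hc
    rw [add_zero]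
    simp only [LinearEquiv.coe_coe, TensorProduct.rid_tmul]
    rcases zmod2_cases t with rfl | rfl
    · rw [add_zero]; exact Submodule.smul_mem _ _ hv
    · have : c = 0 := by simpa [Grading.base] using hc
      rw [this, zero_smul]; exact zero_mem _
  · intro i j
    rw [zero_mul, sgn_zero, one_smul, tensor_op, tensorOps, Finset.sum_eq_single j]
    · have e : ∀ a : ZMod 2, a + a = 0 := by decide
      rw [one_op, if_pos rfl, e, mul_zero, sgn_zero, one_smul]
      exact Grading.tensorMap_rid _ _
    · intro m _ hm
      rw [one_op, if_neg hm]; simp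
    · simp

theorem toLin_tensorHom_even {M M' N N' : SMod q n} (f : M ⟶ M') {g : N ⟶ N'}
    (hg : toLin g ∈ homU N N' 0) :
    toLin (tensorHom f g) = TensorProduct.map (toLin f) (toLin g) :=
  Grading.tensorMap_even _ _ _ _ hg.1

/-- The monoidal structure on the category of `U_q(𝔮_n)`-supermodules. -/
instance : MonoidalSupercategory K (SMod q n) where
  tensorObj := tensor
  unit := one q n
  tensorHom := tensorHom
  tensor_mem hf hg := tensorMap_mem_homU hf hg
  tensor_id M N := hom_ext (Grading.tensorMap_id _ _)
  interchange f f' g' g hf hg := hom_ext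
    (Grading.tensorMap_comp _ _ _ _ _ (toLin f') (toLin g') hg.1 hf.1 |>.trans (by
      rw [mul_comm]; rfl))
  assoc M N P := isoOfEquiv _ (assoc_mem M N P)
  leftUnitor M := isoOfEquiv _ (lid_mem M)
  rightUnitor M := isoOfEquiv _ (rid_mem M)
  assoc_even M N P := assoc_mem M N P
  leftUnitor_even := lid_mem
  rightUnitor_even := rid_mem
  assoc_naturality f g h := hom_ext
    (Grading.tensorMap_assoc _ _ _ _ _ (toLin f) (toLin g) (toLin h))
  leftUnitor_naturality f := hom_ext (Grading.tensorMap_lid _ _ (toLin f))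
  rightUnitor_naturality f := hom_ext (Grading.tensorMap_rid _ (toLin f))
  pentagon W X Y Z := hom_ext (by
    simp only [toLin_comp]
    rw [toLin_tensorHom_even (g := 𝟙 Z) _ (id_mem_homU Z),
      toLin_tensorHom_even _ (assoc_mem X Y Z)]
    ext w x y z
    rfl)
  triangle X Y := hom_ext (by
    simp only [toLin_comp]
    rw [toLin_tensorHom_even (g := 𝟙 Y) _ (id_mem_homU Y),
      toLin_tensorHom_even _ (lid_mem Y)]
    apply TensorProduct.ext_threefold
    intro x c y
    change x ⊗ₜ[K] (c • y) = (c • x) ⊗ₜ[K] y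
    rw [TensorProduct.smul_tmul])

end

end SMod

/-! ## The quantum isomeric supercategory -/

/-- The generating objects `↑` and `↓`. -/
inductive Arrow : Type
  | up
  | down

/-- The generating morphisms, with domain (bottom of the diagram) and codomain (top). -/
inductive Gen : List Arrow → List Arrow → Type
  /-- The positive up crossing. -/
  | posUp : Gen [.up, .up] [.up, .up]
  /-- The negative up crossing. -/
  | negUp : Gen [.up, .up] [.up, .up]
  /-- The negative right crossing. -/
  | negRight : Gen [.up, .down] [.down, .up]
  /-- The left cap. -/
  | leftCap : Gen [.down, .up] []
  /-- The left cup. -/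
  | leftCup : Gen [] [.up, .down]
  /-- The Clifford token. -/
  | tok : Gen [.up] [.up]

/-- The Clifford token is odd, all other generators are even. -/
def Gen.parity : ∀ {a b : List Arrow}, Gen a b → ZMod 2
  | _, _, .tok => 1
  | _, _, _ => 0

/-- Linear combinations of string diagrams, before imposing relations. -/
inductive Term (k : Type u) : List Arrow → List Arrow → Type u
  | gen {a b : List Arrow} (g : Gen a b) : Term k a b
  | id (a : List Arrow) : Term k a a
  /-- The composite `g ∘ f`, with `f` drawn below `g`. -/
  | comp {a b c : List Arrow} (f : Term k a b) (g : Term k b c) : Term k a c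
  /-- The tensor product `f ⊗ g`, with `f` drawn to the left of `g`. -/
  | tensor {a b c d : List Arrow} (f : Term k a b) (g : Term k c d) : Term k (a ++ c) (b ++ d)
  | zero (a b : List Arrow) : Term k a b
  | add {a b : List Arrow} (f g : Term k a b) : Term k a b
  | smul {a b : List Arrow} (c : k) (f : Term k a b) : Term k a b

namespace Term

/-- The identity, between equal words. -/
def castId (k : Type u) {a b : List Arrow} (h : a = b) : Term k a b := h ▸ Term.id a

/-- Homogeneous terms and their parity. -/
inductive IsHomog {k : Type u} : ∀ {a b : List Arrow}, Term k a b → ZMod 2 → Prop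
  | gen {a b : List Arrow} (g : Gen a b) : IsHomog (gen g) g.parity
  | id (a : List Arrow) : IsHomog (id a) 0
  | comp {a b c : List Arrow} {f : Term k a b} {g : Term k b c} {r s : ZMod 2} :
      IsHomog f r → IsHomog g s → IsHomog (comp f g) (r + s)
  | tensor {a b c d : List Arrow} {f : Term k a b} {g : Term k c d} {r s : ZMod 2} :
      IsHomog f r → IsHomog g s → IsHomog (tensor f g) (r + s)
  | zero (a b : List Arrow) (r : ZMod 2) : IsHomog (zero a b) r
  | add {a b : List Arrow} {f g : Term k a b} {r : ZMod 2} :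
      IsHomog f r → IsHomog g r → IsHomog (add f g) r
  | smul {a b : List Arrow} (c : k) {f : Term k a b} {r : ZMod 2} :
      IsHomog f r → IsHomog (smul c f) r

variable (k : Type u)

/-- The positive left crossing `(leftCap ⊗ 1_↑ ⊗ 1_↓) ∘ (1_↓ ⊗ posUp ⊗ 1_↓) ∘ (1_↓ ⊗ 1_↑ ⊗ leftCup)`. -/
def posLeft : Term k [.down, .up] [.up, .down] :=
  comp (b := [.down, .up, .up, .down]) (tensor (id [.down, .up]) (gen .leftCup))
    (comp (b := [.down, .up, .up, .down]) (tensor (id [.down]) (tensor (gen .posUp) (id [.down])))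
      (tensor (gen .leftCap) (id [.up, .down])))

/-- The right cap `leftCap ∘ negRight`. -/
def rightCap : Term k [.up, .down] [] := comp (gen .negRight) (gen .leftCap)

variable {k} [CommRing k]

/-- The defining relations of the quantum isomeric supercategory. -/
inductive DefRel (z : k) : ∀ {a b : List Arrow}, Term k a b → Term k a b → Prop
  | posUp_negUp : DefRel z (comp (gen .posUp) (gen .negUp)) (id [.up, .up])
  | negUp_posUp : DefRel z (comp (gen .negUp) (gen .posUp)) (id [.up, .up])
  | negRight_posLeft : DefRel z (comp (gen .negRight) (posLeft k)) (id [.up, .down])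
  | posLeft_negRight : DefRel z (comp (posLeft k) (gen .negRight)) (id [.down, .up])
  | braid : DefRel z
      (comp (b := [.up, .up, .up]) (tensor (gen .posUp) (id [.up]))
        (comp (b := [.up, .up, .up]) (tensor (id [.up]) (gen .posUp))
          (tensor (gen .posUp) (id [.up]))))
      (comp (b := [.up, .up, .up]) (tensor (id [.up]) (gen .posUp))
        (comp (b := [.up, .up, .up]) (tensor (gen .posUp) (id [.up]))
          (tensor (id [.up]) (gen .posUp))))
  | skein : DefRel z (add (gen .posUp) (smul (-1) (gen .negUp))) (smul z (id [.up, .up]))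
  | tok_tok : DefRel z (comp (gen .tok) (gen .tok)) (smul (-1) (id [.up]))
  | tok_posUp : DefRel z
      (comp (b := [.up, .up]) (tensor (gen .tok) (id [.up])) (gen .posUp))
      (comp (b := [.up, .up]) (gen .posUp) (tensor (id [.up]) (gen .tok)))
  | tok_bubble : DefRel z
      (comp (gen .leftCup) (comp (b := [.up, .down]) (tensor (gen .tok) (id [.down])) (rightCap k)))
      (zero [] [])
  | bubble : DefRel z (comp (gen .leftCup) (rightCap k)) (zero [] [])
  | zigzag_up : DefRel z
      (comp (b := [.up, .down, .up]) (tensor (gen .leftCup) (id [.up]))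
        (tensor (id [.up]) (gen .leftCap)))
      (id [.up])
  | zigzag_down : DefRel z
      (comp (b := [.down, .up, .down]) (tensor (id [.down]) (gen .leftCup))
        (tensor (gen .leftCap) (id [.down])))
      (id [.down])

/-- The congruence on diagrams generated by the axioms of a `k`-linear strict monoidal
supercategory and the defining relations. -/
inductive Rel (z : k) : ∀ {a b : List Arrow}, Term k a b → Term k a b → Prop
  | rel {a b : List Arrow} {f g : Term k a b} : DefRel z f g → Rel z f g
  | refl {a b : List Arrow} (f : Term k a b) : Rel z f f
  | symm {a b : List Arrow} {f g : Term k a b} : Rel z f g → Rel z g f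
  | trans {a b : List Arrow} {f g h : Term k a b} : Rel z f g → Rel z g h → Rel z f h
  | comp_congr {a b c : List Arrow} {f f' : Term k a b} {g g' : Term k b c} :
      Rel z f f' → Rel z g g' → Rel z (comp f g) (comp f' g')
  | tensor_congr {a b c d : List Arrow} {f f' : Term k a b} {g g' : Term k c d} :
      Rel z f f' → Rel z g g' → Rel z (tensor f g) (tensor f' g')
  | add_congr {a b : List Arrow} {f f' g g' : Term k a b} :
      Rel z f f' → Rel z g g' → Rel z (add f g) (add f' g')
  | smul_congr {a b : List Arrow} (c : k) {f f' : Term k a b} :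
      Rel z f f' → Rel z (smul c f) (smul c f')
  | add_comm {a b : List Arrow} (f g : Term k a b) : Rel z (add f g) (add g f)
  | add_assoc {a b : List Arrow} (f g h : Term k a b) :
      Rel z (add (add f g) h) (add f (add g h))
  | zero_add {a b : List Arrow} (f : Term k a b) : Rel z (add (zero a b) f) f
  | smul_add {a b : List Arrow} (c : k) (f g : Term k a b) :
      Rel z (smul c (add f g)) (add (smul c f) (smul c g))
  | add_smul {a b : List Arrow} (c d : k) (f : Term k a b) :
      Rel z (smul (c + d) f) (add (smul c f) (smul d f))
  | mul_smul {a b : List Arrow} (c d : k) (f : Term k a b) :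
      Rel z (smul (c * d) f) (smul c (smul d f))
  | one_smul {a b : List Arrow} (f : Term k a b) : Rel z (smul 1 f) f
  | zero_smul {a b : List Arrow} (f : Term k a b) : Rel z (smul 0 f) (zero a b)
  | id_comp {a b : List Arrow} (f : Term k a b) : Rel z (comp (id a) f) f
  | comp_id {a b : List Arrow} (f : Term k a b) : Rel z (comp f (id b)) f
  | comp_assoc {a b c d : List Arrow} (f : Term k a b) (g : Term k b c) (h : Term k c d) :
      Rel z (comp (comp f g) h) (comp f (comp g h))
  | add_comp {a b c : List Arrow} (f f' : Term k a b) (g : Term k b c) :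
      Rel z (comp (add f f') g) (add (comp f g) (comp f' g))
  | comp_add {a b c : List Arrow} (f : Term k a b) (g g' : Term k b c) :
      Rel z (comp f (add g g')) (add (comp f g) (comp f g'))
  | smul_comp {a b c : List Arrow} (t : k) (f : Term k a b) (g : Term k b c) :
      Rel z (comp (smul t f) g) (smul t (comp f g))
  | comp_smul {a b c : List Arrow} (t : k) (f : Term k a b) (g : Term k b c) :
      Rel z (comp f (smul t g)) (smul t (comp f g))
  | add_tensor {a b c d : List Arrow} (f f' : Term k a b) (g : Term k c d) :
      Rel z (tensor (add f f') g) (add (tensor f g) (tensor f' g))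
  | tensor_add {a b c d : List Arrow} (f : Term k a b) (g g' : Term k c d) :
      Rel z (tensor f (add g g')) (add (tensor f g) (tensor f g'))
  | smul_tensor {a b c d : List Arrow} (t : k) (f : Term k a b) (g : Term k c d) :
      Rel z (tensor (smul t f) g) (smul t (tensor f g))
  | tensor_smul {a b c d : List Arrow} (t : k) (f : Term k a b) (g : Term k c d) :
      Rel z (tensor f (smul t g)) (smul t (tensor f g))
  | tensor_id (a b : List Arrow) : Rel z (tensor (id a) (id b)) (id (a ++ b))
  | interchange {a b c a' b' c' : List Arrow} {r s : ZMod 2} {f : Term k a b} (f' : Term k b c)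
      (g' : Term k a' b') {g : Term k b' c'} : IsHomog f r → IsHomog g s →
      Rel z (comp (tensor f g') (tensor f' g))
        (smul (sgn (r * s)) (tensor (comp f f') (comp g' g)))
  | unit_tensor {a b : List Arrow} (f : Term k a b) : Rel z (tensor (id []) f) f
  | tensor_unit {a b : List Arrow} (f : Term k a b) :
      Rel z (comp (tensor f (id [])) (castId k (List.append_nil b)))
        (comp (castId k (List.append_nil a)) f)
  | tensor_assoc {a b c a' b' c' : List Arrow} (f : Term k a a') (g : Term k b b')
      (h : Term k c c') :
      Rel z (comp (tensor (tensor f g) h) (castId k (List.append_assoc a' b' c')))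
        (comp (castId k (List.append_assoc a b c)) (tensor f (tensor g h)))

variable {z : k}

theorem castId_homog {a b : List Arrow} (h : a = b) : IsHomog (castId k h) 0 := by
  subst h; exact IsHomog.id a

theorem IsHomog.of_eq {a b : List Arrow} {f : Term k a b} {r s : ZMod 2} (h : IsHomog f r)
    (e : r = s) : IsHomog f s := e ▸ h

theorem IsHomog.comp_even {a b c : List Arrow} {f : Term k a b} {g : Term k b c}
    (hf : IsHomog f 0) (hg : IsHomog g 0) : IsHomog (Term.comp f g) 0 :=
  (hf.comp hg).of_eq (add_zero 0)

theorem IsHomog.tensor_even {a b c d : List Arrow} {f : Term k a b} {g : Term k c d}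
    (hf : IsHomog f 0) (hg : IsHomog g 0) : IsHomog (Term.tensor f g) 0 :=
  (hf.tensor hg).of_eq (add_zero 0)

/-- The defining relations are homogeneous. -/
theorem DefRel.homog {a b : List Arrow} {f g : Term k a b} (h : DefRel z f g) :
    ∃ r, IsHomog f r ∧ IsHomog g r := by
  have e : (1 : ZMod 2) + 1 = 0 := by decide
  have posUp : IsHomog (k := k) (gen .posUp) 0 := .gen _
  have negUp : IsHomog (k := k) (gen .negUp) 0 := .gen _
  have negRight : IsHomog (k := k) (gen .negRight) 0 := .gen _
  have leftCap : IsHomog (k := k) (gen .leftCap) 0 := .gen _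
  have leftCup : IsHomog (k := k) (gen .leftCup) 0 := .gen _
  have tok : IsHomog (k := k) (gen .tok) 1 := .gen _
  have id := IsHomog.id (k := k)
  have posLeft : IsHomog (posLeft k) 0 :=
    ((id _).tensor_even leftCup).comp_even
      (((id _).tensor_even (posUp.tensor_even (id _))).comp_even (leftCap.tensor_even (id _)))
  have rightCap : IsHomog (rightCap k) 0 := negRight.comp_even leftCap
  cases h with
  | posUp_negUp => exact ⟨0, posUp.comp_even negUp, id _⟩
  | negUp_posUp => exact ⟨0, negUp.comp_even posUp, id _⟩
  | negRight_posLeft => exact ⟨0, negRight.comp_even posLeft, id _⟩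
  | posLeft_negRight => exact ⟨0, posLeft.comp_even negRight, id _⟩
  | braid =>
    have h1 := posUp.tensor_even (id [.up])
    have h2 := (id [.up]).tensor_even posUp
    exact ⟨0, h1.comp_even (h2.comp_even h1), h2.comp_even (h1.comp_even h2)⟩
  | skein => exact ⟨0, posUp.add (negUp.smul _), (id _).smul _⟩
  | tok_tok => exact ⟨0, (tok.comp tok).of_eq e, (id _).smul _⟩
  | tok_posUp =>
    exact ⟨1, ((tok.tensor (id _)).comp posUp).of_eq (by simp),
      (posUp.comp ((id _).tensor tok)).of_eq (by simp)⟩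
  | tok_bubble => exact ⟨_, leftCup.comp ((tok.tensor (id _)).comp rightCap), .zero _ _ _⟩
  | bubble => exact ⟨_, leftCup.comp rightCap, .zero _ _ _⟩
  | zigzag_up => exact ⟨0, (leftCup.tensor_even (id _)).comp_even ((id _).tensor_even leftCap), id _⟩
  | zigzag_down =>
    exact ⟨0, ((id _).tensor_even leftCup).comp_even (leftCap.tensor_even (id _)), id _⟩

/-- The parity involution, `f ↦ (-1)^{f̄} f`. -/
def parityInv : ∀ {a b : List Arrow}, Term k a b → Term k a b
  | _, _, gen g => smul (sgn g.parity) (gen g)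
  | _, _, id a => id a
  | _, _, comp f g => comp (parityInv f) (parityInv g)
  | _, _, tensor f g => tensor (parityInv f) (parityInv g)
  | _, _, zero a b => zero a b
  | _, _, add f g => add (parityInv f) (parityInv g)
  | _, _, smul c f => smul c (parityInv f)

theorem parityInv_castId {a b : List Arrow} (h : a = b) :
    parityInv (castId k h) = castId k h := by
  subst h; rfl

theorem IsHomog.parityInv {a b : List Arrow} {f : Term k a b} {r : ZMod 2} (h : IsHomog f r) :
    IsHomog (parityInv f) r := by
  induction h with
  | gen g => exact .smul _ (.gen g)
  | id a => exact .id a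
  | comp _ _ h1 h2 => exact .comp h1 h2
  | tensor _ _ h1 h2 => exact .tensor h1 h2
  | zero a b r => exact .zero a b r
  | add _ _ h1 h2 => exact .add h1 h2
  | smul c _ h => exact .smul c h

theorem Rel.smul_zero (c : k) (a b : List Arrow) : Rel z (smul c (zero a b)) (zero a b) :=
  ((smul_congr c (zero_smul (zero a b)).symm).trans (mul_smul c 0 _).symm).trans
    (by rw [mul_zero]; exact zero_smul _)

theorem IsHomog.parityInv_rel {a b : List Arrow} {f : Term k a b} {r : ZMod 2}
    (h : IsHomog f r) : Rel z (Term.parityInv f) (Term.smul (sgn r) f) := by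
  induction h with
  | gen g => exact .refl _
  | id a => rw [sgn_zero]; exact (Rel.one_smul _).symm
  | comp _ _ h1 h2 =>
    rw [sgn_add]
    exact ((h1.comp_congr h2).trans (.smul_comp _ _ _)).trans
      ((Rel.smul_congr _ (.comp_smul _ _ _)).trans (Rel.mul_smul _ _ _).symm)
  | tensor _ _ h1 h2 =>
    rw [sgn_add]
    exact ((h1.tensor_congr h2).trans (.smul_tensor _ _ _)).trans
      ((Rel.smul_congr _ (.tensor_smul _ _ _)).trans (Rel.mul_smul _ _ _).symm)
  | zero a b r => exact (Rel.smul_zero _ _ _).symm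
  | add _ _ h1 h2 => exact (h1.add_congr h2).trans (Rel.smul_add _ _ _).symm
  | smul c _ h =>
    refine (Rel.smul_congr c h).trans ((Rel.mul_smul _ _ _).symm.trans ?_)
    rw [mul_comm]
    exact Rel.mul_smul _ _ _

theorem Rel.parityInv {a b : List Arrow} {f g : Term k a b} (h : Rel z f g) :
    Rel z (Term.parityInv f) (Term.parityInv g) := by
  induction h with
  | rel h =>
    obtain ⟨r, h1, h2⟩ := h.homog
    exact (h1.parityInv_rel.trans (.smul_congr _ (.rel h))).trans h2.parityInv_rel.symm
  | refl f => exact .refl _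
  | symm _ ih => exact ih.symm
  | trans _ _ h1 h2 => exact h1.trans h2
  | comp_congr _ _ h1 h2 => exact h1.comp_congr h2
  | tensor_congr _ _ h1 h2 => exact h1.tensor_congr h2
  | add_congr _ _ h1 h2 => exact h1.add_congr h2
  | smul_congr c _ h => exact h.smul_congr c
  | add_comm f g => exact .add_comm _ _
  | add_assoc f g h => exact .add_assoc _ _ _
  | zero_add f => exact .zero_add _
  | smul_add c f g => exact .smul_add _ _ _
  | add_smul c d f => exact .add_smul _ _ _
  | mul_smul c d f => exact .mul_smul _ _ _
  | one_smul f => exact .one_smul _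
  | zero_smul f => exact .zero_smul _
  | id_comp f => exact .id_comp _
  | comp_id f => exact .comp_id _
  | comp_assoc f g h => exact .comp_assoc _ _ _
  | add_comp f f' g => exact .add_comp _ _ _
  | comp_add f g g' => exact .comp_add _ _ _
  | smul_comp t f g => exact .smul_comp _ _ _
  | comp_smul t f g => exact .comp_smul _ _ _
  | add_tensor f f' g => exact .add_tensor _ _ _
  | tensor_add f g g' => exact .tensor_add _ _ _
  | smul_tensor t f g => exact .smul_tensor _ _ _
  | tensor_smul t f g => exact .tensor_smul _ _ _
  | tensor_id a b => exact .tensor_id a b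
  | interchange f' g' hf hg => exact .interchange _ _ hf.parityInv hg.parityInv
  | unit_tensor f => exact .unit_tensor _
  | tensor_unit f =>
    simp only [Term.parityInv, parityInv_castId]
    exact .tensor_unit _
  | tensor_assoc f g h =>
    simp only [Term.parityInv, parityInv_castId]
    exact .tensor_assoc _ _ _

end Term

section
variable {k : Type u} [CommRing k]

/-- The objects of the quantum isomeric supercategory `Q(z)`: words in `↑` and `↓`. -/
structure QCat (z : k) : Type where
  ofWord ::
  /-- The underlying word. -/
  word : List Arrow

namespace QCat
variable {z : k}

/-- Equality of diagrams modulo the relations. -/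
def setoid (z : k) (a b : List Arrow) : Setoid (Term k a b) where
  r := Term.Rel z
  iseqv := ⟨Term.Rel.refl, Term.Rel.symm, Term.Rel.trans⟩

/-- The morphisms of `Q(z)`. -/
def Hom (z : k) (a b : List Arrow) : Type u := Quotient (setoid z a b)

/-- The morphism represented by a diagram. -/
def mk (z : k) {a b : List Arrow} (f : Term k a b) : Hom z a b := Quotient.mk (setoid z a b) f

theorem mk_eq {a b : List Arrow} {f g : Term k a b} (h : Term.Rel z f g) : mk z f = mk z g :=
  Quotient.sound (s := setoid z a b) h

theorem ind {a b : List Arrow} {P : Hom z a b → Prop} (h : ∀ f, P (mk z f)) (x : Hom z a b) : P x :=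
  Quotient.ind (s := setoid z a b) h x

namespace Hom

instance (a b : List Arrow) : Zero (Hom z a b) := ⟨mk z (.zero a b)⟩
instance (a b : List Arrow) : Add (Hom z a b) :=
  ⟨Quotient.map₂ Term.add fun _ _ h _ _ h' => Term.Rel.add_congr h h'⟩
instance (a b : List Arrow) : SMul k (Hom z a b) :=
  ⟨fun c => Quotient.map (Term.smul c) fun _ _ h => Term.Rel.smul_congr c h⟩
instance (a b : List Arrow) : Neg (Hom z a b) := ⟨fun x => (-1 : k) • x⟩

/-- Composition. -/
def comp {a b c : List Arrow} : Hom z a b → Hom z b c → Hom z a c :=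
  Quotient.map₂ Term.comp fun _ _ h _ _ h' => Term.Rel.comp_congr h h'

/-- Tensor product. -/
def tensor {a b c d : List Arrow} : Hom z a b → Hom z c d → Hom z (a ++ c) (b ++ d) :=
  Quotient.map₂ Term.tensor fun _ _ h _ _ h' => Term.Rel.tensor_congr h h'

/-- The parity involution. -/
def parityInv {a b : List Arrow} : Hom z a b → Hom z a b :=
  Quotient.map Term.parityInv fun _ _ h => Term.Rel.parityInv h

theorem mk_add {a b : List Arrow} (f g : Term k a b) : mk z (.add f g) = mk z f + mk z g := rfl
theorem mk_smul {a b : List Arrow} (c : k) (f : Term k a b) : mk z (.smul c f) = c • mk z f := rfl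

theorem zero_smul' {a b : List Arrow} (x : Hom z a b) : (0 : k) • x = 0 := by
  induction x using ind with | h f => exact mk_eq (.zero_smul f)

theorem add_smul' {a b : List Arrow} (c d : k) (x : Hom z a b) : (c + d) • x = c • x + d • x := by
  induction x using ind with | h f => exact mk_eq (.add_smul c d f)

theorem one_smul' {a b : List Arrow} (x : Hom z a b) : (1 : k) • x = x := by
  induction x using ind with | h f => exact mk_eq (.one_smul f)

theorem add_comm' {a b : List Arrow} (x y : Hom z a b) : x + y = y + x := by
  induction x using ind with | h f =>
  induction y using ind with | h g => exact mk_eq (.add_comm f g)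

theorem zero_add' {a b : List Arrow} (x : Hom z a b) : 0 + x = x := by
  induction x using ind with | h f => exact mk_eq (.zero_add f)

instance (a b : List Arrow) : AddCommGroup (Hom z a b) where
  add_assoc x y w := by
    induction x using ind with | h f =>
    induction y using ind with | h g =>
    induction w using ind with | h h => exact mk_eq (.add_assoc f g h)
  zero_add := zero_add'
  add_zero x := by rw [add_comm', zero_add']
  add_comm := add_comm'
  nsmul := nsmulRec
  zsmul := zsmulRec
  neg_add_cancel x := by
    change (-1 : k) • x + x = 0
    calc (-1 : k) • x + x = (-1 : k) • x + (1 : k) • x := by rw [one_smul']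
      _ = 0 := by rw [← add_smul', neg_add_cancel, zero_smul']

instance (a b : List Arrow) : Module k (Hom z a b) where
  one_smul := one_smul'
  mul_smul c d x := by
    induction x using ind with | h f => exact mk_eq (.mul_smul c d f)
  smul_zero c := mk_eq (Term.Rel.smul_zero c a b)
  smul_add c x y := by
    induction x using ind with | h f =>
    induction y using ind with | h g => exact mk_eq (.smul_add c f g)
  add_smul := add_smul'
  zero_smul := zero_smul'

/-- The morphisms of parity `r`: those represented by homogeneous diagrams. -/
def gr (z : k) (a b : List Arrow) (r : ZMod 2) : Submodule k (Hom z a b) where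
  carrier := {x | ∃ f, Term.IsHomog f r ∧ mk z f = x}
  add_mem' := by
    rintro _ _ ⟨f, hf, rfl⟩ ⟨g, hg, rfl⟩
    exact ⟨.add f g, .add hf hg, rfl⟩
  zero_mem' := ⟨.zero a b, .zero a b r, rfl⟩
  smul_mem' := by
    rintro c _ ⟨f, hf, rfl⟩
    exact ⟨.smul c f, .smul c hf, rfl⟩

theorem comp_mem {a b c : List Arrow} {r s : ZMod 2} {x : Hom z a b} {y : Hom z b c}
    (hx : x ∈ gr z a b r) (hy : y ∈ gr z b c s) : comp x y ∈ gr z a c (r + s) := by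
  obtain ⟨f, hf, rfl⟩ := hx
  obtain ⟨g, hg, rfl⟩ := hy
  exact ⟨.comp f g, .comp hf hg, rfl⟩

theorem tensor_mem {a b c d : List Arrow} {r s : ZMod 2} {x : Hom z a b} {y : Hom z c d}
    (hx : x ∈ gr z a b r) (hy : y ∈ gr z c d s) :
    tensor x y ∈ gr z (a ++ c) (b ++ d) (r + s) := by
  obtain ⟨f, hf, rfl⟩ := hx
  obtain ⟨g, hg, rfl⟩ := hy
  exact ⟨.tensor f g, .tensor hf hg, rfl⟩

theorem add_comp' {a b c : List Arrow} (x x' : Hom z a b) (y : Hom z b c) :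
    comp (x + x') y = comp x y + comp x' y := by
  induction x using ind with | h f =>
  induction x' using ind with | h f' =>
  induction y using ind with | h g => exact mk_eq (.add_comp f f' g)

theorem comp_add' {a b c : List Arrow} (x : Hom z a b) (y y' : Hom z b c) :
    comp x (y + y') = comp x y + comp x y' := by
  induction x using ind with | h f =>
  induction y using ind with | h g =>
  induction y' using ind with | h g' => exact mk_eq (.comp_add f g g')

theorem smul_comp' {a b c : List Arrow} (t : k) (x : Hom z a b) (y : Hom z b c) :
    comp (t • x) y = t • comp x y := by
  induction x using ind with | h f =>
  induction y using ind with | h g => exact mk_eq (.smul_comp t f g)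

theorem comp_smul' {a b c : List Arrow} (t : k) (x : Hom z a b) (y : Hom z b c) :
    comp x (t • y) = t • comp x y := by
  induction x using ind with | h f =>
  induction y using ind with | h g => exact mk_eq (.comp_smul t f g)

/-- The tensor product as a bilinear map. -/
def tensorₗ {a b c d : List Arrow} : Hom z a b →ₗ[k] Hom z c d →ₗ[k] Hom z (a ++ c) (b ++ d) :=
  LinearMap.mk₂ k tensor
    (fun x x' y => by
      induction x using ind with | h f =>
      induction x' using ind with | h f' =>
      induction y using ind with | h g => exact mk_eq (.add_tensor f f' g))
    (fun t x y => by
      induction x using ind with | h f =>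
      induction y using ind with | h g => exact mk_eq (.smul_tensor t f g))
    (fun x y y' => by
      induction x using ind with | h f =>
      induction y using ind with | h g =>
      induction y' using ind with | h g' => exact mk_eq (.tensor_add f g g'))
    (fun t x y => by
      induction x using ind with | h f =>
      induction y using ind with | h g => exact mk_eq (.tensor_smul t f g))

theorem mem_sup_gr {a b : List Arrow} (f : Term k a b) : mk z f ∈ gr z a b 0 ⊔ gr z a b 1 := by
  have key : ∀ {a b : List Arrow} (r : ZMod 2) {x : Hom z a b}, x ∈ gr z a b r →
      x ∈ gr z a b 0 ⊔ gr z a b 1 := by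
    intro a b r x hx
    rcases zmod2_cases r with rfl | rfl
    · exact Submodule.mem_sup_left hx
    · exact Submodule.mem_sup_right hx
  induction f with
  | gen g => exact key _ ⟨_, .gen g, rfl⟩
  | id a => exact key _ ⟨_, .id a, rfl⟩
  | comp f g hf hg =>
    obtain ⟨x0, h0, x1, h1, hx⟩ := Submodule.mem_sup.1 hf
    obtain ⟨y0, h0', y1, h1', hy⟩ := Submodule.mem_sup.1 hg
    change comp (mk z f) (mk z g) ∈ _
    rw [← hx, ← hy, add_comp', comp_add', comp_add']
    exact add_mem (add_mem (key _ (comp_mem h0 h0')) (key _ (comp_mem h0 h1')))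
      (add_mem (key _ (comp_mem h1 h0')) (key _ (comp_mem h1 h1')))
  | tensor f g hf hg =>
    obtain ⟨x0, h0, x1, h1, hx⟩ := Submodule.mem_sup.1 hf
    obtain ⟨y0, h0', y1, h1', hy⟩ := Submodule.mem_sup.1 hg
    change tensorₗ (mk z f) (mk z g) ∈ _
    rw [← hx, ← hy, LinearMap.map_add₂, map_add, map_add, add_add_add_comm]
    exact add_mem (add_mem (key _ (tensor_mem h0 h0')) (key _ (tensor_mem h1 h0')))
      (add_mem (key _ (tensor_mem h0 h1')) (key _ (tensor_mem h1 h1')))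
  | zero a b => exact zero_mem _
  | add f g hf hg => exact add_mem hf hg
  | smul c f hf => exact Submodule.smul_mem _ c hf

theorem parityInv_of_mem {a b : List Arrow} {r : ZMod 2} {x : Hom z a b} (hx : x ∈ gr z a b r) :
    parityInv x = sgn (k := k) r • x := by
  obtain ⟨f, hf, rfl⟩ := hx
  exact mk_eq hf.parityInv_rel

theorem isCompl_gr [Invertible (2 : k)] (a b : List Arrow) :
    IsCompl (gr z a b 0) (gr z a b 1) := by
  constructor
  · rw [Submodule.disjoint_def]
    intro x h0 h1
    have h := (parityInv_of_mem h0).symm.trans (parityInv_of_mem h1)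
    rw [sgn_zero, sgn_one] at h
    have h2 : (2 : k) • x = 0 := by
      rw [← one_add_one_eq_two, add_smul]
      nth_rewrite 1 [h]
      rw [← add_smul, neg_add_cancel, zero_smul]
    rw [← one_smul k x, ← invOf_mul_self (2 : k), mul_smul, h2, smul_zero]
  · rw [codisjoint_iff, eq_top_iff]
    intro x _
    induction x using ind with | h f => exact mem_sup_gr f

end Hom

/-! ### `Q(z)` as a monoidal supercategory -/

instance : Category.{u} (QCat z) where
  Hom a b := Hom z a.word b.word
  id a := mk z (.id a.word)
  comp f g := Hom.comp f g
  id_comp x := by induction x using ind with | h f => exact mk_eq (.id_comp f)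
  comp_id x := by induction x using ind with | h f => exact mk_eq (.comp_id f)
  assoc x y w := by
    induction x using ind with | h f =>
    induction y using ind with | h g =>
    induction w using ind with | h h => exact mk_eq (.comp_assoc f g h)

instance (a b : QCat z) : AddCommGroup (a ⟶ b) :=
  inferInstanceAs (AddCommGroup (Hom z a.word b.word))

instance (a b : QCat z) : Module k (a ⟶ b) := inferInstanceAs (Module k (Hom z a.word b.word))

instance : Preadditive (QCat z) where
  homGroup _ _ := inferInstance
  add_comp _ _ _ := Hom.add_comp'
  comp_add _ _ _ := Hom.comp_add'

instance : Linear k (QCat z) where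
  homModule _ _ := inferInstance
  smul_comp _ _ _ := Hom.smul_comp'
  comp_smul _ _ _ x t y := Hom.comp_smul' t x y

instance [Invertible (2 : k)] : Supercategory k (QCat z) where
  gr a b := Hom.gr z a.word b.word
  isCompl a b := Hom.isCompl_gr a.word b.word
  id_mem a := ⟨_, .id a.word, rfl⟩
  comp_mem := Hom.comp_mem

/-- The morphism represented by a diagram. -/
def diagram {a b : List Arrow} (f : Term k a b) : (⟨a⟩ : QCat z) ⟶ ⟨b⟩ := mk z f

/-- Concatenation of words. -/
def tensorObj (a b : QCat z) : QCat z := ⟨a.word ++ b.word⟩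

/-- Horizontal juxtaposition of diagrams. -/
def tensorHom {a b c d : QCat z} :
    (a ⟶ b) →ₗ[k] (c ⟶ d) →ₗ[k] (tensorObj a c ⟶ tensorObj b d) := Hom.tensorₗ

theorem append_assoc (a b c : QCat z) :
    tensorObj (tensorObj a b) c = tensorObj a (tensorObj b c) :=
  congrArg ofWord (List.append_assoc _ _ _)

theorem append_nil (a : QCat z) : tensorObj a ⟨[]⟩ = a := congrArg ofWord (List.append_nil a.word)

theorem eqToHom_eq {a b : QCat z} (h : a = b) (h' : a.word = b.word) :
    eqToHom h = mk z (Term.castId k h') := by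
  subst h; rfl

theorem tensor_eqToHom {a b c d : QCat z} (h : a = b) (h' : c = d) :
    tensorHom (eqToHom h) (eqToHom h') = eqToHom (congrArg₂ tensorObj h h') := by
  subst h h'; exact mk_eq (.tensor_id _ _)

theorem eqToHom_mem [Invertible (2 : k)] {a b : QCat z} (h : a = b) :
    eqToHom h ∈ gr (k := k) a b 0 := by
  subst h; exact id_mem a

instance [Invertible (2 : k)] : MonoidalSupercategory k (QCat z) where
  tensorObj := tensorObj
  unit := ⟨[]⟩
  tensorHom := tensorHom
  tensor_mem := Hom.tensor_mem
  tensor_id a b := mk_eq (.tensor_id a.word b.word)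
  interchange x x' y' y hx hy := by
    obtain ⟨f, hf, rfl⟩ : ∃ f, Term.IsHomog f _ ∧ mk z f = x := hx
    obtain ⟨g, hg, rfl⟩ : ∃ g, Term.IsHomog g _ ∧ mk z g = y := hy
    induction x' using ind with | h f' =>
    induction y' using ind with | h g' => exact mk_eq (.interchange f' g' hf hg)
  assoc a b c := eqToIso (append_assoc a b c)
  leftUnitor a := Iso.refl a
  rightUnitor a := eqToIso (append_nil a)
  assoc_even a b c := eqToHom_mem (append_assoc a b c)
  leftUnitor_even a := id_mem a
  rightUnitor_even a := eqToHom_mem (append_nil a)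
  assoc_naturality {a a' b b' c c'} x y w := by
    rw [eqToIso.hom, eqToIso.hom, eqToHom_eq (append_assoc a' b' c') (List.append_assoc _ _ _),
      eqToHom_eq (append_assoc a b c) (List.append_assoc _ _ _)]
    induction x using ind with | h f =>
    induction y using ind with | h g =>
    induction w using ind with | h h => exact mk_eq (.tensor_assoc f g h)
  leftUnitor_naturality {a b} x := by
    refine (Category.comp_id (Y := b) _).trans (Eq.trans ?_ (Category.id_comp x).symm)
    induction x using ind with | h f => exact mk_eq (.unit_tensor f)
  rightUnitor_naturality {a b} x := by
    rw [eqToIso.hom, eqToIso.hom, eqToHom_eq (append_nil b) (List.append_nil _),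
      eqToHom_eq (append_nil a) (List.append_nil _)]
    induction x using ind with | h f => exact mk_eq (.tensor_unit f)
  pentagon a b c d := by
    have h1 := tensor_eqToHom (append_assoc a b c) (rfl : d = d)
    have h2 := tensor_eqToHom (rfl : a = a) (append_assoc b c d)
    rw [eqToHom_refl] at h1 h2
    simp only [eqToIso.hom, h1, h2, eqToHom_trans]
  triangle a b := by
    have h1 := tensor_eqToHom (append_nil a) (rfl : b = b)
    have h2 : tensorHom (𝟙 a) (𝟙 b) = 𝟙 _ := mk_eq (.tensor_id a.word b.word)
    rw [eqToHom_refl] at h1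
    rw [eqToIso.hom, eqToIso.hom, h1]
    refine (congrArg _ h2).trans ?_
    exact Category.comp_id _

end QCat

end

/-! ## The incarnation superfunctor -/

section
variable {K : Type u} [Field K] (q : Kˣ) (n : ℕ)

/-- The basis vector `v_i` of `V`. -/
def vec (K : Type u) [Field K] {n : ℕ} (i : Idx n) : Idx n → K := Pi.single i 1

/-- The dual basis vector `v_i^*` of `V^*`. -/
def covec (K : Type u) [Field K] {n : ℕ} (i : Idx n) : Module.Dual K (Idx n → K) :=
  LinearMap.proj i

/-- `Θ = ∑_{i,j} Θ_{ij} ⊗ E_{ij}` as an operator on `V ⊗ V`. -/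
def thetaOp : Module.End K ((Idx n → K) ⊗[K] (Idx n → K)) :=
  ∑ i : Idx n, ∑ j : Idx n,
    Grading.tensorMap (SMod.gradingV K n) (SMod.gradingV K n) (SMod.gradingV K n)
      (Matrix.toLin' (Theta q i j)) (Matrix.toLin' (Matrix.single i j 1))

/-- `T = flip ∘ Θ`. -/
def opT : Module.End K ((Idx n → K) ⊗[K] (Idx n → K)) :=
  Grading.flip (SMod.gradingV K n) (SMod.gradingV K n) ∘ₗ thetaOp q n

/-- The evaluation `V^* ⊗ V → K`. -/
def ev (K : Type u) [Field K] (n : ℕ) : Module.Dual K (Idx n → K) ⊗[K] (Idx n → K) →ₗ[K] K :=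
  contractLeft K (Idx n → K)

/-- The coevaluation `K → V ⊗ V^*`, `1 ↦ ∑_i v_i ⊗ v_i^*`. -/
def coev (K : Type u) [Field K] (n : ℕ) : K →ₗ[K] (Idx n → K) ⊗[K] Module.Dual K (Idx n → K) :=
  LinearMap.toSpanSingleton K _ (∑ i : Idx n, vec K i ⊗ₜ[K] covec K i)

/-- `J = ∑_i (-1)^{p(i)} E_{-i,i}`. -/
def opJ (K : Type u) [Field K] (n : ℕ) : Module.End K (Idx n → K) :=
  Matrix.toLin' (∑ i : Idx n, sgn (k := K) i.p • Matrix.single (-i) i (1 : K))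

/-- The value on `v_i ⊗ v_j^*` of the image of the negative right crossing. -/
def negRightFormula {n : ℕ} (i j : Idx n) : Module.Dual K (Idx n → K) ⊗[K] (Idx n → K) :=
  (sgn (i.p * j.p) * ((q ^ (-Idx.phi i j) : Kˣ) : K)) • (covec K j ⊗ₜ[K] vec K i)
  - (if i = j then zq q • ∑ k : Idx n, if i < k then
      (sgn (i.p + k.p) * ((q ^ (2 * |i.1| - 2 * |k.1|) : Kˣ) : K)) • (covec K k ⊗ₜ[K] vec K k)
      else 0 else 0)
  - (if i = -j then zq q • ∑ k : Idx n, if j < k then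
      (sgn k.p * ((q ^ (2 * |i.1| - 2 * |k.1|) : Kˣ) : K)) • (covec K k ⊗ₜ[K] vec K (-k))
      else 0 else 0)

/-- The images of the generating objects: `↑ ↦ V` and `↓ ↦ V^*`. -/
def objV : Arrow → SMod q n
  | .up => SMod.V q n
  | .down => SMod.dual (SMod.V q n)

variable {q n} [Invertible (2 : K)]
variable (F : MonoidalSuperfunctor K (QCat (zq q)) (SMod q n))
  (a : ∀ x : Arrow, F.obj ⟨[x]⟩ ≅ objV q n x)

/-- The isomorphism from `V_x ⊗ V_y` to the image of the word `xy`. -/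
def pairHom (x y : Arrow) : SMod.tensor (objV q n x) (objV q n y) ⟶ F.obj ⟨[x, y]⟩ :=
  SMod.tensorHom (a x).inv (a y).inv ≫ (F.μ ⟨[x]⟩ ⟨[y]⟩).hom

/-- The linear map underlying the image of a generator. -/
def genMap {b c : List Arrow} (g : Gen b c) :
    (F.obj ⟨b⟩).carrier →ₗ[K] (F.obj ⟨c⟩).carrier :=
  SMod.toLin (F.map (QCat.diagram (.gen g)))

/-- `F` sends `↑` to `V` and `↓` to `V^*` (through the even isomorphisms `a`) and, under the
resulting identifications, the positive up crossing to `T`, the left cap to `ev`, and the Clifford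
token to `J`. -/
structure IsIncarnation : Prop where
  even : ∀ x, (a x).hom ∈ gr (k := K) _ _ 0
  posUp : genMap F .posUp ∘ₗ SMod.toLin (pairHom F a .up .up)
    = SMod.toLin (pairHom F a .up .up) ∘ₗ opT q n
  leftCap : genMap F .leftCap ∘ₗ SMod.toLin (pairHom F a .down .up)
    = SMod.toLin F.ε.hom ∘ₗ ev K n
  tok : genMap F .tok ∘ₗ SMod.toLin (a .up).inv = SMod.toLin (a .up).inv ∘ₗ opJ K n

/-- The formulas for the images of the remaining generators. -/
structure HasFormulas : Prop where
  negUp : ∃ T' : Module.End K ((Idx n → K) ⊗[K] (Idx n → K)), T' * opT q n = 1 ∧ opT q n * T' = 1 ∧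
    genMap F .negUp ∘ₗ SMod.toLin (pairHom F a .up .up)
      = SMod.toLin (pairHom F a .up .up) ∘ₗ T'
  leftCup : genMap F .leftCup ∘ₗ SMod.toLin F.ε.hom
    = SMod.toLin (pairHom F a .up .down) ∘ₗ coev K n
  negRight : ∀ i j : Idx n,
    genMap F .negRight (SMod.toLin (pairHom F a .up .down) (vec K i ⊗ₜ[K] covec K j))
      = SMod.toLin (pairHom F a .down .up) (negRightFormula q i j)

end

/-- The indeterminate `q` of the field `ℂ(q)`. -/
def qVar : (RatFunc ℂ)ˣ := Units.mk0 RatFunc.X RatFunc.X_ne_zero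

end Isomeric

end

open CategoryTheory Isomeric

/-!
The supercategory `Q(z)` is presented by generators and relations, so a monoidal superfunctor out
of it amounts to the images of the generators, provided that coherence is under control. The
notion of a `WordSystem` isolates that control: it is a family of objects indexed by words
together with coherent even isomorphisms `W a ⊗ W b ≅ W (a b)`. Moved along these isomorphisms,
tensor products of morphisms become strictly associative and unital (`WordSystem.tens_assoc`,
`WordSystem.tens_unit`), so string diagrams can be evaluated (`WordSystem.interp`), and the
evaluation is a monoidal superfunctor as soon as the images of the generators satisfy the defining
relations (`WordSystem.monoidalFunctor`). Conversely, every monoidal superfunctor is the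
evaluation in the word system of its values on objects.

*Uniqueness.* Isomorphisms between the images of the two letters extend in exactly one way to a
compatible family of isomorphisms on words (`WordSystem.extend`, `WordSystem.eq_extend`). This
family is natural once it commutes with the generators. For the positive crossing, the left cap
and the token this is the hypothesis; the left cup is determined as the adjoint of the left cap
(`WordSystem.cup_unique`, where evenness is needed for sliding one cup past another without a
sign), and the two negative crossings are inverses of morphisms built from these. Hence any two
incarnations are related by a unique isomorphism, and the remaining formulas need to be checked
only for one incarnation, from which they are transported to all others (`HasFormulas.of_natIso`).

*Existence.* The words in `V` and `V^*`, bracketed to the right, form a word system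
(`SMod.wordSystem`), and the relations are verified there.
* The braid relation for `T`, and the fact that `T` is a homomorphism of supermodules, are two
  readings of the Yang–Baxter equation for `Θ`: both follow from it after the signs are collected,
  the parities of the indices being constrained by the evenness and the triangularity of `Θ`
  (`braidFun_braid`, `opT_mem_homU`).
* The skein relation and the invertibility of `T` follow from `T² = z T + 1` (`opT_opT`).
* Evaluation and coevaluation are homomorphisms because `S` is the antipode (`ev_mem_homU`,
  `coev_mem_homU`).
* The image of the positive left crossing is triangular up to a permutation of the basis vectors,
  with explicit entries (`opPosLeft_covec_vec`). Its inverse is the asserted formula for the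
  negative right crossing; what makes this work is that `± z q^{-2|k|}` is a difference of
  consecutive values of `k ↦ q^{-|2k+1|}`, so that the sums telescope (`sum_telescope`,
  `apply_triangular`).
* The same telescoping sum shows that the contributions of `i` and `-i` to the bubble cancel
  (`sum_ev_negRightFormula`). The bubble with a token is an odd endomorphism of the unit object
  and vanishes for that reason (`eq_zero_of_odd`).
-/

noncomputable section

open CategoryTheory

open scoped TensorProduct

universe u v w

namespace Isomeric

open Supercategory MonoidalSupercategory

/-! ### Even morphisms in monoidal supercategories -/

section
variable {k : Type u} [CommRing k] {D : Type v} [Category.{w} D] [Preadditive D] [Linear k D]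
  [Supercategory k D]

theorem Supercategory.comp_mem_even {X Y Z : D} {f : X ⟶ Y} {g : Y ⟶ Z}
    (hf : f ∈ gr (k := k) X Y 0) (hg : g ∈ gr (k := k) Y Z 0) : f ≫ g ∈ gr (k := k) X Z 0 := by
  simpa using comp_mem hf hg

/-- The inverse of an even isomorphism is even: the odd part of the inverse composes to the odd part
of an identity. -/
theorem Supercategory.inv_mem {X Y : D} (e : X ≅ Y) (h : e.hom ∈ gr (k := k) X Y 0) :
    e.inv ∈ gr (k := k) Y X 0 := by
  have ht : e.inv ∈ gr (k := k) Y X 0 ⊔ gr (k := k) Y X 1 := by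
    rw [(Supercategory.isCompl (k := k) Y X).sup_eq_top]; trivial
  obtain ⟨a, ha, b, hb, hab⟩ := Submodule.mem_sup.1 ht
  have h1 : e.hom ≫ b ∈ gr (k := k) X X 1 := by simpa using comp_mem h hb
  have h0 : e.hom ≫ b ∈ gr (k := k) X X 0 := by
    have : e.hom ≫ b = 𝟙 X - e.hom ≫ a := by
      rw [eq_sub_iff_add_eq, ← Preadditive.comp_add, add_comm b a, hab, e.hom_inv_id]
    rw [this]
    exact sub_mem (id_mem X) (comp_mem_even h ha)
  have hz := Submodule.disjoint_def.1 (Supercategory.isCompl (k := k) X X).disjoint _ h0 h1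
  have hb0 : b = 0 := by
    have := congrArg (fun t => e.inv ≫ t) hz
    simpa using this
  rw [← hab, hb0, add_zero]
  exact ha

variable [MonoidalSupercategory k D]

theorem MonoidalSupercategory.tensor_mem_even {X Y X' Y' : D} {f : X ⟶ Y} {g : X' ⟶ Y'}
    (hf : f ∈ gr (k := k) X Y 0) (hg : g ∈ gr (k := k) X' Y' 0) :
    tensorHom (k := k) f g ∈ gr (k := k) _ _ 0 := by
  simpa using tensor_mem hf hg

/-- Interchange, when the lower left morphism is even. -/
theorem MonoidalSupercategory.tensor_comp_left {X Y Z X' Y' Z' : D} (f : X ⟶ Y) (f' : Y ⟶ Z)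
    (g' : X' ⟶ Y') (g : Y' ⟶ Z') (hf : f ∈ gr (k := k) X Y 0) :
    tensorHom (k := k) f g' ≫ tensorHom (k := k) f' g = tensorHom (k := k) (f ≫ f') (g' ≫ g) := by
  have ht : g ∈ gr (k := k) Y' Z' 0 ⊔ gr (k := k) Y' Z' 1 := by
    rw [(Supercategory.isCompl (k := k) Y' Z').sup_eq_top]; trivial
  obtain ⟨a, ha, b, hb, rfl⟩ := Submodule.mem_sup.1 ht
  rw [map_add, Preadditive.comp_add, Preadditive.comp_add, map_add,
    interchange f f' g' a hf ha, interchange f f' g' b hf hb]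
  simp

/-- Interchange, when the upper right morphism is even. -/
theorem MonoidalSupercategory.tensor_comp_right {X Y Z X' Y' Z' : D} (f : X ⟶ Y) (f' : Y ⟶ Z)
    (g' : X' ⟶ Y') (g : Y' ⟶ Z') (hg : g ∈ gr (k := k) Y' Z' 0) :
    tensorHom (k := k) f g' ≫ tensorHom (k := k) f' g = tensorHom (k := k) (f ≫ f') (g' ≫ g) := by
  have ht : f ∈ gr (k := k) X Y 0 ⊔ gr (k := k) X Y 1 := by
    rw [(Supercategory.isCompl (k := k) X Y).sup_eq_top]; trivial
  obtain ⟨a, ha, b, hb, rfl⟩ := Submodule.mem_sup.1 ht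
  rw [map_add, LinearMap.add_apply, Preadditive.add_comp, Preadditive.add_comp, map_add,
    LinearMap.add_apply, interchange a f' g' g ha hg, interchange b f' g' g hb hg]
  simp

variable (k) in
/-- The tensor product of two even isomorphisms. -/
@[simps]
def MonoidalSupercategory.tensorIso {X Y X' Y' : D} (e : X ≅ Y) (e' : X' ≅ Y')
    (he : e.hom ∈ gr (k := k) X Y 0) (_ : e'.hom ∈ gr (k := k) X' Y' 0) :
    tensorObj k X X' ≅ tensorObj k Y Y' where
  hom := tensorHom (k := k) e.hom e'.hom
  inv := tensorHom (k := k) e.inv e'.inv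
  hom_inv_id := by
    rw [tensor_comp_left _ _ _ _ he, e.hom_inv_id, e'.hom_inv_id, tensor_id]
  inv_hom_id := by
    rw [tensor_comp_left _ _ _ _ (inv_mem e he), e.inv_hom_id, e'.inv_hom_id, tensor_id]

end

/-! ### Coherent families of objects indexed by words -/

/-- A family of objects of a monoidal supercategory indexed by words, multiplicative up to coherent
even isomorphisms: the data on objects of a monoidal superfunctor out of `Q(z)`. -/
structure WordSystem (k : Type u) [CommRing k] (D : Type v) [Category.{w} D] [Preadditive D]
    [Linear k D] [Supercategory k D] [MonoidalSupercategory k D] where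
  /-- The object attached to a word. -/
  obj : List Arrow → D
  /-- The unit isomorphism. -/
  ε : unit k ≅ obj []
  /-- The multiplication isomorphisms. -/
  μ : ∀ a b : List Arrow, tensorObj k (obj a) (obj b) ≅ obj (a ++ b)
  ε_even : ε.hom ∈ gr (k := k) _ _ 0
  μ_even : ∀ a b, (μ a b).hom ∈ gr (k := k) _ _ 0
  associativity : ∀ a b c,
    tensorHom (k := k) (μ a b).hom (𝟙 (obj c)) ≫ (μ (a ++ b) c).hom
        ≫ eqToHom (congrArg obj (List.append_assoc a b c))
      = (assoc (k := k) (obj a) (obj b) (obj c)).hom ≫ tensorHom (k := k) (𝟙 (obj a)) (μ b c).hom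
        ≫ (μ a (b ++ c)).hom
  left_unitality : ∀ a, (leftUnitor (k := k) (obj a)).hom
    = tensorHom (k := k) ε.hom (𝟙 (obj a)) ≫ (μ [] a).hom
  right_unitality : ∀ a, (rightUnitor (k := k) (obj a)).hom
    = tensorHom (k := k) (𝟙 (obj a)) ε.hom ≫ (μ a []).hom
      ≫ eqToHom (congrArg obj (List.append_nil a))

namespace WordSystem

variable {k : Type u} [CommRing k] {D : Type v} [Category.{w} D] [Preadditive D] [Linear k D]
  [Supercategory k D] [MonoidalSupercategory k D] (W : WordSystem k D)

theorem inv_even (a b : List Arrow) : (W.μ a b).inv ∈ gr (k := k) _ _ 0 :=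
  inv_mem _ (W.μ_even a b)

/-- The tensor product of morphisms between the objects attached to words, moved along the
multiplication isomorphisms. These tensor products are strictly associative and unital. -/
def tens {a b c d : List Arrow} :
    (W.obj a ⟶ W.obj b) →ₗ[k] (W.obj c ⟶ W.obj d) →ₗ[k] (W.obj (a ++ c) ⟶ W.obj (b ++ d)) :=
  (tensorHom (k := k)).compr₂
    ((Linear.rightComp k _ (W.μ b d).hom).comp (Linear.leftComp k _ (W.μ a c).inv))

theorem tens_apply {a b c d : List Arrow} (f : W.obj a ⟶ W.obj b) (g : W.obj c ⟶ W.obj d) :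
    W.tens f g = (W.μ a c).inv ≫ tensorHom (k := k) f g ≫ (W.μ b d).hom := by
  simp [tens]

theorem μ_tens {a b c d : List Arrow} (f : W.obj a ⟶ W.obj b) (g : W.obj c ⟶ W.obj d) :
    (W.μ a c).hom ≫ W.tens f g = tensorHom (k := k) f g ≫ (W.μ b d).hom := by
  simp [tens_apply]

theorem tens_mem {a b c d : List Arrow} {r s : ZMod 2} {f : W.obj a ⟶ W.obj b}
    {g : W.obj c ⟶ W.obj d} (hf : f ∈ gr (k := k) _ _ r) (hg : g ∈ gr (k := k) _ _ s) :
    W.tens f g ∈ gr (k := k) _ _ (r + s) := by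
  rw [tens_apply]
  have := comp_mem (W.inv_even a c) (comp_mem (tensor_mem hf hg) (W.μ_even b d))
  simpa using this

theorem tens_id (a b : List Arrow) : W.tens (𝟙 (W.obj a)) (𝟙 (W.obj b)) = 𝟙 (W.obj (a ++ b)) := by
  simp [tens_apply, tensor_id]

theorem tens_interchange {a b c a' b' c' : List Arrow} {r s : ZMod 2} {f : W.obj a ⟶ W.obj b}
    (f' : W.obj b ⟶ W.obj c) (g' : W.obj a' ⟶ W.obj b') {g : W.obj b' ⟶ W.obj c'}
    (hf : f ∈ gr (k := k) _ _ r) (hg : g ∈ gr (k := k) _ _ s) :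
    W.tens f g' ≫ W.tens f' g = sgn (k := k) (r * s) • W.tens (f ≫ f') (g' ≫ g) := by
  have := interchange f f' g' g hf hg
  simp only [tens_apply, Category.assoc, Iso.hom_inv_id_assoc]
  rw [← Category.assoc (tensorHom (k := k) f g'), this]
  simp

/-- Interchange, when the lower left morphism is even. -/
theorem tens_comp_left {a b c a' b' c' : List Arrow} {f : W.obj a ⟶ W.obj b}
    (f' : W.obj b ⟶ W.obj c) (g' : W.obj a' ⟶ W.obj b') (g : W.obj b' ⟶ W.obj c')
    (hf : f ∈ gr (k := k) _ _ 0) :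
    W.tens f g' ≫ W.tens f' g = W.tens (f ≫ f') (g' ≫ g) := by
  have := tensor_comp_left f f' g' g hf
  simp only [tens_apply, Category.assoc, Iso.hom_inv_id_assoc]
  rw [← Category.assoc (tensorHom (k := k) f g'), this]

theorem μ_nil (a : List Arrow) : (W.μ [] a).hom
    = tensorHom (k := k) W.ε.inv (𝟙 (W.obj a)) ≫ (leftUnitor (k := k) (W.obj a)).hom := by
  rw [W.left_unitality a, ← Category.assoc, tensor_comp_left _ _ _ _ (inv_mem _ W.ε_even)]
  simp [tensor_id]

theorem unit_tens {a b : List Arrow} (f : W.obj a ⟶ W.obj b) : W.tens (𝟙 (W.obj [])) f = f := by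
  rw [tens_apply, Iso.inv_comp_eq, μ_nil, μ_nil]
  refine Eq.trans ?_ ((congrArg (fun t => tensorHom (k := k) W.ε.inv (𝟙 (W.obj a)) ≫ t)
    (leftUnitor_naturality (k := k) f)).trans (Category.assoc _ _ _).symm)
  rw [← Category.assoc, ← Category.assoc, tensor_comp_left _ _ _ _ (id_mem _),
    tensor_comp_left _ _ _ _ (inv_mem _ W.ε_even)]
  simp

theorem tens_unit {a b : List Arrow} (f : W.obj a ⟶ W.obj b) :
    W.tens f (𝟙 (W.obj [])) ≫ eqToHom (congrArg W.obj (List.append_nil b))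
      = eqToHom (congrArg W.obj (List.append_nil a)) ≫ f := by
  have h : ∀ a, (W.μ a []).hom ≫ eqToHom (congrArg W.obj (List.append_nil a))
      = tensorHom (k := k) (𝟙 (W.obj a)) W.ε.inv ≫ (rightUnitor (k := k) (W.obj a)).hom := by
    intro a
    rw [W.right_unitality a, ← Category.assoc, tensor_comp_left _ _ _ _ (id_mem _)]
    simp [tensor_id]
  have h' : (W.μ a []).inv ≫ tensorHom (k := k) (𝟙 (W.obj a)) W.ε.inv
      ≫ (rightUnitor (k := k) (W.obj a)).hom = eqToHom (congrArg W.obj (List.append_nil a)) := by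
    rw [← h]; simp
  rw [tens_apply, Category.assoc, Category.assoc, h, ← h', Category.assoc, Category.assoc,
    ← rightUnitor_naturality (k := k), ← Category.assoc (tensorHom (k := k) f _),
    ← Category.assoc (tensorHom (k := k) (𝟙 _) _),
    tensor_comp_left _ _ _ _ (id_mem _), tensor_comp_right _ _ _ _ (inv_mem _ W.ε_even)]
  simp

theorem tens_assoc {a b c a' b' c' : List Arrow} (f : W.obj a ⟶ W.obj a') (g : W.obj b ⟶ W.obj b')
    (h : W.obj c ⟶ W.obj c') :
    W.tens (W.tens f g) h ≫ eqToHom (congrArg W.obj (List.append_assoc a' b' c'))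
      = eqToHom (congrArg W.obj (List.append_assoc a b c)) ≫ W.tens f (W.tens g h) := by
  -- After composition with the isomorphism `(W a ⊗ W b) ⊗ W c ≅ W (a b c)` this is the naturality
  -- of the associator.
  let e := tensorIso k (W.μ a b) (Iso.refl (W.obj c)) (W.μ_even a b) (id_mem _) ≪≫ W.μ (a ++ b) c
  have he : e.hom = tensorHom (k := k) (W.μ a b).hom (𝟙 (W.obj c)) ≫ (W.μ (a ++ b) c).hom := rfl
  rw [← cancel_epi e.hom]
  calc e.hom ≫ W.tens (W.tens f g) h ≫ eqToHom (congrArg W.obj (List.append_assoc a' b' c'))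
      = tensorHom (k := k) (W.μ a b).hom (𝟙 (W.obj c)) ≫ tensorHom (k := k) (W.tens f g) h
          ≫ (W.μ (a' ++ b') c').hom
          ≫ eqToHom (congrArg W.obj (List.append_assoc a' b' c')) := by
        rw [he, Category.assoc, ← Category.assoc (W.μ (a ++ b) c).hom, μ_tens, Category.assoc]
    _ = tensorHom (k := k) (tensorHom (k := k) f g) h ≫ (tensorHom (k := k) (W.μ a' b').hom
          (𝟙 (W.obj c')) ≫ (W.μ (a' ++ b') c').hom
          ≫ eqToHom (congrArg W.obj (List.append_assoc a' b' c'))) := by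
        rw [← Category.assoc, ← Category.assoc (tensorHom (k := k) (tensorHom (k := k) f g) h),
          tensor_comp_left _ _ _ _ (W.μ_even a b), μ_tens, tensor_comp_right _ _ _ _ (id_mem _)]
        simp
    _ = (assoc (k := k) _ _ _).hom ≫ (tensorHom (k := k) f (tensorHom (k := k) g h)
          ≫ tensorHom (k := k) (𝟙 (W.obj a')) (W.μ b' c').hom) ≫ (W.μ a' (b' ++ c')).hom := by
        rw [W.associativity, ← Category.assoc, assoc_naturality]
        simp
    _ = (assoc (k := k) _ _ _).hom ≫ (tensorHom (k := k) (𝟙 (W.obj a)) (W.μ b c).hom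
          ≫ tensorHom (k := k) f (W.tens g h)) ≫ (W.μ a' (b' ++ c')).hom := by
        rw [tensor_comp_right _ _ _ _ (W.μ_even b' c'), tensor_comp_left _ _ _ _ (id_mem _), μ_tens]
        simp
    _ = e.hom ≫ eqToHom (congrArg W.obj (List.append_assoc a b c)) ≫ W.tens f (W.tens g h) := by
        have := congrArg (· ≫ W.tens f (W.tens g h)) (W.associativity a b c)
        simp only [Category.assoc, μ_tens] at this
        rw [he]
        simp only [Category.assoc, this]

/-- Associativity for a one-letter word, where both bracketings give the same word on the nose. -/
theorem μ_cons (x : Arrow) (a b : List Arrow) :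
    tensorHom (k := k) (W.μ [x] a).hom (𝟙 (W.obj b)) ≫ (W.μ (x :: a) b).hom
      = (assoc (k := k) (W.obj [x]) (W.obj a) (W.obj b)).hom
        ≫ tensorHom (k := k) (𝟙 (W.obj [x])) (W.μ a b).hom ≫ (W.μ [x] (a ++ b)).hom :=
  (congrArg (tensorHom (k := k) (W.μ [x] a).hom (𝟙 (W.obj b)) ≫ ·)
    (Category.comp_id _).symm).trans (W.associativity [x] a b)

theorem rightUnitor_singleton (x : Arrow) : (rightUnitor (k := k) (W.obj [x])).hom
    = tensorHom (k := k) (𝟙 (W.obj [x])) W.ε.hom ≫ (W.μ [x] []).hom :=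
  (W.right_unitality [x]).trans
    (congrArg (tensorHom (k := k) (𝟙 (W.obj [x])) W.ε.hom ≫ ·) (Category.comp_id _))

end WordSystem

namespace WordSystem

variable {k : Type u} [CommRing k] {D : Type v} [Category.{w} D] [Preadditive D] [Linear k D]
  [Supercategory k D] [MonoidalSupercategory k D] (W : WordSystem k D)

/-! ### Evaluation of string diagrams -/

/-- The morphism obtained from a string diagram by replacing the generators by given morphisms. -/
def interp (G : ∀ {a b : List Arrow}, Gen a b → (W.obj a ⟶ W.obj b)) :
    ∀ {a b : List Arrow}, Term k a b → (W.obj a ⟶ W.obj b)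
  | _, _, .gen g => G g
  | _, _, .id a => 𝟙 (W.obj a)
  | _, _, .comp f g => interp G f ≫ interp G g
  | _, _, .tensor f g => W.tens (interp G f) (interp G g)
  | _, _, .zero _ _ => 0
  | _, _, .add f g => interp G f + interp G g
  | _, _, .smul c f => c • interp G f

variable {W} {G : ∀ {a b : List Arrow}, Gen a b → (W.obj a ⟶ W.obj b)}

theorem interp_castId {a b : List Arrow} (h : a = b) :
    W.interp G (Term.castId k h) = eqToHom (congrArg W.obj h) := by
  subst h; rfl

theorem interp_mem (hG : ∀ {a b : List Arrow} (g : Gen a b), G g ∈ gr (k := k) _ _ g.parity)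
    {a b : List Arrow} {f : Term k a b} {r : ZMod 2} (h : f.IsHomog r) :
    W.interp G f ∈ gr (k := k) _ _ r := by
  induction h with
  | gen g => exact hG g
  | id a => exact id_mem _
  | comp _ _ h1 h2 => exact comp_mem h1 h2
  | tensor _ _ h1 h2 => exact W.tens_mem h1 h2
  | zero a b r => exact zero_mem _
  | add _ _ h1 h2 => exact add_mem h1 h2
  | smul c _ h => exact Submodule.smul_mem _ c h

/-- If the images of the generators satisfy the defining relations, then equal diagrams have equal
images. -/
theorem interp_eq_of_rel {z : k}
    (hG : ∀ {a b : List Arrow} (g : Gen a b), G g ∈ gr (k := k) _ _ g.parity)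
    (hrel : ∀ {a b : List Arrow} {f g : Term k a b}, Term.DefRel z f g →
      W.interp G f = W.interp G g)
    {a b : List Arrow} {f g : Term k a b} (h : Term.Rel z f g) :
    W.interp G f = W.interp G g := by
  induction h with
  | rel h => exact hrel h
  | refl f => rfl
  | symm _ ih => exact ih.symm
  | trans _ _ h1 h2 => exact h1.trans h2
  | comp_congr _ _ h1 h2 => simp only [interp, h1, h2]
  | tensor_congr _ _ h1 h2 => simp only [interp, h1, h2]
  | add_congr _ _ h1 h2 => simp only [interp, h1, h2]
  | smul_congr c _ h => simp only [interp, h]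
  | add_comm f g => exact _root_.add_comm _ _
  | add_assoc f g h => exact _root_.add_assoc _ _ _
  | zero_add f => exact _root_.zero_add _
  | smul_add c f g => exact _root_.smul_add _ _ _
  | add_smul c d f => exact _root_.add_smul _ _ _
  | mul_smul c d f => exact SemigroupAction.mul_smul _ _ _
  | one_smul f => exact _root_.one_smul _ _
  | zero_smul f => exact _root_.zero_smul _ _
  | id_comp f => exact Category.id_comp _
  | comp_id f => exact Category.comp_id _
  | comp_assoc f g h => exact Category.assoc _ _ _
  | add_comp f f' g => exact Preadditive.add_comp _ _ _ _ _ _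
  | comp_add f g g' => exact Preadditive.comp_add _ _ _ _ _ _
  | smul_comp t f g => exact Linear.smul_comp _ _ _ _ _ _
  | comp_smul t f g => exact Linear.comp_smul _ _ _ _ _ _
  | add_tensor f f' g => simp only [interp, map_add, LinearMap.add_apply]
  | tensor_add f g g' => simp only [interp, map_add]
  | smul_tensor t f g => simp only [interp, map_smul, LinearMap.smul_apply]
  | tensor_smul t f g => simp only [interp, map_smul]
  | tensor_id a b => exact W.tens_id a b
  | interchange f' g' hf hg => exact W.tens_interchange _ _ (interp_mem hG hf) (interp_mem hG hg)
  | unit_tensor f => exact W.unit_tens _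
  | tensor_unit f =>
    simp only [interp, interp_castId]
    exact W.tens_unit _
  | tensor_assoc f g h =>
    simp only [interp, interp_castId]
    exact W.tens_assoc _ _ _

/-! ### Uniqueness of adjoints -/

/-- `tens_assoc` without transport: the two sides are morphisms between equal objects. -/
theorem tens_assoc_heq {a b c a' b' c' : List Arrow} (f : W.obj a ⟶ W.obj a')
    (g : W.obj b ⟶ W.obj b') (h : W.obj c ⟶ W.obj c') :
    HEq (W.tens (W.tens f g) h) (W.tens f (W.tens g h)) :=
  (comp_eqToHom_heq _ _).symm.trans
    ((heq_of_eq (W.tens_assoc f g h)).trans (eqToHom_comp_heq _ _))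

theorem tens_unit_heq {a b : List Arrow} (f : W.obj a ⟶ W.obj b) :
    HEq (W.tens f (𝟙 (W.obj []))) f :=
  (comp_eqToHom_heq _ _).symm.trans ((heq_of_eq (W.tens_unit f)).trans (eqToHom_comp_heq _ _))

/-- A cap is adjoint to at most one even cup. -/
theorem cup_unique {C C' : W.obj [] ⟶ W.obj [.up, .down]} {c : W.obj [.down, .up] ⟶ W.obj []}
    (hC' : C' ∈ gr (k := k) _ _ 0)
    (h1 : W.tens (a := []) (b := [.up, .down]) (c := [.up]) C' (𝟙 (W.obj [.up]))
      ≫ W.tens (a := [.up]) (c := [.down, .up]) (𝟙 (W.obj [.up])) c = 𝟙 (W.obj [.up]))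
    (h2 : W.tens (a := [.down]) (c := []) (𝟙 (W.obj [.down])) C
      ≫ W.tens (a := [.down, .up]) (c := [.down]) c (𝟙 (W.obj [.down])) = 𝟙 (W.obj [.down])) :
    C' = C := by
  -- Straighten a zigzag on the right of `C'`, then slide `C'` past `C` and straighten on the left.
  have e1 : 𝟙 (W.obj [.up, .down]) = W.tens (a := [.up]) (c := [.down]) (𝟙 (W.obj [.up]))
      (W.tens (a := [.down]) (c := []) (𝟙 (W.obj [.down])) C)
      ≫ W.tens (a := [.up]) (c := [.down, .up, .down]) (𝟙 (W.obj [.up]))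
        (W.tens (a := [.down, .up]) (c := [.down]) c (𝟙 (W.obj [.down]))) := by
    rw [tens_comp_left _ _ _ _ (id_mem _)]
    refine (W.tens_id [.up] [.down]).symm.trans ?_
    rw [Category.id_comp]
    exact congrArg _ h2.symm
  have e2 : W.tens (a := [.up]) (c := [.down]) (𝟙 (W.obj [.up]))
      (W.tens (a := [.down]) (c := []) (𝟙 (W.obj [.down])) C)
      = W.tens (a := [.up, .down]) (c := []) (𝟙 (W.obj [.up, .down])) C := by
    have h := eq_of_heq (W.tens_assoc_heq (𝟙 (W.obj [.up])) (𝟙 (W.obj [.down])) C)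
    rw [W.tens_id] at h
    exact h.symm
  have e3 : W.tens (a := [.up]) (c := [.down, .up, .down]) (𝟙 (W.obj [.up]))
        (W.tens (a := [.down, .up]) (c := [.down]) c (𝟙 (W.obj [.down])))
      = W.tens (a := [.up, .down, .up]) (c := [.down])
        (W.tens (a := [.up]) (c := [.down, .up]) (𝟙 (W.obj [.up])) c) (𝟙 (W.obj [.down])) :=
    (eq_of_heq (W.tens_assoc_heq (𝟙 (W.obj [.up])) c (𝟙 (W.obj [.down])))).symm
  have e4 : C' ≫ W.tens (a := [.up, .down]) (c := []) (𝟙 (W.obj [.up, .down])) C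
      = C ≫ W.tens (a := []) (c := [.up, .down]) C' (𝟙 (W.obj [.up, .down])) := by
    have h3 : C' = W.tens (a := []) (c := []) C' (𝟙 (W.obj [])) :=
      (eq_of_heq (W.tens_unit_heq C')).symm
    have h4 : C = W.tens (a := []) (c := []) (𝟙 (W.obj [])) C := (W.unit_tens C).symm
    have h5 := W.tens_comp_left (𝟙 (W.obj [.up, .down])) (𝟙 (W.obj [])) C hC'
    have h6 := W.tens_comp_left C' C (𝟙 (W.obj [.up, .down])) (id_mem (k := k) (W.obj []))
    rw [Category.comp_id, Category.id_comp] at h5 h6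
    exact ((congrArg (· ≫ W.tens (𝟙 (W.obj [.up, .down])) C) h3).trans h5).trans
      (h6.symm.trans (congrArg (· ≫ W.tens C' (𝟙 (W.obj [.up, .down]))) h4.symm))
  have e5 : W.tens (a := []) (c := [.up, .down]) C' (𝟙 (W.obj [.up, .down]))
      = W.tens (a := [.up]) (c := [.down])
        (W.tens (a := []) (b := [.up, .down]) (c := [.up]) C' (𝟙 (W.obj [.up])))
        (𝟙 (W.obj [.down])) := by
    have h := eq_of_heq (W.tens_assoc_heq C' (𝟙 (W.obj [.up])) (𝟙 (W.obj [.down])))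
    rw [W.tens_id] at h
    exact h.symm
  have e6 : W.tens (a := [.up]) (c := [.down])
        (W.tens (a := []) (b := [.up, .down]) (c := [.up]) C' (𝟙 (W.obj [.up])))
        (𝟙 (W.obj [.down])) ≫ W.tens (a := [.up, .down, .up]) (c := [.down])
        (W.tens (a := [.up]) (c := [.down, .up]) (𝟙 (W.obj [.up])) c) (𝟙 (W.obj [.down]))
      = 𝟙 (W.obj [.up, .down]) := by
    have h := W.tens_interchange (r := 0) (s := 0)
      (f := W.tens (a := []) (b := [.up, .down]) (c := [.up]) C' (𝟙 (W.obj [.up])))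
      (W.tens (a := [.up]) (c := [.down, .up]) (𝟙 (W.obj [.up])) c) (𝟙 (W.obj [.down]))
      (g := 𝟙 (W.obj [.down])) (W.tens_mem (r := 0) (s := 0) hC' (id_mem _)) (id_mem _)
    rw [mul_zero, sgn_zero, one_smul, Category.comp_id] at h
    refine h.trans ((congrArg (fun t => W.tens t (𝟙 (W.obj [.down]))) h1).trans ?_)
    exact W.tens_id [.up] [.down]
  calc C' = C' ≫ 𝟙 (W.obj [.up, .down]) := (Category.comp_id _).symm
    _ = (C' ≫ W.tens (a := [.up, .down]) (c := []) (𝟙 (W.obj [.up, .down])) C)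
        ≫ W.tens (a := [.up, .down, .up]) (c := [.down])
        (W.tens (a := [.up]) (c := [.down, .up]) (𝟙 (W.obj [.up])) c) (𝟙 (W.obj [.down])) := by
      refine (congrArg (fun t => C' ≫ t) e1).trans ?_
      rw [e2, e3, Category.assoc]
    _ = C ≫ 𝟙 (W.obj [.up, .down]) := by
      rw [e4, Category.assoc, e5, e6]
    _ = C := by rw [Category.comp_id]

/-! ### The superfunctor given by a coherent family -/

variable [Invertible (2 : k)] {z : k}
    (hG : ∀ {a b : List Arrow} (g : Gen a b), G g ∈ gr (k := k) _ _ g.parity)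
    (hrel : ∀ {a b : List Arrow} {f g : Term k a b}, Term.DefRel z f g →
      W.interp G f = W.interp G g)

/-- The functor out of `Q(z)` given by evaluation of diagrams. -/
def functor : QCat z ⥤ D where
  obj a := W.obj a.word
  map {a b} := Quotient.lift (W.interp G) fun _ _ h => interp_eq_of_rel hG hrel h
  map_id _ := rfl
  map_comp x y := by
    induction x using QCat.ind with | h f =>
    induction y using QCat.ind with | h g => rfl

/-- The monoidal superfunctor out of `Q(z)` given by evaluation of diagrams. -/
def monoidalFunctor : MonoidalSuperfunctor k (QCat z) D where
  toFunctor := functor hG hrel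
  map_add x y := by
    induction x using QCat.ind with | h f =>
    induction y using QCat.ind with | h g => rfl
  map_smul c x := by
    induction x using QCat.ind with | h f => rfl
  map_mem := by
    rintro a b r _ ⟨f, hf, rfl⟩
    exact interp_mem hG hf
  ε := W.ε
  μ a b := W.μ a.word b.word
  ε_even := W.ε_even
  μ_even a b := W.μ_even _ _
  μ_naturality x y := by
    induction x using QCat.ind with | h f =>
    induction y using QCat.ind with | h g => exact (W.μ_tens _ _).symm
  associativity a b c := by
    have h : (functor hG hrel).map (assoc (k := k) a b c).hom = _ :=
      eqToHom_map (functor hG hrel) (QCat.append_assoc a b c)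
    rw [h]
    exact W.associativity _ _ _
  left_unitality a := by
    have h : (functor hG hrel).map (leftUnitor (k := k) a).hom = 𝟙 _ :=
      (functor hG hrel).map_id a
    rw [h]
    exact (W.left_unitality a.word).trans (congrArg _ (Category.comp_id _).symm)
  right_unitality a := by
    have h : (functor hG hrel).map (rightUnitor (k := k) a).hom = _ :=
      eqToHom_map (functor hG hrel) (QCat.append_nil a)
    rw [h]
    exact W.right_unitality _

end WordSystem

namespace WordSystem

variable {k : Type u} [CommRing k] {D : Type v} [Category.{w} D] [Preadditive D] [Linear k D]
  [Supercategory k D] [MonoidalSupercategory k D] {W W' : WordSystem k D}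

/-! ### Extending isomorphisms from letters to words -/

/-- The isomorphisms between the objects attached to words, built multiplicatively from
isomorphisms between the objects attached to letters. -/
def extend (θ : ∀ x, {e : W.obj [x] ≅ W'.obj [x] // e.hom ∈ gr (k := k) _ _ 0}) :
    ∀ a : List Arrow, {e : W.obj a ≅ W'.obj a // e.hom ∈ gr (k := k) _ _ 0}
  | [] => ⟨W.ε.symm ≪≫ W'.ε, comp_mem_even (inv_mem _ W.ε_even) W'.ε_even⟩
  | x :: a => ⟨(W.μ [x] a).symm
      ≪≫ tensorIso k (θ x).1 (extend θ a).1 (θ x).2 (extend θ a).2 ≪≫ W'.μ [x] a,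
      comp_mem_even (W.inv_even [x] a)
        (comp_mem_even (tensor_mem_even (θ x).2 (extend θ a).2) (W'.μ_even [x] a))⟩

variable (θ : ∀ x, {e : W.obj [x] ≅ W'.obj [x] // e.hom ∈ gr (k := k) _ _ 0})

theorem μ_extend_cons (x : Arrow) (a : List Arrow) :
    (W.μ [x] a).hom ≫ (extend θ (x :: a)).1.hom
      = tensorHom (k := k) (θ x).1.hom (extend θ a).1.hom ≫ (W'.μ [x] a).hom := by
  simp [extend]

theorem extend_nil : W.ε.hom ≫ (extend θ []).1.hom = W'.ε.hom := by
  simp [extend]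

/-- A one-letter word is extended as `x` followed by the empty word: this uses the unit axioms. -/
theorem extend_singleton (x : Arrow) : (extend θ [x]).1 = (θ x).1 := by
  ext
  have h1 : tensorHom (k := k) (𝟙 (W.obj [x])) W.ε.hom ≫ (W.μ [x] []).hom ≫ (extend θ [x]).1.hom
      = tensorHom (k := k) (𝟙 (W.obj [x])) W.ε.hom ≫ (W.μ [x] []).hom ≫ (θ x).1.hom := by
    have h2 := rightUnitor_naturality (k := k) (θ x).1.hom
    rw [rightUnitor_singleton, rightUnitor_singleton, Category.assoc] at h2
    rw [← h2, μ_extend_cons, ← Category.assoc, ← Category.assoc,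
      tensor_comp_left _ _ _ _ (id_mem _), tensor_comp_left _ _ _ _ (θ x).2, extend_nil]
    simp
  rw [← Category.assoc, ← Category.assoc, ← rightUnitor_singleton] at h1
  exact (cancel_epi _).1 h1

/-- The extended isomorphisms are compatible with all multiplications, not only with those by a
letter from the left. -/
theorem μ_extend (a b : List Arrow) :
    (W.μ a b).hom ≫ (extend θ (a ++ b)).1.hom
      = tensorHom (k := k) (extend θ a).1.hom (extend θ b).1.hom ≫ (W'.μ a b).hom := by
  induction a with
  | nil =>
    rw [μ_nil, μ_nil, ← Category.assoc, tensor_comp_left _ _ _ _ (extend θ []).2]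
    refine (Category.assoc _ _ _).trans ?_
    refine (congrArg (tensorHom (k := k) W.ε.inv (𝟙 (W.obj b)) ≫ ·)
      (leftUnitor_naturality (k := k) (extend θ b).1.hom).symm).trans ?_
    refine (Category.assoc _ _ _).symm.trans ?_
    rw [tensor_comp_left _ _ _ _ (inv_mem _ W.ε_even)]
    simp [extend]
  | cons x a ih =>
    have hm := W.μ_even [x] a
    rw [← cancel_epi (tensorIso k (W.μ [x] a) (Iso.refl (W.obj b)) hm (id_mem _)).hom]
    calc tensorHom (k := k) (W.μ [x] a).hom (𝟙 (W.obj b)) ≫ (W.μ (x :: a) b).hom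
          ≫ (extend θ (x :: (a ++ b))).1.hom
        = (assoc (k := k) _ _ _).hom ≫ tensorHom (k := k) (𝟙 (W.obj [x])) (W.μ a b).hom
            ≫ tensorHom (k := k) (θ x).1.hom (extend θ (a ++ b)).1.hom
            ≫ (W'.μ [x] (a ++ b)).hom := by
          rw [← μ_extend_cons, ← Category.assoc, μ_cons]
          simp only [Category.assoc]
      _ = ((assoc (k := k) _ _ _).hom ≫ tensorHom (k := k) (θ x).1.hom
            (tensorHom (k := k) (extend θ a).1.hom (extend θ b).1.hom))
            ≫ tensorHom (k := k) (𝟙 (W'.obj [x])) (W'.μ a b).hom ≫ (W'.μ [x] (a ++ b)).hom := by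
          rw [Category.assoc, ← Category.assoc (tensorHom (k := k) (𝟙 (W.obj [x])) _),
            tensor_comp_left _ _ _ _ (id_mem _), ih,
            ← Category.assoc (tensorHom (k := k) (θ x).1.hom _),
            tensor_comp_left _ _ _ _ (θ x).2]
          simp
      _ = tensorHom (k := k) (tensorHom (k := k) (θ x).1.hom (extend θ a).1.hom)
            (extend θ b).1.hom ≫ tensorHom (k := k) (W'.μ [x] a).hom (𝟙 (W'.obj b))
            ≫ (W'.μ (x :: a) b).hom := by
          rw [← assoc_naturality, Category.assoc, μ_cons]
      _ = tensorHom (k := k) (W.μ [x] a).hom (𝟙 (W.obj b))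
            ≫ tensorHom (k := k) (extend θ (x :: a)).1.hom (extend θ b).1.hom
            ≫ (W'.μ (x :: a) b).hom := by
          rw [← Category.assoc, ← Category.assoc, tensor_comp_right _ _ _ _ (id_mem _),
            tensor_comp_left _ _ _ _ hm, ← μ_extend_cons]
          simp

/-- Compatible isomorphisms are determined by their values on letters. -/
theorem eq_extend (e : ∀ a, W.obj a ≅ W'.obj a)
    (unit : W.ε.hom ≫ (e []).hom = W'.ε.hom)
    (tensor : ∀ x a, (W.μ [x] a).hom ≫ (e (x :: a)).hom
      = tensorHom (k := k) (e [x]).hom (e a).hom ≫ (W'.μ [x] a).hom)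
    (h : ∀ x, e [x] = (θ x).1) (a : List Arrow) : e a = (extend θ a).1 := by
  ext
  induction a with
  | nil => rw [← cancel_epi W.ε.hom, unit, extend_nil]
  | cons x a ih => rw [← cancel_epi (W.μ [x] a).hom, tensor, μ_extend_cons, h, ih]

theorem tens_extend {a b c d : List Arrow} {f : W.obj a ⟶ W.obj b} {f' : W'.obj a ⟶ W'.obj b}
    {g : W.obj c ⟶ W.obj d} {g' : W'.obj c ⟶ W'.obj d}
    (hf : f ≫ (extend θ b).1.hom = (extend θ a).1.hom ≫ f')
    (hg : g ≫ (extend θ d).1.hom = (extend θ c).1.hom ≫ g') :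
    W.tens f g ≫ (extend θ (b ++ d)).1.hom = (extend θ (a ++ c)).1.hom ≫ W'.tens f' g' := by
  rw [← cancel_epi (W.μ a c).hom, ← Category.assoc, μ_tens, Category.assoc, μ_extend,
    ← Category.assoc, tensor_comp_right _ _ _ _ (extend θ d).2, hf, hg,
    ← Category.assoc (W.μ a c).hom, μ_extend, Category.assoc, μ_tens, ← Category.assoc,
    tensor_comp_left _ _ _ _ (extend θ a).2]

theorem interp_extend {G : ∀ {a b : List Arrow}, Gen a b → (W.obj a ⟶ W.obj b)}
    {G' : ∀ {a b : List Arrow}, Gen a b → (W'.obj a ⟶ W'.obj b)} {a b : List Arrow} (f : Term k a b)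
    (h : ∀ {a b : List Arrow} (g : Gen a b),
      G g ≫ (extend θ b).1.hom = (extend θ a).1.hom ≫ G' g) :
    W.interp G f ≫ (extend θ b).1.hom = (extend θ a).1.hom ≫ W'.interp G' f := by
  induction f with
  | gen g => exact h g
  | id a => simp [interp]
  | comp f g hf hg => simp only [interp, Category.assoc, hg]; rw [← Category.assoc, hf]; simp
  | tensor f g hf hg => exact tens_extend θ hf hg
  | zero a b => simp [interp]
  | add f g hf hg => simp only [interp, Preadditive.add_comp, Preadditive.comp_add, hf, hg]
  | smul c f hf => simp only [interp, Linear.smul_comp, Linear.comp_smul, hf]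

end WordSystem

/-! ### Monoidal superfunctors out of `Q(z)` -/

namespace MonoidalSuperfunctor

variable {k : Type u} [CommRing k] [Invertible (2 : k)] {z : k} {D : Type v} [Category.{w} D]
  [Preadditive D] [Linear k D] [Supercategory k D] [MonoidalSupercategory k D]
  (F G : MonoidalSuperfunctor k (QCat z) D)

/-- The images of the words under a monoidal superfunctor. -/
def wordSystem : WordSystem k D where
  obj a := F.obj ⟨a⟩
  ε := F.ε
  μ a b := F.μ ⟨a⟩ ⟨b⟩
  ε_even := F.ε_even
  μ_even _ _ := F.μ_even _ _
  associativity a b c := by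
    have h : F.map (assoc (k := k) (⟨a⟩ : QCat z) ⟨b⟩ ⟨c⟩).hom = _ :=
      eqToHom_map F.toFunctor (QCat.append_assoc _ _ _)
    have := F.associativity ⟨a⟩ ⟨b⟩ ⟨c⟩
    rw [h] at this
    exact this
  left_unitality a := by
    have h : F.map (leftUnitor (k := k) (⟨a⟩ : QCat z)).hom = 𝟙 _ := F.map_id ⟨a⟩
    have := F.left_unitality ⟨a⟩
    rw [h] at this
    exact this.trans (congrArg _ (Category.comp_id _))
  right_unitality a := by
    have h : F.map (rightUnitor (k := k) (⟨a⟩ : QCat z)).hom = _ :=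
      eqToHom_map F.toFunctor (QCat.append_nil _)
    have := F.right_unitality ⟨a⟩
    rw [h] at this
    exact this

/-- The image of a string diagram. -/
def mapTerm {a b : List Arrow} (f : Term k a b) : F.wordSystem.obj a ⟶ F.wordSystem.obj b :=
  F.map (QCat.diagram f)

theorem mapTerm_id (a : List Arrow) : F.mapTerm (.id a) = 𝟙 _ := F.map_id ⟨a⟩

theorem mapTerm_comp {a b c : List Arrow} (f : Term k a b) (g : Term k b c) :
    F.mapTerm (.comp f g) = F.mapTerm f ≫ F.mapTerm g :=
  F.map_comp (QCat.diagram f) (QCat.diagram g)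

theorem mapTerm_tensor {a b c d : List Arrow} (f : Term k a b) (g : Term k c d) :
    F.mapTerm (.tensor f g) = F.wordSystem.tens (F.mapTerm f) (F.mapTerm g) := by
  rw [WordSystem.tens_apply]
  exact ((Iso.inv_comp_eq _).2 (F.μ_naturality (QCat.diagram f) (QCat.diagram g))).symm

/-- A monoidal superfunctor evaluates diagrams in the word system of its values on objects. -/
theorem mapTerm_eq_interp {a b : List Arrow} (f : Term k a b) :
    F.mapTerm f = F.wordSystem.interp (fun g => F.mapTerm (.gen g)) f := by
  induction f with
  | gen g => rfl
  | id a => exact F.mapTerm_id a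
  | comp f g hf hg => rw [mapTerm_comp, hf, hg]; rfl
  | tensor f g hf hg => rw [mapTerm_tensor, hf, hg]; rfl
  | zero a b =>
    have := F.map_smul (0 : k) (QCat.diagram (z := z) (.zero a b))
    rw [zero_smul, zero_smul] at this
    exact this
  | add f g hf hg =>
    exact (F.map_add (QCat.diagram f) (QCat.diagram g)).trans (congrArg₂ _ hf hg)
  | smul c f hf => exact (F.map_smul c (QCat.diagram f)).trans (congrArg _ hf)

theorem mapTerm_eq_of_rel {a b : List Arrow} {f g : Term k a b} (h : Term.DefRel z f g) :
    F.mapTerm f = F.mapTerm g :=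
  congrArg (fun t => F.map t) (QCat.mk_eq (.rel h))

theorem mapTerm_mem {a b : List Arrow} {f : Term k a b} {r : ZMod 2} (h : f.IsHomog r) :
    F.mapTerm f ∈ gr (k := k) _ _ r := F.map_mem ⟨f, h, rfl⟩

variable {F G}
variable (θ : ∀ x, {e : F.wordSystem.obj [x] ≅ G.wordSystem.obj [x] // e.hom ∈ gr (k := k) _ _ 0})

/-- Compatibility with a diagram passes to the inverse diagram. -/
theorem mapTerm_extend_of_inverse {a b : List Arrow} {f : Term k a b} {g : Term k b a}
    (h1 : Term.DefRel z (.comp f g) (.id a)) (h2 : Term.DefRel z (.comp g f) (.id b))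
    (hf : F.mapTerm f ≫ (WordSystem.extend θ b).1.hom
      = (WordSystem.extend θ a).1.hom ≫ G.mapTerm f) :
    F.mapTerm g ≫ (WordSystem.extend θ a).1.hom
      = (WordSystem.extend θ b).1.hom ≫ G.mapTerm g := by
  have g1 : G.mapTerm f ≫ G.mapTerm g = 𝟙 _ := by
    rw [← mapTerm_comp, ← mapTerm_id]; exact G.mapTerm_eq_of_rel h1
  have f2 : F.mapTerm g ≫ F.mapTerm f = 𝟙 _ := by
    rw [← mapTerm_comp, ← mapTerm_id]; exact F.mapTerm_eq_of_rel h2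
  calc F.mapTerm g ≫ (WordSystem.extend θ a).1.hom
      = F.mapTerm g ≫ ((WordSystem.extend θ a).1.hom ≫ G.mapTerm f) ≫ G.mapTerm g := by
        rw [Category.assoc, g1, Category.comp_id]
    _ = (F.mapTerm g ≫ F.mapTerm f) ≫ (WordSystem.extend θ b).1.hom ≫ G.mapTerm g := by
        rw [← hf]; simp only [Category.assoc]
    _ = _ := by rw [f2, Category.id_comp]

/-- Compatibility with the left cap implies compatibility with the left cup, its adjoint. -/
theorem mapTerm_extend_leftCup
    (leftCap : F.mapTerm (.gen .leftCap) ≫ (WordSystem.extend θ _).1.hom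
      = (WordSystem.extend θ _).1.hom ≫ G.mapTerm (.gen .leftCap)) :
    F.mapTerm (.gen .leftCup) ≫ (WordSystem.extend θ _).1.hom
      = (WordSystem.extend θ _).1.hom ≫ G.mapTerm (.gen .leftCup) := by
  -- The cup of `F`, moved to `G`, is adjoint to the cap of `G`.
  rw [← Iso.inv_comp_eq]
  set C' := (WordSystem.extend θ []).1.inv ≫ F.mapTerm (.gen .leftCup)
    ≫ (WordSystem.extend θ [.up, .down]).1.hom with hC'
  have hcup : F.mapTerm (.gen .leftCup) ≫ (WordSystem.extend θ [.up, .down]).1.hom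
      = (WordSystem.extend θ []).1.hom ≫ C' := by simp [hC']
  have hid : ∀ a : List Arrow, 𝟙 (F.wordSystem.obj a) ≫ (WordSystem.extend θ a).1.hom
      = (WordSystem.extend θ a).1.hom ≫ 𝟙 (G.wordSystem.obj a) := by simp
  have zF := F.mapTerm_eq_of_rel .zigzag_up
  have zG := G.mapTerm_eq_of_rel .zigzag_down
  rw [mapTerm_comp, mapTerm_tensor, mapTerm_tensor, mapTerm_id] at zF zG
  refine WordSystem.cup_unique (c := G.mapTerm (.gen .leftCap)) ?_ ?_ zG
  · exact comp_mem_even (inv_mem _ (WordSystem.extend θ []).2)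
      (comp_mem_even (F.mapTerm_mem (.gen _)) (WordSystem.extend θ _).2)
  · have h1 := WordSystem.tens_extend θ hcup (hid [.up])
    have h2 := WordSystem.tens_extend θ (hid [.up]) leftCap
    refine (cancel_epi (WordSystem.extend θ [.up]).1.hom).1 ?_
    refine (Category.assoc _ _ _).symm.trans ?_
    refine (congrArg (· ≫ G.wordSystem.tens (a := [.up]) (c := [.down, .up])
      (𝟙 (G.wordSystem.obj [.up])) (G.mapTerm (.gen .leftCap))) h1.symm).trans ?_
    refine (Category.assoc _ _ _).trans ?_
    refine (congrArg (F.wordSystem.tens (a := []) (b := [.up, .down]) (c := [.up])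
      (F.mapTerm (.gen .leftCup)) (𝟙 (F.wordSystem.obj [.up])) ≫ ·) h2.symm).trans ?_
    refine (Category.assoc _ _ _).symm.trans ?_
    refine (congrArg (· ≫ (WordSystem.extend θ [.up]).1.hom) zF).trans ?_
    exact hid [.up]

/-- An isomorphism of monoidal superfunctors out of `Q(z)` amounts to even isomorphisms between the
images of the two generating objects that are compatible with the positive up crossing, the left cap
and the Clifford token: compatibility with the other generators is automatic, since these are
determined by inverses and by adjunction. -/
theorem existsUnique_natIso
    (posUp : F.mapTerm (.gen .posUp) ≫ (WordSystem.extend θ _).1.hom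
      = (WordSystem.extend θ _).1.hom ≫ G.mapTerm (.gen .posUp))
    (leftCap : F.mapTerm (.gen .leftCap) ≫ (WordSystem.extend θ _).1.hom
      = (WordSystem.extend θ _).1.hom ≫ G.mapTerm (.gen .leftCap))
    (tok : F.mapTerm (.gen .tok) ≫ (WordSystem.extend θ _).1.hom
      = (WordSystem.extend θ _).1.hom ≫ G.mapTerm (.gen .tok)) :
    ∃! η : MonoidalSuperNatIso F G, ∀ x, η.app ⟨[x]⟩ = (θ x).1 := by
  have leftCup := mapTerm_extend_leftCup θ leftCap
  have hid : ∀ a : List Arrow, F.mapTerm (.id a) ≫ (WordSystem.extend θ a).1.hom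
      = (WordSystem.extend θ a).1.hom ≫ G.mapTerm (.id a) := by simp [mapTerm_id]
  have htens : ∀ {a b c d : List Arrow} {f : Term k a b} {g : Term k c d},
      F.mapTerm f ≫ (WordSystem.extend θ b).1.hom
        = (WordSystem.extend θ a).1.hom ≫ G.mapTerm f →
      F.mapTerm g ≫ (WordSystem.extend θ d).1.hom
        = (WordSystem.extend θ c).1.hom ≫ G.mapTerm g →
      F.mapTerm (f.tensor g) ≫ (WordSystem.extend θ (b ++ d)).1.hom
        = (WordSystem.extend θ (a ++ c)).1.hom ≫ G.mapTerm (f.tensor g) := by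
    intro a b c d f g hf hg
    rw [mapTerm_tensor, mapTerm_tensor]
    exact WordSystem.tens_extend θ hf hg
  have hcomp : ∀ {a b c : List Arrow} {f : Term k a b} {g : Term k b c},
      F.mapTerm f ≫ (WordSystem.extend θ b).1.hom
        = (WordSystem.extend θ a).1.hom ≫ G.mapTerm f →
      F.mapTerm g ≫ (WordSystem.extend θ c).1.hom
        = (WordSystem.extend θ b).1.hom ≫ G.mapTerm g →
      F.mapTerm (f.comp g) ≫ (WordSystem.extend θ c).1.hom
        = (WordSystem.extend θ a).1.hom ≫ G.mapTerm (f.comp g) := by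
    intro a b c f g hf hg
    rw [mapTerm_comp, mapTerm_comp, Category.assoc, hg, ← Category.assoc, hf, Category.assoc]
  have posLeft : F.mapTerm (Term.posLeft k) ≫ (WordSystem.extend θ _).1.hom
      = (WordSystem.extend θ _).1.hom ≫ G.mapTerm (Term.posLeft k) :=
    hcomp (htens (hid [.down, .up]) leftCup)
      (hcomp (htens (hid [.down]) (htens posUp (hid [.down]))) (htens leftCap (hid [.up, .down])))
  have gens : ∀ {a b : List Arrow} (g : Gen a b),
      F.mapTerm (.gen g) ≫ (WordSystem.extend θ b).1.hom
        = (WordSystem.extend θ a).1.hom ≫ G.mapTerm (.gen g) := by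
    intro a b g
    cases g with
    | posUp => exact posUp
    | negUp => exact mapTerm_extend_of_inverse θ .posUp_negUp .negUp_posUp posUp
    | negRight => exact mapTerm_extend_of_inverse θ .posLeft_negRight .negRight_posLeft posLeft
    | leftCap => exact leftCap
    | leftCup => exact leftCup
    | tok => exact tok
  refine ⟨{ app := fun a => (WordSystem.extend θ a.word).1
            even := fun a => (WordSystem.extend θ a.word).2
            naturality := ?_
            unit := WordSystem.extend_nil θ
            tensor := fun a b => WordSystem.μ_extend θ a.word b.word },
    WordSystem.extend_singleton θ, ?_⟩
  · intro a b f
    induction f using QCat.ind with | h f =>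
    have := WordSystem.interp_extend θ f gens
    rw [← mapTerm_eq_interp, ← mapTerm_eq_interp] at this
    exact this
  · intro η hη
    ext a : 2
    exact WordSystem.eq_extend θ (fun a => η.app ⟨a⟩) η.unit (fun x a => η.tensor ⟨[x]⟩ ⟨a⟩) hη
      a.word

end MonoidalSuperfunctor

namespace SMod

variable {K : Type u} [Field K] {q : Kˣ} {n : ℕ} (V : Arrow → SMod q n)

/-! ### Tensor words of supermodules -/

/-- The tensor product of the supermodules attached to the letters of a word, bracketed to the
right. A one-letter word gives the supermodule itself, without a unit factor. -/
@[reducible] def wordObj : List Arrow → SMod q n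
  | [] => one q n
  | [x] => V x
  | x :: y :: a => tensor (V x) (wordObj (y :: a))

/-- The multiplication isomorphisms between tensor words. -/
def wordMul : ∀ a b : List Arrow,
    {e : tensor (wordObj V a) (wordObj V b) ≅ wordObj V (a ++ b) // e.hom ∈ gr (k := K) _ _ 0}
  | [], b => ⟨leftUnitor (k := K) (wordObj V b), leftUnitor_even _⟩
  | [x], [] => ⟨rightUnitor (k := K) (V x), rightUnitor_even _⟩
  | [_], _ :: _ => ⟨Iso.refl _, id_mem _⟩
  | x :: y :: a, b => ⟨assoc (k := K) (V x) (wordObj V (y :: a)) (wordObj V b)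
      ≪≫ tensorIso K (Iso.refl (V x)) (wordMul (y :: a) b).1 (id_mem _) (wordMul (y :: a) b).2,
      comp_mem_even (assoc_even _ _ _) (tensor_mem_even (id_mem _) (wordMul (y :: a) b).2)⟩

/-- The linear map underlying the multiplication of tensor words. -/
def mulₗ (a b : List Arrow) :
    (wordObj V a).carrier ⊗[K] (wordObj V b).carrier →ₗ[K] (wordObj V (a ++ b)).carrier :=
  toLin (wordMul V a b).1.hom

theorem mulₗ_nil (b : List Arrow) (c : K) (x : (wordObj V b).carrier) :
    mulₗ V [] b (c ⊗ₜ x) = c • x := rfl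

theorem mulₗ_cons_cons (x y : Arrow) (a b : List Arrow) (v : (V x).carrier)
    (w : (wordObj V (y :: a)).carrier) (t : (wordObj V b).carrier) :
    mulₗ V (x :: y :: a) b ((v ⊗ₜ w) ⊗ₜ t) = v ⊗ₜ mulₗ V (y :: a) b (w ⊗ₜ t) := by
  have h : toLin (wordMul V (x :: y :: a) b).1.hom
      = toLin (tensorHom (𝟙 (V x)) (wordMul V (y :: a) b).1.hom)
        ∘ₗ toLin (assoc (k := K) (V x) (wordObj V (y :: a)) (wordObj V b)).hom := rfl
  rw [mulₗ, h, toLin_tensorHom_even _ (wordMul V (y :: a) b).2]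
  rfl

theorem toLin_eqToHom_cons {a b : List Arrow} (x y : Arrow) (h : y :: a = y :: b)
    (v : (V x).carrier) (w : (wordObj V (y :: a)).carrier) :
    toLin (eqToHom (congrArg (wordObj V) (congrArg (x :: ·) h))) (v ⊗ₜ w)
      = (v ⊗ₜ toLin (eqToHom (congrArg (wordObj V) h)) w : (wordObj V (x :: y :: b)).carrier) := by
  cases h; rfl

theorem mulₗ_assoc : ∀ (a b c : List Arrow) (x : (wordObj V a).carrier) (y : (wordObj V b).carrier)
    (t : (wordObj V c).carrier),
    toLin (eqToHom (congrArg (wordObj V) (List.append_assoc a b c)))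
        (mulₗ V (a ++ b) c (mulₗ V a b (x ⊗ₜ y) ⊗ₜ t))
      = mulₗ V a (b ++ c) (x ⊗ₜ mulₗ V b c (y ⊗ₜ t))
  | [], b, c, x, y, t => by
    change mulₗ V b c ((x • y) ⊗ₜ t) = x • mulₗ V b c (y ⊗ₜ t)
    rw [← TensorProduct.smul_tmul', map_smul]
  | [r], [], c, x, y, t => by
    change mulₗ V [r] c ((y • x) ⊗ₜ t) = mulₗ V [r] c (x ⊗ₜ (y • t))
    rw [TensorProduct.smul_tmul]
  | [r], s :: b, c, x, y, t => mulₗ_cons_cons V r s b c x y t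
  | r :: s :: a, b, c, x, y, t => by
    induction x using TensorProduct.induction_on with
    | zero => simp
    | add x x' h h' => simp only [TensorProduct.add_tmul, map_add, h, h']
    | tmul v w =>
      rw [mulₗ_cons_cons, mulₗ_cons_cons, ← mulₗ_assoc (s :: a) b c w y t]
      exact (congrArg _ (mulₗ_cons_cons V r s (a ++ b) c v _ t)).trans
        (toLin_eqToHom_cons V r s (List.append_assoc (s :: a) b c) v _)

theorem mulₗ_right_unit : ∀ (a : List Arrow) (x : (wordObj V a).carrier) (c : K),
    toLin (eqToHom (congrArg (wordObj V) (List.append_nil a))) (mulₗ V a [] (x ⊗ₜ c)) = c • x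
  | [], x, c => mul_comm x c
  | [r], x, c => rfl
  | r :: s :: a, x, c => by
    induction x using TensorProduct.induction_on with
    | zero => simp
    | add x x' h h' => simp only [TensorProduct.add_tmul, map_add, h, h', smul_add]
    | tmul v w =>
      rw [mulₗ_cons_cons]
      refine (toLin_eqToHom_cons V r s (List.append_nil (s :: a)) v _).trans ?_
      rw [mulₗ_right_unit (s :: a) w c, TensorProduct.tmul_smul]

/-- Tensor words of supermodules form a coherent family. -/
def wordSystem : WordSystem K (SMod q n) where
  obj := wordObj V
  ε := Iso.refl _
  μ a b := (wordMul V a b).1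
  ε_even := id_mem _
  μ_even a b := (wordMul V a b).2
  associativity a b c := hom_ext (by
    change (toLin _ ∘ₗ toLin _) ∘ₗ toLin (tensorHom (wordMul V a b).1.hom (𝟙 (wordObj V c)))
      = (toLin _ ∘ₗ toLin (tensorHom (𝟙 (wordObj V a)) (wordMul V b c).1.hom)) ∘ₗ _
    rw [toLin_tensorHom_even _ (id_mem_homU _), toLin_tensorHom_even _ (wordMul V b c).2]
    apply TensorProduct.ext_threefold
    exact mulₗ_assoc V a b c)
  left_unitality a := hom_ext (by
    change _ = toLin _ ∘ₗ toLin (tensorHom (𝟙 (one q n)) (𝟙 (wordObj V a)))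
    rw [toLin_tensorHom_even _ (id_mem_homU _)]
    apply TensorProduct.ext'
    intro c x
    exact (mulₗ_nil V a c x).symm)
  right_unitality a := hom_ext (by
    change _ = (toLin _ ∘ₗ toLin _) ∘ₗ toLin (tensorHom (𝟙 (wordObj V a)) (𝟙 (one q n)))
    rw [toLin_tensorHom_even _ (id_mem_homU _)]
    apply TensorProduct.ext'
    intro x c
    exact (mulₗ_right_unit V a x c).symm)

/-- The tensor product of morphisms between tensor words, the second one even, on products of
elements. -/
theorem toLin_tens_mulₗ_even {a b c d : List Arrow} (f : wordObj V a ⟶ wordObj V b)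
    {g : wordObj V c ⟶ wordObj V d} (hg : toLin g ∈ homU _ _ 0)
    (x : (wordObj V a).carrier) (y : (wordObj V c).carrier) :
    toLin ((wordSystem V).tens f g) (mulₗ V a c (x ⊗ₜ y))
      = mulₗ V b d (toLin f x ⊗ₜ toLin g y) := by
  have h := congrArg (fun t => toLin t (x ⊗ₜ[K] y)) ((wordSystem V).μ_tens f g)
  refine h.trans ?_
  exact congrArg (mulₗ V b d) (congrArg (fun t => t (x ⊗ₜ[K] y)) (toLin_tensorHom_even f hg))

end SMod

section
variable {K : Type u} [Field K] {q : Kˣ} {n : ℕ}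

/-! ### The operator `T` on basis vectors -/

open YangBaxter

theorem vec_mem (i : Idx n) : vec K i ∈ (SMod.gradingV K n).gr i.p := SMod.single_mem i 1

/-- Vectors are separated by linear functionals; this reduces identities between vectors to
identities between scalars. -/
theorem eq_of_forall_dual {M : Type u} [AddCommGroup M] [Module K M] {x y : M}
    (h : ∀ f : M →ₗ[K] K, f x = f y) : x = y := by
  rw [← sub_eq_zero, ← Module.forall_dual_apply_eq_zero_iff K]
  intro f
  rw [map_sub, h f, sub_self]

theorem toLin'_single_vec (i j b : Idx n) :
    Matrix.toLin' (Matrix.single i j (1 : K)) (vec K b) = if j = b then vec K i else 0 := by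
  ext r
  simp only [vec, Matrix.toLin'_apply, Matrix.mulVec_single_one, Matrix.col_apply,
    Matrix.single_apply]
  by_cases h : j = b
  · subst h
    by_cases h' : i = r
    · subst h'; simp
    · simp [h', Ne.symm h']
  · simp [h]

theorem toLin'_single_mem (i j : Idx n) : Matrix.toLin' (Matrix.single i j (1 : K)) ∈
    (SMod.gradingV K n).homGr (SMod.gradingV K n) (i.p + j.p) := by
  intro s v hv a ha
  rw [Matrix.toLin'_apply, Matrix.mulVec, dotProduct]
  refine Finset.sum_eq_zero fun c _ => ?_
  rw [Matrix.single_apply]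
  split_ifs with h
  · obtain ⟨rfl, rfl⟩ := h
    rw [hv j, mul_zero]
    rintro rfl
    apply ha
    generalize i.p = x; generalize j.p = y; revert x y; decide
  · exact zero_mul _

theorem toLin'_theta_vec (i b a : Idx n) :
    Matrix.toLin' (Theta q i b) (vec K a) = ∑ r : Idx n, Theta q i b r a • vec K r := by
  ext r
  simp [vec, Matrix.toLin'_apply, Finset.sum_apply, Pi.single_apply]

/-- The definition of `T`, spelled out on basis vectors. -/
theorem opT_vec_sum (a b : Idx n) : opT q n (vec K a ⊗ₜ vec K b) = ∑ r : Idx n, ∑ i : Idx n,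
    (Theta q i b r a * sgn ((i.p + b.p) * a.p + r.p * i.p)) • (vec K i ⊗ₜ[K] vec K r) := by
  have h : thetaOp q n (vec K a ⊗ₜ vec K b) = ∑ i : Idx n, ∑ r : Idx n,
      (Theta q i b r a * sgn ((i.p + b.p) * a.p)) • (vec K r ⊗ₜ[K] vec K i) := by
    simp only [thetaOp, LinearMap.sum_apply]
    refine Finset.sum_congr rfl fun i _ => ?_
    rw [Finset.sum_eq_single b]
    · rw [Grading.tensorMap_tmul _ _ _ _ (toLin'_single_mem i b) (vec_mem a), toLin'_single_vec,
        if_pos rfl, toLin'_theta_vec, TensorProduct.sum_tmul, Finset.smul_sum]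
      refine Finset.sum_congr rfl fun r _ => ?_
      rw [← TensorProduct.smul_tmul', smul_smul, mul_comm]
    · intro j _ hj
      rw [Grading.tensorMap_tmul _ _ _ _ (toLin'_single_mem i j) (vec_mem a), toLin'_single_vec,
        if_neg hj, TensorProduct.tmul_zero, smul_zero]
    · exact fun hb => absurd (Finset.mem_univ b) hb
  rw [opT, LinearMap.comp_apply, h]
  simp only [map_sum, map_smul]
  rw [Finset.sum_comm]
  refine Finset.sum_congr rfl fun r _ => Finset.sum_congr rfl fun i _ => ?_
  rw [Grading.flip_tmul _ _ (vec_mem r) (vec_mem i), smul_smul, mul_assoc, ← sgn_add]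

/-- The basis vector `v_a` for an arbitrary integer `a`, zero if `a` is not an index. -/
def vecZ (K : Type u) [Field K] (n : ℕ) (a : ℤ) : Idx n → K :=
  if h : a ∈ (Finset.Icc (-(n : ℤ)) n).erase 0 then vec K ⟨a, h⟩ else 0

@[simp] theorem vecZ_val (a : Idx n) : vecZ K n a.1 = vec K a := dif_pos a.2

@[simp] theorem vecZ_neg (a : Idx n) : vecZ K n (-a.1) = vec K (-a) := vecZ_val (-a)

/-- A linear functional on `T (v_a ⊗ v_b)`, through the form of `Θ` used in the Yang–Baxter
equation. -/
theorem apply_opT_vec (f : (Idx n → K) ⊗[K] (Idx n → K) →ₗ[K] K) (a b : Idx n) :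
    f (opT q n (vec K a ⊗ₜ vec K b)) = R q a.1 b.1 fun r i =>
      sgn ((pI i + pI b.1) * pI a.1 + pI r * pI i) * f (vecZ K n i ⊗ₜ vecZ K n r) := by
  rw [opT_vec_sum, ← sum_theta]
  simp only [map_sum, map_smul, vecZ_val, smul_eq_mul]
  exact Finset.sum_congr rfl fun r _ => Finset.sum_congr rfl fun i _ => mul_assoc _ _ _

/-- `R q a b g` depends only on the values of `g` at indices allowed by the evenness and the
triangularity of `Θ`. -/
theorem R_congr {a b : Idx n} {g g' : ℤ → ℤ → K}
    (h : ∀ r i : Idx n, r.p + i.p = a.p + b.p → (i.p + b.p) * b.p = 0 → g r.1 i.1 = g' r.1 i.1) :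
    R q a.1 b.1 g = R q a.1 b.1 g' := by
  have h1 := h a b rfl (by generalize b.p = x; revert x; decide)
  have h2 : a.1 < b.1 → g b.1 a.1 = g' b.1 a.1 := fun hab =>
    h b a (add_comm _ _) (Idx.p_of_le (i := a) (j := b) hab.le)
  have h3 : -a.1 < b.1 → g (-b.1) (-a.1) = g' (-b.1) (-a.1) := fun hab =>
    h (-b) (-a) (by
        rw [Idx.p_neg, Idx.p_neg]
        generalize a.p = x; generalize b.p = y; revert x y; decide)
      (Idx.p_of_le (i := -a) (j := b) hab.le)
  unfold R
  rw [h1]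
  refine congrArg₂ _ (congrArg _ ?_) ?_
  · split_ifs with hab
    · rw [h2 hab]
    · rfl
  · split_ifs with hab
    · rw [h3 hab]
    · rfl

/-- The values of `T` on basis vectors, without summation. -/
theorem opT_vec (a b : Idx n) : opT q n (vec K a ⊗ₜ vec K b)
    = (sgn (a.p * b.p) * ((q ^ Idx.phi a b : Kˣ) : K)) • (vec K b ⊗ₜ[K] vec K a)
      + (if a < b then zq q • (vec K a ⊗ₜ[K] vec K b) else 0)
      + (if -a < b then (zq q * sgn b.p) • (vec K (-a) ⊗ₜ[K] vec K (-b)) else 0) := by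
  refine eq_of_forall_dual (K := K) fun f => ?_
  have hp : ∀ a : Idx n, pI a.1 = a.p := fun _ => rfl
  have hn : ∀ a : Idx n, pI (-a.1) = a.p + 1 := fun a => Idx.p_neg a
  rw [apply_opT_vec, R]
  simp only [map_add, apply_ite f, map_smul, map_zero, smul_eq_mul, hp, hn, vecZ_val, vecZ_neg]
  congr 1
  · congr 1
    · have e : (b.p + b.p) * a.p + a.p * b.p = a.p * b.p := by
        generalize a.p = x; generalize b.p = y; revert x y; decide
      rw [e]
      change ((q ^ Idx.phi a b : Kˣ) : K) * _ = _
      ring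
    · have e : a.p + ((a.p + b.p) * a.p + b.p * a.p) = 0 := by
        generalize a.p = x; generalize b.p = y; revert x y; decide
      change (if a < b then _ else _) = _
      rw [mul_assoc, ← mul_assoc (sgn a.p), ← sgn_add, e, sgn_zero, one_mul]
  · have e : a.p + 1 + ((a.p + 1 + b.p) * a.p + (b.p + 1) * (a.p + 1)) = b.p := by
      generalize a.p = x; generalize b.p = y; revert x y; decide
    change (if -a < b then _ else _) = _
    rw [mul_assoc (zq q), ← mul_assoc (sgn (a.p + 1)), ← sgn_add, e, ← mul_assoc]

theorem Grading.flip_mem {M N : Type u} [AddCommGroup M] [Module K M] [AddCommGroup N] [Module K N]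
    (G : Grading K M) (H : Grading K N) : G.flip H ∈ (G.tensor H).homGr (H.tensor G) 0 := by
  apply Grading.mem_homGr_tensor
  intro s t v hv w hw
  rw [Grading.flip_tmul G H hv hw, add_zero, add_comm]
  exact Submodule.smul_mem _ _ (Grading.tmul_mem H G hw hv)

theorem opT_mem : opT q n ∈ ((SMod.gradingV K n).tensor (SMod.gradingV K n)).homGr
    ((SMod.gradingV K n).tensor (SMod.gradingV K n)) 0 := by
  have h : thetaOp q n ∈ ((SMod.gradingV K n).tensor (SMod.gradingV K n)).homGr
      ((SMod.gradingV K n).tensor (SMod.gradingV K n)) 0 := by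
    refine sum_mem fun i _ => sum_mem fun j _ => ?_
    have := Grading.tensorMap_mem _ _ _ _ (SMod.toLin'_Theta_mem (q := q) i j)
      (toLin'_single_mem (K := K) i j)
    have e : i.p + j.p + (i.p + j.p) = 0 := by
      generalize i.p = x; generalize j.p = y; revert x y; decide
    rwa [e] at this
  exact add_zero (0 : ZMod 2) ▸ Grading.comp_mem_homGr _ _ _ h (Grading.flip_mem _ _)

/-! ### The quadratic relation -/

variable (q) in
/-- The function `(a, b) ↦ f (T (v_a ⊗ v_b))`, expressed through `g (a, b) = f (v_a ⊗ v_b)`. -/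
def braidFun (a b : ℤ) (g : ℤ → ℤ → K) : K :=
  R q a b fun r i => sgn ((pI i + pI b) * pI a + pI r * pI i) * g i r

theorem apply_opT (f : (Idx n → K) ⊗[K] (Idx n → K) →ₗ[K] K) (a b : Idx n) :
    f (opT q n (vec K a ⊗ₜ vec K b))
      = braidFun q a.1 b.1 fun x y => f (vecZ K n x ⊗ₜ vecZ K n y) := apply_opT_vec f a b

theorem R_mul_left (a b : ℤ) (c : K) (g : ℤ → ℤ → K) :
    R q a b (fun r i => c * g r i) = c * R q a b g := by
  unfold R
  split_ifs <;> ring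

theorem braidFun_congr {a b : Idx n} {g g' : ℤ → ℤ → K}
    (h : ∀ x y : Idx n, g x.1 y.1 = g' x.1 y.1) :
    braidFun q a.1 b.1 g = braidFun q a.1 b.1 g' :=
  R_congr fun r i _ _ => by rw [h i r]

/-- The quadratic relation for `T`, by cases on the signs of `a` and `b` and on the order of `|a|`
and `|b|`. -/
theorem braidFun_braidFun (g : ℤ → ℤ → K) (a b : ℤ) (ha : a ≠ 0) (hb : b ≠ 0) :
    braidFun q a b (fun x y => braidFun q x y g) = zq q * braidFun q a b g + g a b := by
  have e2 : (1 : ZMod 2) + 1 = 0 := by decide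
  have hq : (q : K) ≠ 0 := q.ne_zero
  have main : ∀ a b : ℤ, 0 < a → 0 < b → ∀ s t : Bool,
      ∀ a' b', a' = (if s then a else -a) → b' = (if t then b else -b) →
      braidFun q a' b' (fun x y => braidFun q x y g) = zq q * braidFun q a' b' g + g a' b' := by
    intro a b ha hb s t a' b' e1 e3
    have na := pI_neg ha
    have nb := pI_neg hb
    have pa := pI_pos ha
    have pb := pI_pos hb
    subst e1 e3
    unfold braidFun
    rcases lt_trichotomy a b with h1 | h1 | h1
    all_goals try subst h1
    all_goals cases s <;> cases t
    all_goals
      simp only [Bool.false_eq_true, if_true, if_false, R_pp_lt, R_pp_gt, R_pp_eq, R_pn_lt, R_pn_gt,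
        R_pn_eq, R_np_lt, R_np_gt, R_np_eq, R_nn_lt, R_nn_gt, R_nn_eq, *]
    all_goals
      simp only [sgn_zero, sgn_one, add_zero, zero_add, mul_zero, mul_one, one_mul, zq,
        Units.val_inv_eq_inv_val]
    all_goals try field_simp
    all_goals try ring
  have hs : ∀ x : ℤ, x = if decide (0 < x) then |x| else -|x| := by
    intro x
    by_cases hx : 0 < x
    · simp [hx, abs_of_pos]
    · simp [hx, abs_of_nonpos (not_lt.1 hx)]
  exact main |a| |b| (abs_pos.2 ha) (abs_pos.2 hb) _ _ a b (hs a) (hs b)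

/-- Two linear maps on `V ⊗ V` agreeing on the basis vectors are equal. -/
theorem tensor_vec_ext {M : Type u} [AddCommGroup M] [Module K M]
    {f g : (Idx n → K) ⊗[K] (Idx n → K) →ₗ[K] M}
    (h : ∀ a b : Idx n, f (vec K a ⊗ₜ vec K b) = g (vec K a ⊗ₜ vec K b)) : f = g := by
  apply TensorProduct.ext
  refine (Pi.basisFun K (Idx n)).ext fun a => (Pi.basisFun K (Idx n)).ext fun b => ?_
  simpa [vec] using h a b

theorem opT_opT (x : (Idx n → K) ⊗[K] (Idx n → K)) :
    opT q n (opT q n x) = zq q • opT q n x + x := by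
  have key : opT q n ∘ₗ opT q n = zq q • opT q n + LinearMap.id := by
    refine tensor_vec_ext fun a b => eq_of_forall_dual (K := K) fun f => ?_
    have h : f (opT q n (opT q n (vec K a ⊗ₜ vec K b)))
        = braidFun q a.1 b.1 fun x y => braidFun q x y fun x y => f (vecZ K n x ⊗ₜ vecZ K n y) := by
      refine (apply_opT (f ∘ₗ opT q n) a b).trans (braidFun_congr fun x y => ?_)
      rw [vecZ_val, vecZ_val, LinearMap.comp_apply, apply_opT]
    rw [LinearMap.comp_apply, h, braidFun_braidFun _ _ _ a.val_ne_zero b.val_ne_zero, vecZ_val,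
      vecZ_val, ← apply_opT, LinearMap.add_apply, LinearMap.smul_apply, LinearMap.id_apply, map_add,
      map_smul f, smul_eq_mul]
  exact LinearMap.congr_fun key x

variable (q n) in
/-- The inverse `T - z` of `T`. -/
def opTInv : Module.End K ((Idx n → K) ⊗[K] (Idx n → K)) := opT q n - zq q • 1

theorem opTInv_apply (x : (Idx n → K) ⊗[K] (Idx n → K)) :
    opTInv q n x = opT q n x - zq q • x := rfl

theorem opT_mul_opTInv : opT q n * opTInv q n = 1 := by
  refine LinearMap.ext fun x => ?_
  rw [Module.End.mul_apply, opTInv_apply, map_sub, opT_opT, LinearMap.map_smul,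
    Module.End.one_apply, add_sub_cancel_left]

theorem opTInv_mul_opT : opTInv q n * opT q n = 1 := by
  refine LinearMap.ext fun x => ?_
  rw [Module.End.mul_apply, opTInv_apply, opT_opT, Module.End.one_apply, add_sub_cancel_left]

/-! ### The braid relation -/

/-- The signs on the left-hand side of the braid relation for `T`, compared with those in the
Yang–Baxter equation. The equations between the indices express that `Θ` is even, the vanishing
products that it is triangular. The last summand on the right involves only the outer indices and is
common to the two sides of the relation. -/
theorem braid_sign_right {a b c w j x l i k : ZMod 2} (h1 : w + j = a + b) (h2 : (j + b) * b = 0)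
    (h3 : x + l = w + c) (h4 : (l + c) * c = 0) (h5 : i + k = j + l) (h6 : (k + l) * l = 0) :
    ((j + b) * a + w * j) + ((l + c) * w + x * l) + ((k + l) * j + i * k)
      = (k + l) * (j + b) + (a + b + x + i + a * b + a * c + a * i + b * c + x * i) := by
  obtain rfl : w = a + b - j := eq_sub_of_add_eq h1
  obtain rfl : x = a + b - j + c - l := eq_sub_of_add_eq h3
  obtain rfl : i = j + l - k := eq_sub_of_add_eq h5
  clear h1 h3 h5
  revert a b c j l k; decide

/-- The signs on the right-hand side of the braid relation for `T`, as in `braid_sign_right`. -/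
theorem braid_sign_left {a b c w j x l i k : ZMod 2} (h1 : j + l = b + c) (h2 : (l + c) * c = 0)
    (h3 : w + k = a + l) (h4 : (k + l) * l = 0) (h5 : x + i = w + j) (h6 : (i + j) * j = 0) :
    ((l + c) * b + j * l) + ((k + l) * a + w * k) + ((i + j) * w + x * i)
      = (i + j) * (k + l) + (k + l) * (j + b)
        + (a + b + x + i + a * b + a * c + a * i + b * c + x * i) := by
  obtain rfl : j = b + c - l := eq_sub_of_add_eq h1
  obtain rfl : w = a + l - k := eq_sub_of_add_eq h3
  obtain rfl : x = a + l - k + (b + c - l) - i := eq_sub_of_add_eq h5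
  clear h1 h3 h5
  revert a b c i l k; decide

/-- The braid relation for `T` in terms of functions of the indices: the Yang–Baxter equation for
`Θ`, applied to the function twisted by the sign that depends only on the outer indices. -/
theorem braidFun_braid (f : ℤ → ℤ → ℤ → K) (a b c : Idx n) :
    braidFun q a.1 b.1 (fun x y => braidFun q y c.1 fun y' c' =>
        braidFun q x y' fun p r => f p r c')
      = braidFun q b.1 c.1 fun b' c' => braidFun q a.1 b' fun p t =>
          braidFun q t c' fun r s => f p r s := by
  have hp : ∀ a : Idx n, pI a.1 = a.p := fun _ => rfl
  have key := ybe q (fun x i k => sgn (pI a.1 + pI b.1 + pI x + pI i + pI a.1 * pI b.1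
    + pI a.1 * pI c.1 + pI a.1 * pI i + pI b.1 * pI c.1 + pI x * pI i) * f k i x)
    a.1 b.1 c.1 a.val_ne_zero b.val_ne_zero c.val_ne_zero
  refine Eq.trans ?_ (key.symm.trans ?_)
  · refine R_congr fun w j h1 h2 => ?_
    unfold braidFun
    rw [← R_mul_left]
    refine R_congr fun x l h3 h4 => ?_
    rw [← mul_assoc, ← R_mul_left]
    refine R_congr fun i k h5 h6 => ?_
    simp only [hp]
    rw [← mul_assoc, ← mul_assoc, ← sgn_add, ← sgn_add, ← sgn_add,
      braid_sign_right h1 h2 h3 h4 h5 h6]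
  · refine R_congr fun j l h1 h2 => ?_
    unfold braidFun
    rw [← R_mul_left]
    refine R_congr fun w k h3 h4 => ?_
    rw [← mul_assoc, ← R_mul_left]
    refine R_congr fun x i h5 h6 => ?_
    simp only [hp]
    rw [← mul_assoc, ← mul_assoc, ← sgn_add, ← sgn_add, ← sgn_add, ← sgn_add,
      braid_sign_left h1 h2 h3 h4 h5 h6]

end

section
variable {K : Type u} [Field K] {q : Kˣ} {n : ℕ}

open YangBaxter

variable (q n) in
/-- `T ⊗ 1` on `V ⊗ (V ⊗ V)`. -/
def opT₁ : Module.End K ((Idx n → K) ⊗[K] ((Idx n → K) ⊗[K] (Idx n → K))) :=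
  (TensorProduct.assoc K _ _ _).toLinearMap ∘ₗ TensorProduct.map (opT q n) LinearMap.id
    ∘ₗ (TensorProduct.assoc K _ _ _).symm.toLinearMap

variable (q n) in
/-- `1 ⊗ T` on `V ⊗ (V ⊗ V)`. -/
def opT₂ : Module.End K ((Idx n → K) ⊗[K] ((Idx n → K) ⊗[K] (Idx n → K))) :=
  TensorProduct.map LinearMap.id (opT q n)

theorem apply_opT₁ (f : (Idx n → K) ⊗[K] ((Idx n → K) ⊗[K] (Idx n → K)) →ₗ[K] K) (a b c : Idx n) :
    f (opT₁ q n (vec K a ⊗ₜ (vec K b ⊗ₜ vec K c)))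
      = braidFun q a.1 b.1 fun x y => f (vecZ K n x ⊗ₜ (vecZ K n y ⊗ₜ vec K c)) :=
  apply_opT (f ∘ₗ (TensorProduct.assoc K _ _ _).toLinearMap
    ∘ₗ (TensorProduct.mk K _ _).flip (vec K c)) a b

theorem apply_opT₂ (f : (Idx n → K) ⊗[K] ((Idx n → K) ⊗[K] (Idx n → K)) →ₗ[K] K) (a b c : Idx n) :
    f (opT₂ q n (vec K a ⊗ₜ (vec K b ⊗ₜ vec K c)))
      = braidFun q b.1 c.1 fun x y => f (vec K a ⊗ₜ (vecZ K n x ⊗ₜ vecZ K n y)) :=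
  apply_opT (f ∘ₗ TensorProduct.mk K _ _ (vec K a)) b c

theorem opT_braid (x : (Idx n → K) ⊗[K] ((Idx n → K) ⊗[K] (Idx n → K))) :
    opT₁ q n (opT₂ q n (opT₁ q n x)) = opT₂ q n (opT₁ q n (opT₂ q n x)) := by
  have key : opT₁ q n ∘ₗ opT₂ q n ∘ₗ opT₁ q n = opT₂ q n ∘ₗ opT₁ q n ∘ₗ opT₂ q n := by
    apply TensorProduct.ext
    refine (Pi.basisFun K (Idx n)).ext fun a => tensor_vec_ext fun b c =>
      eq_of_forall_dual (K := K) fun f => ?_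
    rw [Pi.basisFun_apply]
    change f (opT₁ q n (opT₂ q n (opT₁ q n (vec K a ⊗ₜ (vec K b ⊗ₜ vec K c)))))
      = f (opT₂ q n (opT₁ q n (opT₂ q n (vec K a ⊗ₜ (vec K b ⊗ₜ vec K c)))))
    have h1 := apply_opT₁ (q := q) (f ∘ₗ opT₁ q n ∘ₗ opT₂ q n) a b c
    have h2 := apply_opT₂ (q := q) (f ∘ₗ opT₂ q n ∘ₗ opT₁ q n) a b c
    have h3 := braidFun_braid (q := q)
      (fun x y t => f (vecZ K n x ⊗ₜ (vecZ K n y ⊗ₜ vecZ K n t))) a b c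
    refine h1.trans (Eq.trans ?_ (h3.trans (Eq.trans ?_ h2.symm)))
    · refine braidFun_congr fun x y => ?_
      rw [vecZ_val, vecZ_val]
      refine (apply_opT₂ (f ∘ₗ opT₁ q n) x y c).trans (braidFun_congr fun y' c' => ?_)
      rw [vecZ_val, vecZ_val]
      exact apply_opT₁ f x y' c'
    · refine braidFun_congr fun x y => ?_
      rw [vecZ_val, vecZ_val]
      refine Eq.trans ?_ (apply_opT₁ (f ∘ₗ opT₂ q n) a x y).symm
      refine braidFun_congr fun y' c' => ?_
      rw [vecZ_val, vecZ_val]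
      exact (apply_opT₂ f y' c' y).symm
  exact LinearMap.congr_fun key x

/-! ### `T` is a homomorphism of supermodules -/

/-- A linear functional on `u_{ij} (v_a ⊗ v_b)`. -/
theorem apply_tensorOps_vec (f : (Idx n → K) ⊗[K] (Idx n → K) →ₗ[K] K) (i j a b : Idx n) :
    f ((SMod.tensor (SMod.V q n) (SMod.V q n)).op i j (vec K a ⊗ₜ vec K b))
      = R q b.1 j.1 fun d m => R q a.1 m fun c i' => if i' = i.1 then
          sgn ((pI i' + pI m) * (pI m + pI j.1) + (pI m + pI j.1) * pI a.1)
            * f (vecZ K n c ⊗ₜ vecZ K n d) else 0 := by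
  have h : ∀ m d : Idx n, R q a.1 m.1 (fun c i' => if i' = i.1 then
          sgn ((pI i' + pI m.1) * (pI m.1 + pI j.1) + (pI m.1 + pI j.1) * pI a.1)
            * f (vecZ K n c ⊗ₜ vecZ K n d.1) else 0)
      = ∑ c, Theta q i m c a * (sgn ((i.p + m.p) * (m.p + j.p) + (m.p + j.p) * a.p)
        * f (vec K c ⊗ₜ vec K d)) := by
    intro m d
    rw [← sum_theta]
    refine Finset.sum_congr rfl fun c _ => ?_
    rw [Finset.sum_eq_single i]
    · rw [if_pos rfl, vecZ_val, vecZ_val]; rfl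
    · intro i' _ hi
      rw [if_neg fun h => hi (Subtype.ext h), mul_zero]
    · exact fun hi => absurd (Finset.mem_univ i) hi
  rw [← sum_theta]
  simp only [h]
  rw [SMod.tensor_op, tensorOps, LinearMap.sum_apply, map_sum, Finset.sum_comm]
  refine Finset.sum_congr rfl fun m _ => ?_
  rw [LinearMap.smul_apply, Grading.tensorMap_tmul _ _ _ _ ((SMod.V q n).op_mem m j) (vec_mem a),
    SMod.V_op, SMod.V_op, toLin'_theta_vec, toLin'_theta_vec, TensorProduct.sum_tmul]
  simp only [TensorProduct.tmul_sum, Finset.smul_sum, map_sum, Finset.mul_sum]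
  rw [Finset.sum_comm]
  refine Finset.sum_congr rfl fun d _ => Finset.sum_congr rfl fun c _ => ?_
  simp only [← TensorProduct.smul_tmul', TensorProduct.tmul_smul]
  rw [map_smul f, map_smul f, map_smul f, map_smul f]
  simp only [smul_eq_mul]
  rw [sgn_add]
  ring

/-- The signs in the composite of `T` followed by the action on `V ⊗ V`, compared with those in the
Yang–Baxter equation. -/
theorem hom_sign_right {a b c w j x l i k : ZMod 2} (h1 : w + j = a + b) (h2 : (j + b) * b = 0)
    (h3 : x + l = w + c) (h4 : (l + c) * c = 0) (h5 : i + k = j + l) (h6 : (k + l) * l = 0) :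
    ((j + b) * a + w * j) + ((k + l) * (l + c) + (l + c) * j)
      = (k + l) * (j + b) + (a * b + a * i + x * i) := by
  obtain rfl : w = a + b - j := eq_sub_of_add_eq h1
  obtain rfl : x = a + b - j + c - l := eq_sub_of_add_eq h3
  obtain rfl : i = j + l - k := eq_sub_of_add_eq h5
  clear h1 h3 h5
  revert a b c j l k; decide

/-- The signs in the composite of the action on `V ⊗ V` followed by `T`, compared with those in the
Yang–Baxter equation. -/
theorem hom_sign_left {a b c w j x l i k : ZMod 2} (h1 : j + l = b + c) (h2 : (l + c) * c = 0)
    (h3 : w + k = a + l) (h4 : (k + l) * l = 0) (h5 : x + i = w + j) (h6 : (i + j) * j = 0) :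
    ((k + l) * (l + c) + (l + c) * a) + ((i + j) * w + x * i)
      = (i + j) * (k + l) + (k + l) * (j + b) + (a * b + a * i + x * i) := by
  obtain rfl : j = b + c - l := eq_sub_of_add_eq h1
  obtain rfl : w = a + l - k := eq_sub_of_add_eq h3
  obtain rfl : x = a + l - k + (b + c - l) - i := eq_sub_of_add_eq h5
  clear h1 h3 h5
  revert a b c i l k; decide

/-- `T` is a homomorphism of supermodules. Since `u_{ij}` acts on `V` by `Θ_{ij}`, this is the
Yang–Baxter equation again, with both indices of the third factor fixed. -/
theorem opT_mem_homU :
    opT q n ∈ SMod.homU (SMod.tensor (SMod.V q n) (SMod.V q n))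
      (SMod.tensor (SMod.V q n) (SMod.V q n)) 0 := by
  refine SMod.mem_homU_of_op opT_mem fun i₀ c => ?_
  rw [zero_mul, sgn_zero, one_smul]
  refine tensor_vec_ext fun a b => eq_of_forall_dual (K := K) fun f => ?_
  have hp : ∀ a : Idx n, pI a.1 = a.p := fun _ => rfl
  have hl := apply_tensorOps_vec (q := q) (f ∘ₗ opT q n) i₀ c a b
  have hr := apply_opT (q := q) (f ∘ₗ (SMod.tensor (SMod.V q n) (SMod.V q n)).op i₀ c) a b
  have key := ybe q (fun x i k => if k = i₀.1 then
    sgn (pI a.1 * pI b.1 + pI a.1 * pI i + pI x * pI i) * f (vecZ K n i ⊗ₜ vecZ K n x) else 0)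
    a.1 b.1 c.1 a.val_ne_zero b.val_ne_zero c.val_ne_zero
  refine hl.trans (Eq.trans ?_ (key.trans (Eq.trans ?_ hr.symm)))
  · refine R_congr fun j l h1 h2 => R_congr fun w k h3 h4 => ?_
    rw [vecZ_val, vecZ_val, LinearMap.comp_apply, apply_opT_vec, ← R_mul_left]
    split_ifs with hk
    · refine R_congr fun x i h5 h6 => ?_
      simp only [hp]
      rw [← mul_assoc, ← mul_assoc, ← sgn_add, ← sgn_add, ← sgn_add,
        hom_sign_left h1 h2 h3 h4 h5 h6]
    · simp [R]
  · refine R_congr fun w j h1 h2 => ?_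
    beta_reduce
    rw [vecZ_val, vecZ_val, LinearMap.comp_apply, apply_tensorOps_vec, ← R_mul_left]
    refine R_congr fun x l h3 h4 => ?_
    rw [← R_mul_left]
    refine R_congr fun i k h5 h6 => ?_
    split_ifs with hk
    · simp only [hp]
      rw [← mul_assoc, ← mul_assoc, ← sgn_add, ← sgn_add, hom_sign_right h1 h2 h3 h4 h5 h6]
    · rw [mul_zero, mul_zero]

/-! ### The Clifford token -/

theorem opJ_vec (a : Idx n) : opJ K n (vec K a) = sgn (k := K) a.p • vec K (-a) := by
  simp only [opJ, map_sum, map_smul, LinearMap.sum_apply, LinearMap.smul_apply]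
  rw [Finset.sum_eq_single a]
  · rw [toLin'_single_vec, if_pos rfl]
  · intro b _ hb; rw [toLin'_single_vec, if_neg hb, smul_zero]
  · exact fun ha => absurd (Finset.mem_univ a) ha

theorem opJ_mem : opJ K n ∈ (SMod.gradingV K n).homGr (SMod.gradingV K n) 1 := by
  rw [opJ, map_sum]
  refine sum_mem fun i _ => ?_
  rw [map_smul]
  refine Submodule.smul_mem _ _ ?_
  have := toLin'_single_mem (K := K) (-i) i
  rw [Idx.p_neg] at this
  have e : i.p + 1 + i.p = 1 := by generalize i.p = x; revert x; decide
  rwa [e] at this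

/-- Two linear maps on `V` agreeing on the basis vectors are equal. -/
theorem vec_ext {M : Type u} [AddCommGroup M] [Module K M] {f g : (Idx n → K) →ₗ[K] M}
    (h : ∀ a : Idx n, f (vec K a) = g (vec K a)) : f = g := by
  refine (Pi.basisFun K (Idx n)).ext fun a => ?_
  simpa [vec] using h a

theorem opJ_opJ (x : Idx n → K) : opJ K n (opJ K n x) = -x := by
  have key : opJ K n ∘ₗ opJ K n = -LinearMap.id := by
    refine vec_ext fun a => ?_
    rw [LinearMap.comp_apply, opJ_vec, map_smul, opJ_vec, smul_smul, Idx.neg_neg', Idx.p_neg,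
      sgn_add, ← mul_assoc, sgn_mul_self, one_mul, sgn_one, neg_one_smul]
    rfl
  exact LinearMap.congr_fun key x

theorem toLin'_theta_diag (i a : Idx n) :
    Matrix.toLin' (Theta q i i) (vec K a) = ((q ^ Idx.phi a i : Kˣ) : K) • vec K a := by
  rw [Theta, if_pos rfl, vec, Matrix.toLin'_apply, Matrix.mulVec_single_one]
  ext r
  by_cases h : r = a
  · subst h; simp
  · simp [h, Matrix.diagonal_apply_ne]

theorem toLin'_theta_of_lt {i j : Idx n} (h : i < j) (a : Idx n) :
    Matrix.toLin' (Theta q i j) (vec K a) = (zq q * sgn (k := K) i.p) •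
      ((if i = a then vec K j else 0) + (if -i = a then vec K (-j) else 0)) := by
  rw [Theta, if_neg (ne_of_lt h), if_pos h, map_smul, map_add, LinearMap.smul_apply,
    LinearMap.add_apply, toLin'_single_vec, toLin'_single_vec]

theorem Idx.phi_neg_left (a b : Idx n) : Idx.phi (-a) b = Idx.phi a b := by
  simp [Idx.phi]

theorem opJ_mem_homU : opJ K n ∈ SMod.homU (SMod.V q n) (SMod.V q n) 1 := by
  refine SMod.mem_homU_of_op opJ_mem fun i j => ?_
  rw [SMod.V_op]
  refine vec_ext fun a => ?_
  rw [LinearMap.smul_apply, LinearMap.comp_apply, LinearMap.comp_apply, opJ_vec, one_mul]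
  rcases lt_trichotomy i j with h | rfl | h
  · have hs : sgn (k := K) (i.p + j.p) * sgn i.p = sgn j.p := by
      rw [sgn_add, mul_right_comm, sgn_mul_self, one_mul]
    rw [toLin'_theta_of_lt h, map_smul, map_smul, toLin'_theta_of_lt h]
    by_cases h1 : i = a
    · subst h1
      have h2 : -i ≠ i := fun e => by
        have := congrArg Subtype.val e
        have h0 := i.val_ne_zero
        rw [Idx.val_neg] at this; omega
      rw [if_pos rfl, if_neg h2, if_neg (Ne.symm h2), if_pos rfl, add_zero, zero_add, opJ_vec,
        smul_comm (sgn (k := K) i.p), smul_comm (sgn (k := K) (i.p + j.p)),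
        smul_smul (sgn (k := K) (i.p + j.p)), hs]
    · by_cases h2 : -i = a
      · subst h2
        have hs' : sgn (k := K) (i.p + j.p) * sgn (-i).p = sgn (-j).p := by
          rw [Idx.p_neg, Idx.p_neg, sgn_add i.p 1, sgn_add j.p 1, ← mul_assoc, hs]
        rw [if_neg h1, if_pos rfl, Idx.neg_neg', if_pos rfl, if_neg (Ne.symm h1), add_zero,
          zero_add, opJ_vec, smul_comm (sgn (k := K) (-i).p), smul_comm (sgn (k := K) (i.p + j.p)),
          smul_smul (sgn (k := K) (i.p + j.p)), hs', Idx.neg_neg']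
      · have h3 : i ≠ -a := fun e => h2 (by rw [e, Idx.neg_neg'])
        have h4 : -i ≠ -a := fun e => h1 (by rw [← Idx.neg_neg' i, e, Idx.neg_neg'])
        rw [if_neg h1, if_neg h2, if_neg h3, if_neg h4, add_zero, map_zero]
        simp only [smul_zero]
  · have e : i.p + i.p = 0 := by generalize i.p = x; revert x; decide
    rw [toLin'_theta_diag, map_smul, map_smul, toLin'_theta_diag, Idx.phi_neg_left, opJ_vec, e,
      sgn_zero, one_smul, smul_comm]
  · have h0 : Theta q i j = 0 := by rw [Theta, if_neg (ne_of_gt h), if_neg (not_lt.2 h.le)]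
    rw [h0, map_zero, LinearMap.zero_apply, LinearMap.zero_apply, map_zero, smul_zero]

theorem tensorMap_id_opJ_vec (a b : Idx n) :
    Grading.tensorMap (SMod.gradingV K n) (SMod.gradingV K n) (SMod.gradingV K n)
      LinearMap.id (opJ K n) (vec K a ⊗ₜ vec K b)
      = (sgn (k := K) a.p * sgn (k := K) b.p) • (vec K a ⊗ₜ[K] vec K (-b)) := by
  rw [Grading.tensorMap_tmul _ _ _ _ opJ_mem (vec_mem a), opJ_vec, one_mul, LinearMap.id_apply,
    TensorProduct.tmul_smul, smul_smul]

/-- The Clifford token slides through the crossing. -/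
theorem opT_comp_map_opJ : opT q n ∘ₗ TensorProduct.map (opJ K n) LinearMap.id
    = Grading.tensorMap (SMod.gradingV K n) (SMod.gradingV K n) (SMod.gradingV K n)
      LinearMap.id (opJ K n) ∘ₗ opT q n := by
  refine tensor_vec_ext fun a b => ?_
  refine eq_of_forall_dual (K := K) fun f => ?_
  rw [LinearMap.comp_apply, LinearMap.comp_apply, TensorProduct.map_tmul, opJ_vec,
    LinearMap.id_apply, ← TensorProduct.smul_tmul', LinearMap.map_smul, opT_vec, opT_vec]
  simp only [map_add, LinearMap.map_smul, apply_ite f, apply_ite (Grading.tensorMap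
    (SMod.gradingV K n) (SMod.gradingV K n) (SMod.gradingV K n) LinearMap.id (opJ K n)),
    map_zero, tensorMap_id_opJ_vec, smul_eq_mul, Idx.neg_neg', Idx.phi_neg_left, Idx.p_neg]
  have e1 : sgn (k := K) ((a.p + 1) * b.p) = sgn (a.p * b.p) * sgn b.p := by
    rw [← sgn_add]; congr 1; ring
  have e2 : ∀ x : ZMod 2, sgn (k := K) (x + 1) = - sgn x := fun x => by rw [sgn_add, sgn_one]; ring
  have e3 : sgn (k := K) b.p * sgn b.p = 1 := sgn_mul_self _
  rw [e1, e2, e2]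
  split_ifs
  all_goals
    first
    | ring1
    | linear_combination (-(sgn a.p * zq q * f (vec K (-a) ⊗ₜ[K] vec K b))) * e3

end

section
variable {K : Type u} [Field K] {q : Kˣ} {n : ℕ}

/-! ### Evaluation and coevaluation -/

/-- The sign in `Δ(u_{ij})` is trivial on the terms that do not vanish. -/
theorem comul_sign {i m j : Idx n} (h1 : i ≤ m) (h2 : m ≤ j) :
    sgn (k := K) ((i.p + m.p) * (m.p + j.p)) = 1 := by
  have h1 := Idx.p_of_le h1
  have h2 := Idx.p_of_le h2
  have e : ∀ a b c : ZMod 2, (a + b) * b = 0 → (b + c) * c = 0 → (a + b) * (b + c) = 0 := by decide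
  rw [e _ _ _ h1 h2, sgn_zero]

/-- The contraction `M^* ⊗ M → K` is a homomorphism of supermodules for every `M`, because of
`∑ S(u_{im}) u_{mj} = δ_{ij}`. -/
theorem SMod.contractLeft_mem_homU (M : SMod q n) : contractLeft K M.carrier ∈
    SMod.homU (SMod.tensor (SMod.dual M) M) (SMod.one q n) 0 := by
  obtain ⟨hS, h1, -⟩ := Uq.inverse_L_spec q (n := n)
  refine SMod.mem_homU_of_op (Grading.mem_homGr_tensor _ _ _ fun s t f hf v hv => ?_) fun i j => ?_
  · rw [add_zero, contractLeft_apply, add_comm]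
    exact hf t v hv
  rw [zero_mul, sgn_zero, one_smul]
  refine Grading.tensor_hom_ext M.grading.dual M.grading fun s t f hf v hv => ?_
  rw [LinearMap.comp_apply, LinearMap.comp_apply, contractLeft_apply, SMod.tensor_op, tensorOps,
    LinearMap.sum_apply, map_sum]
  have hterm : ∀ m : Idx n, contractLeft K M.carrier ((sgn (k := K) ((i.p + m.p) * (m.p + j.p)) •
      Grading.tensorMap (SMod.dual M).grading M.grading M.grading ((SMod.dual M).op i m) (M.op m j))
        (f ⊗ₜ v)) = sgn (k := K) ((i.p + j.p) * s)
          • f (M.act (Uq.antipodeGen q i m * Uq.gen q m j) v) := by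
    intro m
    have hS' : M.act (Uq.antipodeGen q i m) ∈ M.grading.homGr M.grading (i.p + m.p) :=
      M.act_mem (hS.2 i m)
    rw [LinearMap.smul_apply, Grading.tensorMap_tmul _ _ _ _ (M.op_mem m j) hf, SMod.dual_op,
      Grading.transpose_apply M.grading hS' hf, LinearMap.map_smul,
      LinearMap.map_smul, ← TensorProduct.smul_tmul', LinearMap.map_smul, contractLeft_apply,
      LinearMap.comp_apply, map_mul, Module.End.mul_apply]
    by_cases him : i ≤ m
    · by_cases hmj : m ≤ j
      · have e : (m.p + j.p) * s + (i.p + m.p) * s = (i.p + j.p) * s := by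
          generalize i.p = a; generalize j.p = b; generalize m.p = c
          clear hf; revert a b c s; decide
        rw [comul_sign him hmj, one_smul, smul_smul, ← sgn_add, e]; rfl
      · have h0 : M.op m j = 0 := by
          rw [SMod.op, Uq.gen_of_lt q (not_le.1 hmj), map_zero]
        have h0' : M.act (Uq.gen q m j) = 0 := h0
        rw [h0, h0', LinearMap.zero_apply, map_zero, map_zero]
        simp only [smul_zero]
    · have h0 : Uq.antipodeGen q i m = 0 := hS.1 i m (not_le.1 him)
      rw [h0, map_zero, LinearMap.zero_apply, LinearMap.zero_apply, map_zero]
      simp only [smul_zero]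
  rw [Finset.sum_congr rfl fun m _ => hterm m, ← Finset.smul_sum, ← map_sum f,
    ← LinearMap.sum_apply, ← map_sum M.act]
  have hij := congrFun (congrFun h1 i) j
  rw [Matrix.mul_apply] at hij
  have hij' : ∑ m, Uq.antipodeGen q i m * Uq.gen q m j
      = (1 : Matrix (Idx n) (Idx n) (Uq q n)) i j := hij
  rw [hij', SMod.one_op, Matrix.one_apply]
  split_ifs with h
  · subst h
    have e : (i.p + i.p) * s = 0 := by
      generalize i.p = a; clear hterm hf; revert a s; decide
    rw [e, sgn_zero, one_smul, map_one]; rfl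
  · rw [map_zero, LinearMap.zero_apply, map_zero, smul_zero]; rfl

theorem ev_mem_homU : ev K n ∈
    SMod.homU (SMod.tensor (SMod.dual (SMod.V q n)) (SMod.V q n)) (SMod.one q n) 0 :=
  SMod.contractLeft_mem_homU (SMod.V q n)

theorem covec_vec (i j : Idx n) : covec K i (vec K j) = if i = j then 1 else 0 := by
  change (Pi.single j (1 : K) : Idx n → K) i = _
  rw [Pi.single_apply]

theorem ev_covec_vec (i j : Idx n) : ev K n (covec K i ⊗ₜ vec K j) = if i = j then 1 else 0 :=
  covec_vec i j

theorem covec_mem (i : Idx n) : covec K i ∈ (SMod.gradingV K n).dual.gr i.p := by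
  intro s v hv
  by_cases h : i.p = s
  · have e : s + i.p = 0 := by rw [h]; clear hv h; revert s; decide
    rw [e]
    exact Grading.base_zero _
  · have : covec K i v = 0 := hv i h
    rw [this]
    exact zero_mem _

theorem sum_covec_apply (f : Module.Dual K (Idx n → K)) :
    f = ∑ l : Idx n, f (vec K l) • covec K l := by
  refine vec_ext fun a => ?_
  rw [LinearMap.sum_apply, Finset.sum_eq_single a]
  · rw [LinearMap.smul_apply, covec_vec, if_pos rfl, smul_eq_mul, mul_one]
  · intro b _ hb
    rw [LinearMap.smul_apply, covec_vec, if_neg hb, smul_zero]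
  · exact fun h => absurd (Finset.mem_univ _) h

theorem sum_vec_apply (v : Idx n → K) : v = ∑ l : Idx n, covec K l v • vec K l :=
  ((Pi.basisFun K (Idx n)).sum_repr v).symm.trans (Finset.sum_congr rfl fun l _ => by
    rw [Pi.basisFun_apply]; rfl)

/-- The canonical element `∑ v_k ⊗ v_k^*` absorbs endomorphisms from either side. -/
theorem sum_vec_tmul_comp {M : Type u} [AddCommGroup M] [Module K M] (A : (Idx n → K) →ₗ[K] M)
    (B : Module.End K (Idx n → K)) :
    ∑ k : Idx n, A (vec K k) ⊗ₜ[K] (covec K k ∘ₗ B)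
      = ∑ k : Idx n, A (B (vec K k)) ⊗ₜ[K] covec K k := by
  have h : ∀ k : Idx n, A (vec K k) ⊗ₜ[K] (covec K k ∘ₗ B)
      = ∑ l : Idx n, A (covec K k (B (vec K l)) • vec K k) ⊗ₜ[K] covec K l := by
    intro k
    conv_lhs => rw [sum_covec_apply (covec K k ∘ₗ B)]
    rw [TensorProduct.tmul_sum]
    refine Finset.sum_congr rfl fun l _ => ?_
    rw [LinearMap.map_smul, TensorProduct.smul_tmul]; rfl
  rw [Finset.sum_congr rfl fun k _ => h k, Finset.sum_comm]
  refine Finset.sum_congr rfl fun l _ => ?_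
  rw [← TensorProduct.sum_tmul, ← map_sum A, ← sum_vec_apply]

theorem coev_one : coev K n 1 = ∑ k : Idx n, vec K k ⊗ₜ[K] covec K k := by
  rw [coev, LinearMap.toSpanSingleton_apply, one_smul]

/-- The coevaluation is a homomorphism of supermodules, because of `∑ u_{im} S(u_{mj}) = δ_{ij}`. -/
theorem coev_mem_homU : coev K n ∈
    SMod.homU (SMod.one q n) (SMod.tensor (SMod.V q n) (SMod.dual (SMod.V q n))) 0 := by
  obtain ⟨hS, -, h1⟩ := Uq.inverse_L_spec q (n := n)
  refine SMod.mem_homU_of_op ?_ fun i j => ?_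
  · intro s x hx
    have hc : coev K n x = x • ∑ k : Idx n, vec K k ⊗ₜ[K] covec K k := rfl
    rw [hc, add_zero]
    rcases zmod2_cases s with rfl | rfl
    · refine Submodule.smul_mem _ _ (sum_mem fun k _ => ?_)
      have := Grading.tmul_mem _ _ (vec_mem (K := K) k) (covec_mem k)
      have e : k.p + k.p = 0 := by generalize k.p = a; revert a; decide
      rwa [e] at this
    · have : x = 0 := by simpa [Grading.base] using hx
      rw [this, zero_smul]
      exact zero_mem _
  rw [zero_mul, sgn_zero, one_smul]
  refine LinearMap.ext_ring ?_
  rw [LinearMap.comp_apply, LinearMap.comp_apply, coev_one, SMod.tensor_op, tensorOps,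
    LinearMap.sum_apply]
  have hterm : ∀ m : Idx n, (sgn (k := K) ((i.p + m.p) * (m.p + j.p)) •
      Grading.tensorMap (SMod.V q n).grading (SMod.dual (SMod.V q n)).grading
        (SMod.dual (SMod.V q n)).grading ((SMod.V q n).op i m) ((SMod.dual (SMod.V q n)).op m j))
        (∑ k : Idx n, vec K k ⊗ₜ[K] covec K k)
      = ∑ k : Idx n, (SMod.V q n).act (Uq.gen q i m * Uq.antipodeGen q m j) (vec K k)
          ⊗ₜ[K] covec K k := by
    intro m
    have hS' : (SMod.V q n).act (Uq.antipodeGen q m j) ∈ (SMod.V q n).grading.homGr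
      (SMod.V q n).grading (m.p + j.p) := (SMod.V q n).act_mem (hS.2 m j)
    have hk : ∀ k : Idx n, Grading.tensorMap (SMod.V q n).grading (SMod.dual (SMod.V q n)).grading
        (SMod.dual (SMod.V q n)).grading ((SMod.V q n).op i m) ((SMod.dual (SMod.V q n)).op m j)
        (vec K k ⊗ₜ[K] covec K k) = (SMod.V q n).op i m (vec K k)
          ⊗ₜ[K] (covec K k ∘ₗ (SMod.V q n).act (Uq.antipodeGen q m j)) := by
      intro k
      rw [Grading.tensorMap_tmul _ _ _ _ ((SMod.dual (SMod.V q n)).op_mem m j) (vec_mem k),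
        SMod.dual_op, Grading.transpose_apply _ hS' (covec_mem k), TensorProduct.tmul_smul,
        smul_smul, sgn_mul_self, one_smul]
    rw [LinearMap.smul_apply, map_sum, Finset.sum_congr rfl fun k _ => hk k]
    have e := sum_vec_tmul_comp ((SMod.V q n).op i m) ((SMod.V q n).act (Uq.antipodeGen q m j))
    refine (congrArg _ e).trans ?_
    by_cases him : i ≤ m
    · by_cases hmj : m ≤ j
      · rw [comul_sign him hmj, one_smul]
        simp only [map_mul, Module.End.mul_apply]; rfl
      · have h0 : Uq.antipodeGen q m j = 0 := hS.1 m j (not_le.1 hmj)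
        simp only [h0, mul_zero, map_zero, LinearMap.zero_apply, TensorProduct.zero_tmul,
          Finset.sum_const_zero, smul_zero]
    · have h0 : Uq.gen q i m = 0 := Uq.gen_of_lt q (not_le.1 him)
      simp only [SMod.op, h0, zero_mul, map_zero, LinearMap.zero_apply, TensorProduct.zero_tmul,
          Finset.sum_const_zero, smul_zero]
  rw [Finset.sum_congr rfl fun m _ => hterm m, Finset.sum_comm]
  have hij := congrFun (congrFun h1 i) j
  rw [Matrix.mul_apply] at hij
  have hij' : ∑ m, Uq.gen q i m * Uq.antipodeGen q m j
      = (1 : Matrix (Idx n) (Idx n) (Uq q n)) i j := hij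
  have hsum : ∀ k : Idx n, ∑ m : Idx n, (SMod.V q n).act (Uq.gen q i m * Uq.antipodeGen q m j)
      (vec K k) ⊗ₜ[K] covec K k = if i = j then vec K k ⊗ₜ[K] covec K k else 0 := by
    intro k
    rw [← TensorProduct.sum_tmul, ← LinearMap.sum_apply, ← map_sum (SMod.V q n).act, hij',
      Matrix.one_apply]
    split_ifs
    · rw [map_one]; rfl
    · rw [map_zero, LinearMap.zero_apply, TensorProduct.zero_tmul]
  rw [Finset.sum_congr rfl fun k _ => hsum k, SMod.one_op]
  split_ifs
  · exact coev_one
  · rw [LinearMap.zero_apply, map_zero, Finset.sum_const_zero]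

/-! ### The telescoping sum -/

/-- `q^{-2|k|}` times the sign of `k` and `z` is a difference of two consecutive values of
`k ↦ q^{-|2k+1|}`. -/
theorem sum_telescope {a b : ℤ} (hab : a ≤ b) (ha : -(n : ℤ) ≤ a + 1) (hb : b ≤ n) :
    ∑ k : Idx n, (if a < k.1 ∧ k.1 ≤ b then
      zq q * (sgn k.p * ((q ^ (-2 * |k.1|) : Kˣ) : K)) else 0)
      = ((q ^ (-|2 * a + 1|) : Kˣ) : K) - ((q ^ (-|2 * b + 1|) : Kˣ) : K) := by
  induction b, hab using Int.leInduction with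
  | base =>
    rw [sub_self]
    exact Finset.sum_eq_zero fun k _ => if_neg fun h => absurd (h.1.trans_le h.2) (lt_irrefl _)
  | succ b hab ih =>
    have ih := ih (by omega)
    by_cases h0 : b + 1 = 0
    -- There is no index `0`, and `|2 b + 1|` takes the same value at `b = -1` and `b = 0`.
    · obtain rfl : b = -1 := by omega
      refine (Finset.sum_congr rfl fun k _ => ?_).trans (ih.trans (by norm_num))
      have h := k.val_ne_zero
      refine if_congr ?_ rfl rfl
      omega
    · have hm : b + 1 ∈ (Finset.Icc (-(n : ℤ)) n).erase 0 := by
        rw [Finset.mem_erase, Finset.mem_Icc]; omega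
      have hs : ∀ k : Idx n, (if a < k.1 ∧ k.1 ≤ b + 1 then
          zq q * (sgn k.p * ((q ^ (-2 * |k.1|) : Kˣ) : K)) else 0)
          = (if a < k.1 ∧ k.1 ≤ b then zq q * (sgn k.p * ((q ^ (-2 * |k.1|) : Kˣ) : K)) else 0)
            + if k = (⟨b + 1, hm⟩ : Idx n) then
              zq q * (sgn k.p * ((q ^ (-2 * |k.1|) : Kˣ) : K)) else 0 := by
        intro k
        by_cases hk : k = (⟨b + 1, hm⟩ : Idx n)
        · have hk' : k.1 = b + 1 := congrArg Subtype.val hk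
          rw [if_pos hk, if_pos (by omega), if_neg (by omega), zero_add]
        · have hk' : k.1 ≠ b + 1 := fun h => hk (Subtype.ext h)
          rw [if_neg hk, add_zero]
          refine if_congr ?_ rfl rfl
          omega
      rw [Finset.sum_congr rfl fun k _ => hs k, Finset.sum_add_distrib, ih, Finset.sum_ite_eq',
        if_pos (Finset.mem_univ _)]
      have key : zq q * (sgn (Idx.p (⟨b + 1, hm⟩ : Idx n)) * ((q ^ (-2 * |b + 1|) : Kˣ) : K))
          = ((q ^ (-|2 * b + 1|) : Kˣ) : K) - ((q ^ (-|2 * (b + 1) + 1|) : Kˣ) : K) := by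
        rcases lt_or_gt_of_ne h0 with h | h
        · have e1 : -|2 * b + 1| = -2 * |b + 1| + -1 := by
            rw [abs_of_neg, abs_of_neg] <;> omega
          have e2 : -|2 * (b + 1) + 1| = -2 * |b + 1| + 1 := by
            rw [abs_of_neg, abs_of_neg] <;> omega
          rw [e1, e2, zpow_add, zpow_add, zpow_neg_one, zpow_one, Idx.p, if_pos h, sgn_one, zq]
          push_cast
          ring
        · have e1 : -|2 * b + 1| = -2 * |b + 1| + 1 := by
            rw [abs_of_pos, abs_of_pos] <;> omega
          have e2 : -|2 * (b + 1) + 1| = -2 * |b + 1| + -1 := by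
            rw [abs_of_pos, abs_of_pos] <;> omega
          rw [e1, e2, zpow_add, zpow_add, zpow_neg_one, zpow_one, Idx.p, if_neg (not_lt.2 h.le),
            sgn_zero, zq]
          push_cast
          ring
      rw [key]
      ring

end

section
variable {K : Type u} [Field K] {q : Kˣ} {n : ℕ}

/-! ### Inverting the positive left crossing -/

theorem Idx.phi_self (i : Idx n) : Idx.phi i i = if i.1 < 0 then -1 else 1 := if_pos rfl

/-- The value at `i` of the exponent `|2 k + 1|` in the telescoping sum. -/
theorem two_abs_add_phi (i : Idx n) : |2 * i.1 + 1| = 2 * |i.1| + Idx.phi i i := by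
  rw [Idx.phi_self]
  rcases lt_or_gt_of_ne i.val_ne_zero with h | h
  · rw [if_pos h, abs_of_neg h, abs_of_neg] <;> omega
  · rw [if_neg (not_lt.2 h.le), abs_of_pos h, abs_of_pos]
    all_goals omega

/-- The value at `i - 1` of the exponent `|2 k + 1|` in the telescoping sum. -/
theorem two_abs_sub_phi (i : Idx n) : |2 * (i.1 - 1) + 1| = 2 * |i.1| - Idx.phi i i := by
  rw [Idx.phi_self]
  rcases lt_or_gt_of_ne i.val_ne_zero with h | h
  · rw [if_pos h, abs_of_neg h, abs_of_neg] <;> omega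
  · rw [if_neg (not_lt.2 h.le), abs_of_pos h, abs_of_pos] <;> omega

theorem Idx.le_n (i : Idx n) : i.1 ≤ n := (Finset.mem_Icc.1 (Finset.mem_erase.1 i.2).2).2
theorem Idx.neg_n_le (i : Idx n) : -(n : ℤ) ≤ i.1 := (Finset.mem_Icc.1 (Finset.mem_erase.1 i.2).2).1

/-- A map sending `y_k` to `(-1)^{p(k)} q^{φ(k,k)} x_k + z ∑_{m > k} x_m` for all `k` is inverted by
the explicit combinations of the `y_k` that occur in the formula for the negative right crossing. -/
theorem apply_triangular {M M' : Type u} [AddCommGroup M] [Module K M] [AddCommGroup M']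
    [Module K M'] (P : M' →ₗ[K] M) (y : Idx n → M') (x : Idx n → M)
    (h : ∀ k, P (y k) = (sgn k.p * ((q ^ Idx.phi k k : Kˣ) : K)) • x k
      + ∑ m : Idx n, if k < m then zq q • x m else 0) (i : Idx n) :
    P ((sgn i.p * ((q ^ (-Idx.phi i i) : Kˣ) : K)) • y i
      - zq q • ∑ k : Idx n, if i < k then
        (sgn (i.p + k.p) * ((q ^ (2 * |i.1| - 2 * |k.1|) : Kˣ) : K)) • y k else 0) = x i := by
  refine eq_of_forall_dual (K := K) fun f => ?_
  -- `hsum` says that the coefficients of `x_m` with `i < m` cancel: the inner sum over `i < k < m`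
  -- telescopes, and the boundary term at `m` kills the diagonal contribution.
  have hsum : ∀ m : Idx n, (if i < m then zq q * (sgn (i.p + m.p)
      * ((q ^ (2 * |i.1| - 2 * |m.1|) : Kˣ) : K)) * (sgn m.p * ((q ^ Idx.phi m m : Kˣ) : K)) else 0)
      + ∑ k : Idx n, (if i < k then zq q * (sgn (i.p + k.p)
        * ((q ^ (2 * |i.1| - 2 * |k.1|) : Kˣ) : K)) * (if k < m then zq q else 0) else 0)
      = if i < m then sgn i.p * ((q ^ (-Idx.phi i i) : Kˣ) : K) * zq q else 0 := by
    intro m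
    by_cases him : i < m
    · have him' : i.1 < m.1 := him
      have ht := sum_telescope (q := q) (n := n) (a := i.1) (b := m.1 - 1) (by omega)
        (by have := i.neg_n_le; omega) (by have := m.le_n; omega)
      rw [two_abs_add_phi, two_abs_sub_phi] at ht
      have e : ∀ k : Idx n, (if i < k then zq q * (sgn (i.p + k.p)
          * ((q ^ (2 * |i.1| - 2 * |k.1|) : Kˣ) : K)) * (if k < m then zq q else 0) else 0)
          = sgn i.p * ((q ^ (2 * |i.1|) : Kˣ) : K) * zq q * (if i.1 < k.1 ∧ k.1 ≤ m.1 - 1 then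
            zq q * (sgn k.p * ((q ^ (-2 * |k.1|) : Kˣ) : K)) else 0) := by
        intro k
        by_cases h1 : i < k
        · by_cases h2 : k < m
          · have h1' : i.1 < k.1 := h1
            have h2' : k.1 < m.1 := h2
            rw [if_pos h1, if_pos h2, if_pos (by omega), sub_eq_add_neg, zpow_add, sgn_add,
              Units.val_mul, neg_mul]
            ring
          · have h2' : ¬ k.1 < m.1 := h2
            rw [if_neg h2, if_neg (show ¬(i.1 < k.1 ∧ k.1 ≤ m.1 - 1) by omega), mul_zero, mul_zero,
              ite_self]
        · have h1' : ¬ i.1 < k.1 := h1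
          rw [if_neg h1, if_neg (by omega), mul_zero]
      rw [if_pos him, if_pos him, Finset.sum_congr rfl fun k _ => e k, ← Finset.mul_sum, ht]
      have e1 : ((q ^ (2 * |i.1| - 2 * |m.1|) : Kˣ) : K) * ((q ^ Idx.phi m m : Kˣ) : K)
          = ((q ^ (2 * |i.1|) : Kˣ) : K) * ((q ^ (-(2 * |m.1| - Idx.phi m m)) : Kˣ) : K) := by
        rw [← Units.val_mul, ← Units.val_mul, ← zpow_add, ← zpow_add]
        congr 2; ring
      have e2 : ((q ^ (-Idx.phi i i) : Kˣ) : K)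
          = ((q ^ (2 * |i.1|) : Kˣ) : K) * ((q ^ (-(2 * |i.1| + Idx.phi i i)) : Kˣ) : K) := by
        rw [← Units.val_mul, ← zpow_add]
        congr 2; ring
      rw [e2, sgn_add]
      have e3 : sgn (k := K) m.p * sgn m.p = 1 := sgn_mul_self _
      linear_combination (zq q * sgn i.p * (sgn m.p * sgn m.p)) * e1 + zq q * sgn i.p
        * ((q ^ (2 * |i.1|) : Kˣ) : K) * ((q ^ (-(2 * |m.1| - Idx.phi m m)) : Kˣ) : K) * e3
    · rw [if_neg him, if_neg him, zero_add]
      refine Finset.sum_eq_zero fun k _ => ?_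
      by_cases h1 : i < k
      · rw [if_neg fun h2 => him (h1.trans h2), mul_zero, ite_self]
      · rw [if_neg h1]
  have hy : ∀ k, f (P (y k)) = sgn k.p * ((q ^ Idx.phi k k : Kˣ) : K) * f (x k)
      + ∑ m : Idx n, (if k < m then zq q else 0) * f (x m) := by
    intro k
    rw [h, map_add, LinearMap.map_smul, map_sum, smul_eq_mul]
    simp only [apply_ite f, LinearMap.map_smul, map_zero, smul_eq_mul, ite_mul, zero_mul]
  have hD : sgn (k := K) i.p * ((q ^ (-Idx.phi i i) : Kˣ) : K) * (sgn i.p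
      * ((q ^ Idx.phi i i : Kˣ) : K)) = 1 := by
    have e3 : sgn (k := K) i.p * sgn i.p = 1 := sgn_mul_self _
    have e4 : ((q ^ (-Idx.phi i i) : Kˣ) : K) * ((q ^ Idx.phi i i : Kˣ) : K) = 1 := by
      rw [← Units.val_mul, ← zpow_add, neg_add_cancel, zpow_zero, Units.val_one]
    linear_combination sgn (k := K) i.p * sgn i.p * e4 + e3
  simp only [map_sub, LinearMap.map_smul, map_sum, apply_ite P, apply_ite f, map_zero, smul_eq_mul,
    hy]
  have hswap : zq q * ∑ k : Idx n, (if i < k then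
        sgn (i.p + k.p) * ((q ^ (2 * |i.1| - 2 * |k.1|) : Kˣ) : K)
          * (sgn k.p * ((q ^ Idx.phi k k : Kˣ) : K) * f (x k)
          + ∑ m : Idx n, (if k < m then zq q else 0) * f (x m)) else 0)
      = ∑ m : Idx n, (if i < m then sgn i.p * ((q ^ (-Idx.phi i i) : Kˣ) : K) * zq q else 0)
          * f (x m) := by
    simp only [← hsum, add_mul, Finset.sum_add_distrib, Finset.sum_mul]
    rw [Finset.sum_comm (f := fun m k => _), ← Finset.sum_add_distrib, Finset.mul_sum]
    refine Finset.sum_congr rfl fun k _ => ?_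
    split_ifs
    · rw [mul_add, mul_add, Finset.mul_sum, Finset.mul_sum]
      congr 1
      · ring
      · exact Finset.sum_congr rfl fun m _ => by ring
    · simp
  rw [hswap, mul_add, ← mul_assoc, hD, one_mul, Finset.mul_sum]
  rw [add_sub_assoc, ← Finset.sum_sub_distrib, Finset.sum_eq_zero, add_zero]
  intro m _
  split_ifs <;> ring

variable (q n) in
/-- The linear map `V ⊗ V^* → V^* ⊗ V` given by the asserted formula for the image of the negative
right crossing. -/
def opN : (Idx n → K) ⊗[K] Module.Dual K (Idx n → K) →ₗ[K]
    Module.Dual K (Idx n → K) ⊗[K] (Idx n → K) :=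
  TensorProduct.lift ((Pi.basisFun K (Idx n)).constr K fun i =>
    (Pi.basisFun K (Idx n)).dualBasis.constr K fun j => negRightFormula q i j)

theorem opN_vec_covec (i j : Idx n) : opN q n (vec K i ⊗ₜ covec K j) = negRightFormula q i j := by
  have h1 : vec K i = Pi.basisFun K (Idx n) i := (Pi.basisFun_apply K (Idx n) i).symm
  have h2 : covec K j = (Pi.basisFun K (Idx n)).dualBasis j := by
    refine vec_ext fun a => ?_
    rw [covec_vec, vec, ← Pi.basisFun_apply, Module.Basis.dualBasis_apply_self]
    simp [eq_comm]
  rw [opN, TensorProduct.lift.tmul, h1, h2, Module.Basis.constr_basis, Module.Basis.constr_basis]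

/-- The value on `v_i^* ⊗ v_j` of the image of the positive left crossing. -/
def posLeftFormula (q : Kˣ) (i j : Idx n) : (Idx n → K) ⊗[K] Module.Dual K (Idx n → K) :=
  (sgn (i.p * j.p) * ((q ^ Idx.phi j i : Kˣ) : K)) • (vec K j ⊗ₜ[K] covec K i)
  + (if i = j then ∑ k : Idx n, (if j < k then zq q • (vec K k ⊗ₜ[K] covec K k) else 0) else 0)
  + (if i = -j then ∑ k : Idx n,
      (if i < k then (zq q * sgn k.p) • (vec K (-k) ⊗ₜ[K] covec K k) else 0) else 0)

theorem Idx.neg_ne (i : Idx n) : i ≠ -i := fun e => by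
  have := congrArg Subtype.val e
  have h0 := i.val_ne_zero
  rw [Idx.val_neg] at this; omega

theorem Idx.mul_p_neg (i : Idx n) : i.p * (-i).p = 0 := by
  rw [Idx.p_neg]; generalize i.p = x; revert x; decide

theorem negRightFormula_self (i : Idx n) : negRightFormula q i i
    = (sgn i.p * ((q ^ (-Idx.phi i i) : Kˣ) : K)) • (covec K i ⊗ₜ[K] vec K i)
      - zq q • ∑ k : Idx n, if i < k then
        (sgn (i.p + k.p) * ((q ^ (2 * |i.1| - 2 * |k.1|) : Kˣ) : K)) • (covec K k ⊗ₜ[K] vec K k)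
        else 0 := by
  have esq : ∀ x : ZMod 2, x * x = x := by decide
  have hz : ∀ t : Module.Dual K (Idx n → K) ⊗[K] (Idx n → K), t - 0 = t := fun t => sub_zero t
  rw [negRightFormula, if_pos rfl, if_neg i.neg_ne, esq, hz]

theorem negRightFormula_neg (j : Idx n) : negRightFormula q (-j) j
    = ((q ^ (-Idx.phi j j) : Kˣ) : K) • (covec K j ⊗ₜ[K] vec K (-j))
      - zq q • ∑ k : Idx n, if j < k then
        (sgn k.p * ((q ^ (2 * |j.1| - 2 * |k.1|) : Kˣ) : K)) • (covec K k ⊗ₜ[K] vec K (-k))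
        else 0 := by
  have hz : ∀ t : Module.Dual K (Idx n → K) ⊗[K] (Idx n → K), t - 0 = t := fun t => sub_zero t
  rw [negRightFormula, if_pos rfl, if_neg j.neg_ne.symm, Idx.phi_neg_left, mul_comm (-j).p,
    j.mul_p_neg, sgn_zero, one_mul, Idx.val_neg, abs_neg, hz]

theorem negRightFormula_of_ne {i j : Idx n} (h1 : i ≠ j) (h2 : i ≠ -j) : negRightFormula q i j
    = (sgn (i.p * j.p) * ((q ^ (-Idx.phi i j) : Kˣ) : K)) • (covec K j ⊗ₜ[K] vec K i) := by
  have hz : ∀ t : Module.Dual K (Idx n → K) ⊗[K] (Idx n → K), t - 0 = t := fun t => sub_zero t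
  rw [negRightFormula, if_neg h1, if_neg h2, hz, hz]

/-- A map with the values of the positive left crossing inverts the negative right crossing. -/
theorem apply_negRightFormula
    (P : Module.Dual K (Idx n → K) ⊗[K] (Idx n → K) →ₗ[K]
      (Idx n → K) ⊗[K] Module.Dual K (Idx n → K))
    (hP : ∀ i j : Idx n, P (covec K i ⊗ₜ vec K j) = posLeftFormula q i j) (i j : Idx n) :
    P (negRightFormula q i j) = vec K i ⊗ₜ covec K j := by
  have esq : ∀ x : ZMod 2, x * x = x := by decide
  by_cases h1 : i = j
  · subst h1
    have := apply_triangular (q := q) P (fun k => covec K k ⊗ₜ vec K k)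
      (fun k => vec K k ⊗ₜ covec K k) (fun k => by
        rw [hP, posLeftFormula, if_pos rfl, if_neg k.neg_ne, add_zero, esq]) i
    rw [negRightFormula_self]
    exact this
  · by_cases h2 : i = -j
    · subst h2
      have := apply_triangular (q := q) P (fun k => covec K k ⊗ₜ vec K (-k))
        (fun k => sgn (k := K) k.p • (vec K (-k) ⊗ₜ covec K k)) (fun k => by
          rw [hP, posLeftFormula, if_neg k.neg_ne, if_pos k.neg_neg'.symm, add_zero, k.mul_p_neg,
            sgn_zero, one_mul, Idx.phi_neg_left, smul_smul, mul_right_comm, sgn_mul_self, one_mul]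
          simp only [smul_smul]) j
      have h := congrArg (fun t => sgn (k := K) j.p • t) this
      beta_reduce at h
      rw [smul_smul, sgn_mul_self, one_smul, ← LinearMap.map_smul] at h
      have hs : ∀ k : Idx n, (sgn (k := K) j.p • if j < k then
          (sgn (j.p + k.p) * ((q ^ (2 * |j.1| - 2 * |k.1|) : Kˣ) : K))
            • (covec K k ⊗ₜ[K] vec K (-k)) else 0) = if j < k then
          (sgn k.p * ((q ^ (2 * |j.1| - 2 * |k.1|) : Kˣ) : K))
            • (covec K k ⊗ₜ[K] vec K (-k)) else 0 := by
        intro k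
        rw [smul_ite, smul_zero, smul_smul, sgn_add, ← mul_assoc, ← mul_assoc, sgn_mul_self,
          one_mul]
      rw [← h, negRightFormula_neg, smul_sub, smul_smul, ← mul_assoc,
        sgn_mul_self, one_mul, smul_comm (sgn (k := K) j.p) (zq q),
        Finset.smul_sum (r := sgn (k := K) j.p),
        Finset.sum_congr rfl fun k _ => hs k]
    · have h3 : j ≠ -i := fun e => h2 (by rw [e, Idx.neg_neg'])
      have h4 : ((q ^ (-Idx.phi i j) : Kˣ) : K) * ((q ^ Idx.phi i j : Kˣ) : K) = 1 := by
        rw [← Units.val_mul, ← zpow_add, neg_add_cancel, zpow_zero, Units.val_one]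
      rw [negRightFormula_of_ne h1 h2, LinearMap.map_smul, hP,
        posLeftFormula, if_neg (Ne.symm h1), if_neg h3, add_zero, add_zero, smul_smul, mul_comm j.p,
        mul_mul_mul_comm, sgn_mul_self, h4, one_mul, one_smul]

/-! ### The bubble -/

/-- The contribution of `i` to the bubble: the sum over `k > i` telescopes up to the end `n`. -/
theorem ev_negRightFormula_self (i : Idx n) : ev K n (negRightFormula q i i)
    = sgn i.p * (((q ^ (2 * |i.1|) : Kˣ) : K) * ((q ^ (-|2 * (n : ℤ) + 1|) : Kˣ) : K)) := by
  have esq : ∀ x : ZMod 2, x * x = x := by decide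
  have ht := sum_telescope (q := q) (n := n) (a := i.1) (b := n) i.le_n
    (by have := i.neg_n_le; omega) le_rfl
  rw [two_abs_add_phi] at ht
  have e : ∀ k : Idx n, (if i < k then sgn (i.p + k.p)
      * ((q ^ (2 * |i.1| - 2 * |k.1|) : Kˣ) : K) else 0) * zq q
      = sgn i.p * ((q ^ (2 * |i.1|) : Kˣ) : K) * (if i.1 < k.1 ∧ k.1 ≤ n then
            zq q * (sgn k.p * ((q ^ (-2 * |k.1|) : Kˣ) : K)) else 0) := by
    intro k
    by_cases h1 : i < k
    · have h1' : i.1 < k.1 := h1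
      rw [if_pos h1, if_pos ⟨h1', k.le_n⟩, sub_eq_add_neg, zpow_add, sgn_add, Units.val_mul,
        neg_mul]
      ring
    · rw [if_neg h1, if_neg fun h => h1 h.1, mul_zero, zero_mul]
  have e2 : ((q ^ (-Idx.phi i i) : Kˣ) : K)
      = ((q ^ (2 * |i.1|) : Kˣ) : K) * ((q ^ (-(2 * |i.1| + Idx.phi i i)) : Kˣ) : K) := by
    rw [← Units.val_mul, ← zpow_add]
    congr 2; ring
  rw [negRightFormula_self, map_sub, LinearMap.map_smul,
    LinearMap.map_smul, map_sum]
  simp only [apply_ite (ev K n), LinearMap.map_smul, ev_covec_vec, if_true, map_zero, smul_eq_mul,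
    mul_one]
  rw [mul_comm (zq q), Finset.sum_mul, Finset.sum_congr rfl fun k _ => e k, ← Finset.mul_sum, ht,
    e2]
  ring

/-- The image of the bubble vanishes: the contributions of `i` and `-i` cancel. -/
theorem sum_ev_negRightFormula : ∑ i : Idx n, ev K n (negRightFormula q i i) = 0 := by
  refine Finset.sum_involution (fun i _ => -i) (fun i _ => ?_) (fun i _ _ => i.neg_ne.symm)
    (fun i _ => Finset.mem_univ _) (fun i _ => i.neg_neg')
  rw [ev_negRightFormula_self, ev_negRightFormula_self, Idx.val_neg, abs_neg, Idx.p_neg, sgn_add,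
    sgn_one]
  ring

end

open SMod

section
variable {K : Type u} [Field K] {q : Kˣ} {n : ℕ}

/-! ### The images of the generators -/

/-- The tensor product of morphisms between tensor words. -/
def wordTens (V : Arrow → SMod q n) {a b c d : List Arrow} (f : wordObj V a ⟶ wordObj V b)
    (g : wordObj V c ⟶ wordObj V d) : wordObj V (a ++ c) ⟶ wordObj V (b ++ d) :=
  (wordSystem V).tens (a := a) (b := b) (c := c) (d := d) f g

variable (q n) in
/-- `T` as a homomorphism of supermodules. -/
def posUpHom : wordObj (objV q n) [.up, .up] ⟶ wordObj (objV q n) [.up, .up] :=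
  ofLin (opT q n) opT_mem_homU

theorem opTInv_mem_homU :
    opTInv q n ∈ homU (tensor (SMod.V q n) (SMod.V q n)) (tensor (SMod.V q n) (SMod.V q n)) 0 :=
  Submodule.sub_mem _ opT_mem_homU (Submodule.smul_mem _ _ (id_mem_homU _))

variable (q n) in
/-- `T⁻¹` as a homomorphism of supermodules. -/
def negUpHom : wordObj (objV q n) [.up, .up] ⟶ wordObj (objV q n) [.up, .up] :=
  ofLin (opTInv q n) opTInv_mem_homU

variable (q n) in
/-- The evaluation as a homomorphism of supermodules. -/
def leftCapHom : wordObj (objV q n) [.down, .up] ⟶ wordObj (objV q n) [] :=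
  ofLin (ev K n) ev_mem_homU

variable (q n) in
/-- The coevaluation as a homomorphism of supermodules. -/
def leftCupHom : wordObj (objV q n) [] ⟶ wordObj (objV q n) [.up, .down] :=
  ofLin (coev K n) coev_mem_homU

variable (q n) in
/-- `J` as a homomorphism of supermodules. -/
def tokHom : wordObj (objV q n) [.up] ⟶ wordObj (objV q n) [.up] := ofLin (opJ K n) opJ_mem_homU

variable (q n) in
/-- The image of the positive left crossing. -/
def posLeftHom : wordObj (objV q n) [.down, .up] ⟶ wordObj (objV q n) [.up, .down] :=
  wordTens (objV q n) (𝟙 (wordObj (objV q n) [.down, .up])) (leftCupHom q n)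
  ≫ wordTens (objV q n) (a := [.down]) (c := [.up, .up, .down]) (b := [.down])
    (d := [.up, .up, .down]) (𝟙 (wordObj (objV q n) [.down]))
    (wordTens (objV q n) (posUpHom q n) (𝟙 (wordObj (objV q n) [.down])))
  ≫ wordTens (objV q n) (leftCapHom q n) (𝟙 (wordObj (objV q n) [.up, .down]))

section
variable (V : Arrow → SMod q n)

theorem mulₗ_pair (x y z : Arrow) (c : List Arrow) : mulₗ V [x, y] (z :: c)
    = (TensorProduct.assoc K (V x).carrier (V y).carrier
        (wordObj V (z :: c)).carrier).toLinearMap :=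
  TensorProduct.ext_threefold fun v v' w => mulₗ_cons_cons V x y [] (z :: c) v v' w

theorem toLin_wordTens_pair_id {x y z x' y' : Arrow} {c : List Arrow}
    (f : wordObj V [x, y] ⟶ wordObj V [x', y']) :
    toLin (wordTens V f (𝟙 (wordObj V (z :: c))))
      = (TensorProduct.assoc K (V x').carrier (V y').carrier
          (wordObj V (z :: c)).carrier).toLinearMap
        ∘ₗ TensorProduct.map (toLin f) LinearMap.id
        ∘ₗ (TensorProduct.assoc K (V x).carrier (V y).carrier
          (wordObj V (z :: c)).carrier).symm.toLinearMap := by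
  rw [← LinearMap.comp_assoc, ← mulₗ_pair, LinearEquiv.eq_comp_toLinearMap_symm, ← mulₗ_pair]
  exact TensorProduct.ext' fun t w => toLin_tens_mulₗ_even V (a := [x, y]) (b := [x', y'])
    (c := z :: c) f (g := 𝟙 _) (id_mem_homU _) t w

theorem toLin_wordTens_cap_id {x y z : Arrow} {c : List Arrow}
    (f : wordObj V [x, y] ⟶ wordObj V []) :
    toLin (wordTens V f (𝟙 (wordObj V (z :: c))))
      = (TensorProduct.lid K (wordObj V (z :: c)).carrier).toLinearMap
        ∘ₗ TensorProduct.map (toLin f) LinearMap.id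
        ∘ₗ (TensorProduct.assoc K (V x).carrier (V y).carrier
          (wordObj V (z :: c)).carrier).symm.toLinearMap := by
  rw [← LinearMap.comp_assoc, LinearEquiv.eq_comp_toLinearMap_symm, ← mulₗ_pair]
  exact TensorProduct.ext' fun t w => toLin_tens_mulₗ_even V (a := [x, y]) (b := [])
    (c := z :: c) f (g := 𝟙 _) (id_mem_homU _) t w

theorem toLin_wordTens_cup_id {x y z : Arrow} {c : List Arrow}
    (f : wordObj V [] ⟶ wordObj V [x, y]) :
    toLin (wordTens V f (𝟙 (wordObj V (z :: c))))
      = (TensorProduct.assoc K (V x).carrier (V y).carrier (wordObj V (z :: c)).carrier).toLinearMap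
        ∘ₗ TensorProduct.map (toLin f) LinearMap.id ∘ₗ
        (TensorProduct.lid K (wordObj V (z :: c)).carrier).symm.toLinearMap := by
  rw [← LinearMap.comp_assoc, LinearEquiv.eq_comp_toLinearMap_symm, ← mulₗ_pair]
  exact TensorProduct.ext' fun t w => toLin_tens_mulₗ_even V (a := []) (b := [x, y])
    (c := z :: c) f (g := 𝟙 _) (id_mem_homU _) t w

theorem toLin_wordTens_id {x y y' : Arrow} {c c' : List Arrow}
    {g : wordObj V (y :: c) ⟶ wordObj V (y' :: c')} (hg : toLin g ∈ homU _ _ 0) :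
    toLin (wordTens V (𝟙 (wordObj V [x])) g) = TensorProduct.map LinearMap.id (toLin g) :=
  TensorProduct.ext' fun v w =>
    toLin_tens_mulₗ_even V (a := [x]) (b := [x]) (c := y :: c) (d := y' :: c') (𝟙 _) hg v w

theorem toLin_wordTens_id_cap {x y : Arrow} {c : List Arrow}
    {g : wordObj V (y :: c) ⟶ wordObj V []} (hg : toLin g ∈ homU _ _ 0) :
    toLin (wordTens V (𝟙 (wordObj V [x])) g)
      = (TensorProduct.rid K (V x).carrier).toLinearMap
        ∘ₗ TensorProduct.map LinearMap.id (toLin g) :=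
  TensorProduct.ext' fun v w =>
    toLin_tens_mulₗ_even V (a := [x]) (b := [x]) (c := y :: c) (d := []) (𝟙 _) hg v w

theorem toLin_wordTens_id_cup {x y : Arrow} {c : List Arrow}
    {g : wordObj V [] ⟶ wordObj V (y :: c)} (hg : toLin g ∈ homU _ _ 0) :
    toLin (wordTens V (𝟙 (wordObj V [x])) g)
      = TensorProduct.map LinearMap.id (toLin g)
        ∘ₗ (TensorProduct.rid K (V x).carrier).symm.toLinearMap := by
  rw [LinearEquiv.eq_comp_toLinearMap_symm]
  exact TensorProduct.ext' fun v w =>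
    toLin_tens_mulₗ_even V (a := [x]) (b := [x]) (c := []) (d := y :: c) (𝟙 _) hg v w

theorem toLin_wordTens_pair_id_cup {x y z : Arrow} {c : List Arrow}
    {g : wordObj V [] ⟶ wordObj V (z :: c)} (hg : toLin g ∈ homU _ _ 0) :
    toLin (wordTens V (𝟙 (wordObj V [x, y])) g)
      = (TensorProduct.assoc K (V x).carrier (V y).carrier (wordObj V (z :: c)).carrier).toLinearMap
        ∘ₗ TensorProduct.map LinearMap.id (toLin g) ∘ₗ
        (TensorProduct.rid K ((V x).carrier ⊗[K] (V y).carrier)).symm.toLinearMap := by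
  rw [← LinearMap.comp_assoc, LinearEquiv.eq_comp_toLinearMap_symm, ← mulₗ_pair]
  have h : (TensorProduct.rid K ((V x).carrier ⊗[K] (V y).carrier)).toLinearMap
      = mulₗ V [x, y] [] := TensorProduct.ext_threefold fun v w t => by
    refine Eq.trans ?_ (mulₗ_cons_cons V x y [] [] v w t).symm
    exact (TensorProduct.tmul_smul _ _ _).symm
  rw [h]
  exact TensorProduct.ext' fun t w => toLin_tens_mulₗ_even V (a := [x, y]) (b := [x, y])
    (c := []) (d := z :: c) (𝟙 _) hg t w

end

theorem toLin_posUp_id :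
    toLin (wordTens (objV q n) (posUpHom q n) (𝟙 (wordObj (objV q n) [.up]))) = opT₁ q n :=
  toLin_wordTens_pair_id (objV q n) (posUpHom q n)

theorem toLin_id_posUp :
    toLin (wordTens (objV q n) (𝟙 (wordObj (objV q n) [.up])) (posUpHom q n)) = opT₂ q n :=
  toLin_wordTens_id (objV q n) opT_mem_homU

variable (q n) in
/-- The positive left crossing as a composite of linear maps. -/
def opPosLeft : Module.Dual K (Idx n → K) ⊗[K] (Idx n → K) →ₗ[K]
    (Idx n → K) ⊗[K] Module.Dual K (Idx n → K) :=
  ((TensorProduct.lid K _).toLinearMap ∘ₗ TensorProduct.map (ev K n) LinearMap.id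
      ∘ₗ (TensorProduct.assoc K _ _ _).symm.toLinearMap)
  ∘ₗ TensorProduct.map LinearMap.id ((TensorProduct.assoc K _ _ _).toLinearMap
      ∘ₗ TensorProduct.map (opT q n) LinearMap.id ∘ₗ (TensorProduct.assoc K _ _ _).symm.toLinearMap)
  ∘ₗ ((TensorProduct.assoc K _ _ _).toLinearMap ∘ₗ TensorProduct.map LinearMap.id (coev K n)
      ∘ₗ (TensorProduct.rid K _).symm.toLinearMap)

theorem toLin_posLeftHom : toLin (posLeftHom q n) = opPosLeft q n := by
  have h2 : toLin (wordTens (objV q n) (posUpHom q n) (𝟙 (wordObj (objV q n) [.down])))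
    = (TensorProduct.assoc K _ _ _).toLinearMap ∘ₗ TensorProduct.map (opT q n) LinearMap.id
      ∘ₗ (TensorProduct.assoc K (Idx n → K) (Idx n → K)
        (Module.Dual K (Idx n → K))).symm.toLinearMap :=
    toLin_wordTens_pair_id (objV q n) (posUpHom q n)
  have h1 := toLin_wordTens_pair_id_cup (objV q n) (x := .down) (y := .up) (g := leftCupHom q n)
    coev_mem_homU
  have h3 := toLin_wordTens_cap_id (objV q n) (z := .up) (c := [.down]) (leftCapHom q n)
  have h4 := toLin_wordTens_id (objV q n) (x := .down)
    (g := wordTens (objV q n) (posUpHom q n) (𝟙 (wordObj (objV q n) [.down])))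
    ((wordSystem (objV q n)).tens_mem (a := [.up, .up]) (b := [.up, .up]) (c := [.down])
      (d := [.down]) (r := 0) (s := 0) opT_mem_homU (id_mem_homU _))
  have h5 := h4.trans (congrArg (TensorProduct.map LinearMap.id) h2)
  refine (congrArg₂ (fun f g => f ∘ₗ g) h3 (congrArg₂ (fun f g => f ∘ₗ g) h5 h1)).trans ?_
  rfl

theorem opPosLeft_tmul (f : Module.Dual K (Idx n → K)) (v : Idx n → K) :
    opPosLeft q n (f ⊗ₜ v) = ∑ k : Idx n, (TensorProduct.lid K _ (TensorProduct.map f LinearMap.id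
      (opT q n (v ⊗ₜ vec K k)))) ⊗ₜ[K] covec K k := by
  have key : ∀ (t : (Idx n → K) ⊗[K] (Idx n → K)) (g : Module.Dual K (Idx n → K)),
      TensorProduct.lid K _ (TensorProduct.map (ev K n) LinearMap.id
        ((TensorProduct.assoc K _ _ _).symm (f ⊗ₜ (TensorProduct.assoc K _ _ _ (t ⊗ₜ g)))))
      = (TensorProduct.lid K _ (TensorProduct.map f LinearMap.id t)) ⊗ₜ[K] g := by
    intro t g
    induction t using TensorProduct.induction_on with
    | zero => simp
    | add t t' h h' => simp only [TensorProduct.add_tmul, map_add, TensorProduct.tmul_add, h, h']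
    | tmul a b => simp [ev, TensorProduct.smul_tmul']
  simp only [opPosLeft, LinearMap.comp_apply, LinearEquiv.coe_coe, TensorProduct.rid_symm_apply,
    TensorProduct.map_tmul, LinearMap.id_apply, coev_one, TensorProduct.tmul_sum,
    map_sum, TensorProduct.assoc_tmul, TensorProduct.assoc_symm_tmul, key]

/-- The positive left crossing on basis vectors. -/
theorem opPosLeft_covec_vec (i j : Idx n) :
    opPosLeft q n (covec K i ⊗ₜ vec K j) = posLeftFormula q i j := by
  have hc : ∀ a b : Idx n, TensorProduct.lid K (Idx n → K)
      (TensorProduct.map (covec K i) LinearMap.id (vec K a ⊗ₜ[K] vec K b))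
      = if i = a then vec K b else 0 := by
    intro a b
    rw [TensorProduct.map_tmul, TensorProduct.lid_tmul, covec_vec, ite_smul, one_smul, zero_smul,
      LinearMap.id_apply]
  have hk : ∀ k : Idx n, (TensorProduct.lid K _ (TensorProduct.map (covec K i) LinearMap.id
      (opT q n (vec K j ⊗ₜ vec K k)))) ⊗ₜ[K] covec K k
      = (if i = k then (sgn (j.p * k.p) * ((q ^ Idx.phi j k : Kˣ) : K)) • (vec K j ⊗ₜ[K] covec K k)
          else 0)
        + (if i = j then (if j < k then zq q • (vec K k ⊗ₜ[K] covec K k) else 0) else 0)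
        + (if i = -j then (if i < k then (zq q * sgn k.p) • (vec K (-k) ⊗ₜ[K] covec K k) else 0)
          else 0) := by
    intro k
    rw [opT_vec, map_add, map_add, map_add, map_add, TensorProduct.add_tmul, TensorProduct.add_tmul]
    refine congrArg₂ _ (congrArg₂ _ ?_ ?_) ?_
    · rw [LinearMap.map_smul, LinearEquiv.map_smul, hc, TensorProduct.smul_tmul']
      split_ifs
      · rfl
      · rw [smul_zero, TensorProduct.zero_tmul]
    · by_cases h1 : j < k
      · rw [if_pos h1, if_pos h1, LinearMap.map_smul, LinearEquiv.map_smul, hc,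
          TensorProduct.smul_tmul']
        split_ifs
        · rfl
        · rw [smul_zero, TensorProduct.zero_tmul]
      · rw [if_neg h1, if_neg h1, map_zero, map_zero, TensorProduct.zero_tmul, ite_self]
    · by_cases h2 : i = -j
      · rw [if_pos h2, ← h2]
        by_cases h1 : i < k
        · rw [if_pos h1, if_pos h1, LinearMap.map_smul, LinearEquiv.map_smul, hc, if_pos rfl,
            TensorProduct.smul_tmul']
        · rw [if_neg h1, if_neg h1, map_zero, map_zero, TensorProduct.zero_tmul]
      · rw [if_neg h2]
        by_cases h1 : -j < k
        · rw [if_pos h1, LinearMap.map_smul, LinearEquiv.map_smul, hc, if_neg h2, smul_zero,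
            TensorProduct.zero_tmul]
        · rw [if_neg h1, map_zero, map_zero, TensorProduct.zero_tmul]
  have hs : ∀ (p : Prop) [Decidable p] (g : Idx n → (Idx n → K) ⊗[K] Module.Dual K (Idx n → K)),
      (∑ k, if p then g k else 0) = if p then ∑ k, g k else 0 := by
    intro p _ g
    split_ifs
    · rfl
    · exact Finset.sum_const_zero
  rw [opPosLeft_tmul, Finset.sum_congr rfl fun k _ => hk k, Finset.sum_add_distrib,
    Finset.sum_add_distrib, hs, hs, Finset.sum_ite_eq, if_pos (Finset.mem_univ _), posLeftFormula,
    mul_comm j.p]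

theorem opPosLeft_opN (x : (Idx n → K) ⊗[K] Module.Dual K (Idx n → K)) :
    opPosLeft q n (opN q n x) = x := by
  have hk : ∀ a b : Idx n, opPosLeft q n (opN q n (vec K a ⊗ₜ covec K b)) = vec K a ⊗ₜ covec K b :=
    fun a b => by
      rw [opN_vec_covec, apply_negRightFormula (q := q) (opPosLeft q n) opPosLeft_covec_vec]
  induction x using TensorProduct.induction_on with
  | zero => simp only [map_zero]
  | add x y hx hy => simp only [map_add, hx, hy]
  | tmul v f =>
    rw [sum_vec_apply v, sum_covec_apply f]
    simp only [TensorProduct.sum_tmul, TensorProduct.tmul_sum, ← TensorProduct.smul_tmul',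
      TensorProduct.tmul_smul, map_sum, LinearMap.map_smul, hk]

/-- The right inverse of the positive left crossing is also a left inverse, since the two tensor
products have the same finite dimension. -/
theorem opN_opPosLeft (x : Module.Dual K (Idx n → K) ⊗[K] (Idx n → K)) :
    opN q n (opPosLeft q n x) = x := by
  have hinj : Function.Injective (opN q n) := Function.LeftInverse.injective opPosLeft_opN
  have hrank : Module.finrank K ((Idx n → K) ⊗[K] Module.Dual K (Idx n → K))
      = Module.finrank K (Module.Dual K (Idx n → K) ⊗[K] (Idx n → K)) :=
    (TensorProduct.comm K _ _).finrank_eq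
  obtain ⟨y, rfl⟩ := (LinearMap.injective_iff_surjective_of_finrank_eq_finrank hrank).1 hinj x
  rw [opPosLeft_opN]

theorem opPosLeft_mem_homU : opPosLeft q n ∈ homU (tensor (dual (SMod.V q n)) (SMod.V q n))
    (tensor (SMod.V q n) (dual (SMod.V q n))) 0 := by
  have h2 := (wordSystem (objV q n)).tens_mem (a := [.up, .up]) (b := [.up, .up]) (c := [.down])
    (d := [.down]) (r := 0) (s := 0) (f := posUpHom q n) (g := 𝟙 _) opT_mem_homU (id_mem_homU _)
  have h3 := (wordSystem (objV q n)).tens_mem (a := [.down]) (b := [.down])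
    (c := [.up, .up, .down]) (d := [.up, .up, .down]) (r := 0) (s := 0) (f := 𝟙 _)
    (id_mem_homU _) h2
  have h1 := (wordSystem (objV q n)).tens_mem (a := [.down, .up]) (b := [.down, .up])
    (c := []) (d := [.up, .down]) (r := 0) (s := 0) (f := 𝟙 _) (g := leftCupHom q n)
    (id_mem_homU _) coev_mem_homU
  have h4 := (wordSystem (objV q n)).tens_mem (a := [.down, .up]) (b := [])
    (c := [.up, .down]) (d := [.up, .down]) (r := 0) (s := 0) (f := leftCapHom q n) (g := 𝟙 _)
    ev_mem_homU (id_mem_homU _)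
  have h := mem_gr_iff.1 (comp_mem_even (k := K) h1 (comp_mem_even h3 h4))
  exact toLin_posLeftHom (q := q) (n := n) ▸ h

variable (q n) in
/-- The image of the negative right crossing: the inverse of the positive left crossing. -/
def negRightIso : wordObj (objV q n) [.up, .down] ≅ wordObj (objV q n) [.down, .up] :=
  (isoOfEquiv (M := tensor (dual (SMod.V q n)) (SMod.V q n))
    (N := tensor (SMod.V q n) (dual (SMod.V q n)))
    (LinearEquiv.ofLinearMap (opPosLeft q n) (opN q n) (LinearMap.ext opPosLeft_opN)
      (LinearMap.ext opN_opPosLeft)) opPosLeft_mem_homU).symm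

theorem negRightIso_inv : (negRightIso q n).inv = posLeftHom q n := hom_ext toLin_posLeftHom.symm

end

section
variable {K : Type u} [Field K] {q : Kˣ} {n : ℕ}

/-! ### The defining relations -/

variable (q n) in
/-- The images of the generating morphisms. -/
def genHom : ∀ {a b : List Arrow}, Gen a b → (wordObj (objV q n) a ⟶ wordObj (objV q n) b)
  | _, _, .posUp => posUpHom q n
  | _, _, .negUp => negUpHom q n
  | _, _, .negRight => (negRightIso q n).hom
  | _, _, .leftCap => leftCapHom q n
  | _, _, .leftCup => leftCupHom q n
  | _, _, .tok => tokHom q n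

theorem genHom_mem {a b : List Arrow} (g : Gen a b) : genHom q n g ∈ gr (k := K) _ _ g.parity := by
  cases g with
  | posUp => exact opT_mem_homU
  | negUp => exact opTInv_mem_homU
  | negRight => exact Supercategory.inv_mem (negRightIso q n).symm opPosLeft_mem_homU
  | leftCap => exact ev_mem_homU
  | leftCup => exact coev_mem_homU
  | tok => exact opJ_mem_homU

/-- The trivial supermodule has no nonzero odd endomorphisms. -/
theorem eq_zero_of_odd {f : one q n ⟶ one q n} (hf : f ∈ gr (k := K) _ _ 1) : f = 0 := by
  refine hom_ext (LinearMap.ext_ring ?_)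
  have h : toLin f (1 : K) ∈ (if (0 + 1 : ZMod 2) = 0 then ⊤ else ⊥ : Submodule K K) :=
    hf.1 0 (1 : K) (Grading.base_zero 1)
  rw [if_neg (by decide)] at h
  exact h

theorem zigzag_up_apply (v : Idx n → K) :
    TensorProduct.rid K _ (TensorProduct.map LinearMap.id (ev K n) (TensorProduct.assoc K _ _ _
      (TensorProduct.map (coev K n) LinearMap.id ((TensorProduct.lid K _).symm v)))) = v := by
  rw [TensorProduct.lid_symm_apply, TensorProduct.map_tmul, coev_one, TensorProduct.sum_tmul]
  simp only [map_sum, TensorProduct.assoc_tmul, TensorProduct.map_tmul, LinearMap.id_apply,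
    TensorProduct.rid_tmul]
  exact (sum_vec_apply v).symm

theorem zigzag_down_apply (f : Module.Dual K (Idx n → K)) :
    TensorProduct.lid K _ (TensorProduct.map (ev K n) LinearMap.id
      ((TensorProduct.assoc K _ _ _).symm
        (TensorProduct.map LinearMap.id (coev K n) ((TensorProduct.rid K _).symm f)))) = f := by
  rw [TensorProduct.rid_symm_apply, TensorProduct.map_tmul, coev_one, TensorProduct.tmul_sum]
  simp only [map_sum, TensorProduct.assoc_symm_tmul, TensorProduct.map_tmul, LinearMap.id_apply,
    TensorProduct.lid_tmul]
  exact (sum_covec_apply f).symm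

theorem toLin_tok_id : toLin (wordTens (objV q n) (tokHom q n) (𝟙 (wordObj (objV q n) [.up])))
    = TensorProduct.map (opJ K n) LinearMap.id :=
  TensorProduct.ext' fun v w => toLin_tens_mulₗ_even (objV q n) (a := [.up]) (b := [.up])
    (c := [.up]) (d := [.up]) (tokHom q n) (g := 𝟙 _) (id_mem_homU _) v w

/-- The images of the generators satisfy the defining relations of the quantum isomeric
supercategory. -/
theorem interp_defRel {a b : List Arrow} {f g : Term K a b} (h : Term.DefRel (zq q) f g) :
    (wordSystem (objV q n)).interp (genHom q n) f
      = (wordSystem (objV q n)).interp (genHom q n) g := by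
  cases h with
  | posUp_negUp => exact hom_ext (LinearMap.ext fun x => LinearMap.congr_fun opTInv_mul_opT x)
  | negUp_posUp => exact hom_ext (LinearMap.ext fun x => LinearMap.congr_fun opT_mul_opTInv x)
  | negRight_posLeft =>
    exact (congrArg ((negRightIso q n).hom ≫ ·) negRightIso_inv.symm).trans
      (negRightIso q n).hom_inv_id
  | posLeft_negRight =>
    exact (congrArg (· ≫ (negRightIso q n).hom) negRightIso_inv.symm).trans
      (negRightIso q n).inv_hom_id
  | braid =>
    have e : opT₁ q n ∘ₗ opT₂ q n ∘ₗ opT₁ q n = opT₂ q n ∘ₗ opT₁ q n ∘ₗ opT₂ q n :=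
      LinearMap.ext opT_braid
    have h1 := toLin_posUp_id (q := q) (n := n)
    have h2 := toLin_id_posUp (q := q) (n := n)
    refine hom_ext ?_
    refine (congrArg₂ (fun f g => f ∘ₗ g) (congrArg₂ (fun f g => f ∘ₗ g) h1 h2) h1).trans
      (e.trans ?_)
    exact (congrArg₂ (fun f g => f ∘ₗ g) (congrArg₂ (fun f g => f ∘ₗ g) h2 h1) h2).symm
  | skein =>
    have e : ∀ x : (Idx n → K) ⊗[K] (Idx n → K),
        opT q n x + (-1 : K) • opTInv q n x = zq q • x := fun x => by
      refine eq_of_forall_dual (K := K) fun f => ?_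
      rw [opTInv_apply, map_add, LinearMap.map_smul, LinearMap.map_smul, map_sub,
        LinearMap.map_smul, smul_eq_mul, smul_eq_mul]
      ring
    exact hom_ext (LinearMap.ext e)
  | tok_tok =>
    have e : ∀ x : Idx n → K, opJ K n (opJ K n x) = (-1 : K) • x := fun x => by
      rw [opJ_opJ, neg_one_smul]
    exact hom_ext (LinearMap.ext e)
  | tok_posUp =>
    refine hom_ext ?_
    exact (congrArg (fun g => opT q n ∘ₗ g) toLin_tok_id).trans opT_comp_map_opJ
  | tok_bubble =>
    -- The bubble with one token is odd.
    have h := WordSystem.interp_mem (W := wordSystem (objV q n)) (G := genHom q n) genHom_mem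
      (f := .comp (.gen .leftCup)
        (.comp (b := [.up, .down]) (.tensor (.gen .tok) (.id [.down])) (Term.rightCap K))) (r := 1)
      (Term.IsHomog.of_eq (.comp (.gen _) (.comp (.tensor (.gen _) (.id _))
        (.comp (.gen _) (.gen _)))) (by decide))
    exact eq_zero_of_odd h
  | bubble =>
    refine hom_ext (LinearMap.ext_ring ?_)
    change ev K n (opN q n (coev K n 1)) = 0
    rw [coev_one, map_sum, map_sum]
    refine (Finset.sum_congr rfl fun i _ => ?_).trans (sum_ev_negRightFormula (q := q))
    rw [opN_vec_covec]
  | zigzag_up =>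
    have h1 := toLin_wordTens_cup_id (objV q n) (z := .up) (c := []) (leftCupHom q n)
    have h2 := toLin_wordTens_id_cap (objV q n) (x := .up) (g := leftCapHom q n) ev_mem_homU
    refine hom_ext ?_
    refine (congrArg₂ (fun f g => f ∘ₗ g) h2 h1).trans ?_
    exact LinearMap.ext zigzag_up_apply
  | zigzag_down =>
    have h1 := toLin_wordTens_id_cup (objV q n) (x := .down) (g := leftCupHom q n) coev_mem_homU
    have h2 := toLin_wordTens_cap_id (objV q n) (z := .down) (c := []) (leftCapHom q n)
    refine hom_ext ?_
    refine (congrArg₂ (fun f g => f ∘ₗ g) h2 h1).trans ?_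
    exact LinearMap.ext zigzag_down_apply

end

section
variable {K : Type u} [Field K] {q : Kˣ} {n : ℕ} [Invertible (2 : K)]

/-! ### Comparison of incarnations -/

section
variable {F G : MonoidalSuperfunctor K (QCat (zq q)) (SMod q n)}
  {a : ∀ x : Arrow, F.obj ⟨[x]⟩ ≅ objV q n x} {b : ∀ x : Arrow, G.obj ⟨[x]⟩ ≅ objV q n x}

theorem inv_comp_eq_inv_of_comp_hom {C : Type*} [Category C] {X Y Z : C} {a : X ≅ Z} {b : Y ≅ Z}
    {e : X ⟶ Y} (h : e ≫ b.hom = a.hom) : a.inv ≫ e = b.inv := by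
  rw [Iso.inv_comp_eq, ← h, Category.assoc, Iso.hom_inv_id, Category.comp_id]

/-- The identification of `V_x ⊗ V_y` with the image of the word `xy`, as an isomorphism. -/
def pairIso (ha : ∀ x, (a x).hom ∈ gr (k := K) _ _ 0) (x y : Arrow) :
    SMod.tensor (objV q n x) (objV q n y) ≅ F.obj ⟨[x, y]⟩ :=
  tensorIso K (a x).symm (a y).symm (inv_mem _ (ha x)) (inv_mem _ (ha y)) ≪≫ F.μ ⟨[x]⟩ ⟨[y]⟩

theorem pairHom_comp (ha : ∀ x, (a x).hom ∈ gr (k := K) _ _ 0) {x y : Arrow}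
    {e : F.obj ⟨[x, y]⟩ ⟶ G.obj ⟨[x, y]⟩} {e₁ : F.obj ⟨[x]⟩ ⟶ G.obj ⟨[x]⟩}
    {e₂ : F.obj ⟨[y]⟩ ⟶ G.obj ⟨[y]⟩}
    (he : (F.μ ⟨[x]⟩ ⟨[y]⟩).hom ≫ e = tensorHom (k := K) e₁ e₂ ≫ (G.μ ⟨[x]⟩ ⟨[y]⟩).hom)
    (h₁ : e₁ ≫ (b x).hom = (a x).hom) (h₂ : e₂ ≫ (b y).hom = (a y).hom) :
    pairHom F a x y ≫ e = pairHom G b x y := by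
  have h := tensor_comp_left (k := K) (a x).inv e₁ (a y).inv e₂ (inv_mem _ (ha x))
  rw [inv_comp_eq_inv_of_comp_hom h₁, inv_comp_eq_inv_of_comp_hom h₂] at h
  refine (Category.assoc _ _ _).trans ?_
  refine (congrArg (tensorHom (k := K) (a x).inv (a y).inv ≫ ·) he).trans ?_
  refine (Category.assoc _ _ _).symm.trans ?_
  exact congrArg (· ≫ (G.μ ⟨[x]⟩ ⟨[y]⟩).hom) h

/-- Any two incarnations are related by a unique even monoidal natural isomorphism compatible with
the identifications of the images of the generating objects. -/
theorem IsIncarnation.existsUnique_natIso (hF : IsIncarnation F a) (hG : IsIncarnation G b) :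
    ∃! η : MonoidalSuperNatIso F G, ∀ x : Arrow, (η.app ⟨[x]⟩).hom ≫ (b x).hom = (a x).hom := by
  -- The isomorphism on letters is forced by compatibility with the identifications `a` and `b`.
  let θ : ∀ x, {e : F.wordSystem.obj [x] ≅ G.wordSystem.obj [x] // e.hom ∈ gr (k := K) _ _ 0} :=
    fun x => ⟨a x ≪≫ (b x).symm, comp_mem_even (hF.even x) (inv_mem _ (hG.even x))⟩
  have hθ : ∀ x, (θ x).1.hom ≫ (b x).hom = (a x).hom := fun x =>
    (Category.assoc _ _ _).trans ((congrArg _ (b x).inv_hom_id).trans (Category.comp_id _))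
  have hsing : ∀ x, (WordSystem.extend θ [x]).1.hom ≫ (b x).hom = (a x).hom := fun x => by
    rw [WordSystem.extend_singleton]; exact hθ x
  have hpair : ∀ x y, pairHom F a x y ≫ (WordSystem.extend θ [x, y]).1.hom = pairHom G b x y :=
    fun x y => pairHom_comp hF.even (WordSystem.μ_extend_cons θ x [y]) (hθ x) (hsing y)
  have hiff : ∀ η : MonoidalSuperNatIso F G,
      (∀ x, η.app ⟨[x]⟩ = (θ x).1) ↔ ∀ x, (η.app ⟨[x]⟩).hom ≫ (b x).hom = (a x).hom := by
    refine fun η => forall_congr' fun x => ⟨fun h => h ▸ hθ x, fun h => Iso.ext ?_⟩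
    exact (cancel_mono (b x).hom).1 (h.trans (hθ x).symm)
  refine (existsUnique_congr hiff).1 (MonoidalSuperfunctor.existsUnique_natIso θ ?_ ?_ ?_)
  · have h1 : pairHom F a .up .up ≫ F.mapTerm (.gen .posUp) = posUpHom q n ≫ pairHom F a .up .up :=
      hom_ext hF.posUp
    have h2 : pairHom G b .up .up ≫ G.mapTerm (.gen .posUp) = posUpHom q n ≫ pairHom G b .up .up :=
      hom_ext hG.posUp
    refine (cancel_epi (pairIso hF.even .up .up).hom).1 ?_
    change pairHom F a .up .up ≫ _ = pairHom F a .up .up ≫ _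
    refine ((Category.assoc _ _ _).symm.trans (congrArg (· ≫ _) h1)).trans ?_
    refine (Category.assoc _ _ _).trans ((congrArg (posUpHom q n ≫ ·) (hpair _ _)).trans ?_)
    refine h2.symm.trans ?_
    refine (congrArg (· ≫ G.mapTerm (.gen .posUp)) (hpair _ _).symm).trans ?_
    exact Category.assoc _ _ _
  · have h1 : pairHom F a .down .up ≫ F.mapTerm (.gen .leftCap) = leftCapHom q n ≫ F.ε.hom :=
      hom_ext hF.leftCap
    have h2 : pairHom G b .down .up ≫ G.mapTerm (.gen .leftCap) = leftCapHom q n ≫ G.ε.hom :=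
      hom_ext hG.leftCap
    refine (cancel_epi (pairIso hF.even .down .up).hom).1 ?_
    change pairHom F a .down .up ≫ _ = pairHom F a .down .up ≫ _
    refine ((Category.assoc _ _ _).symm.trans (congrArg (· ≫ _) h1)).trans ?_
    refine (Category.assoc _ _ _).trans
      ((congrArg (leftCapHom q n ≫ ·) (WordSystem.extend_nil θ)).trans ?_)
    refine h2.symm.trans ?_
    refine (congrArg (· ≫ G.mapTerm (.gen .leftCap)) (hpair _ _).symm).trans ?_
    exact Category.assoc _ _ _
  · have h1 : (a .up).inv ≫ F.mapTerm (.gen .tok) = tokHom q n ≫ (a .up).inv := hom_ext hF.tok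
    have h2 : (b .up).inv ≫ G.mapTerm (.gen .tok) = tokHom q n ≫ (b .up).inv := hom_ext hG.tok
    have h3 : (a .up).inv ≫ (WordSystem.extend θ [.up]).1.hom = (b .up).inv :=
      inv_comp_eq_inv_of_comp_hom (hsing .up)
    refine (cancel_epi (a .up).inv).1 ?_
    refine ((Category.assoc _ _ _).symm.trans (congrArg (· ≫ _) h1)).trans ?_
    refine (Category.assoc _ _ _).trans ((congrArg (tokHom q n ≫ ·) h3).trans ?_)
    refine h2.symm.trans ?_
    refine (congrArg (· ≫ G.mapTerm (.gen .tok)) h3.symm).trans ?_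
    exact Category.assoc _ _ _

/-- The formulas for the images of the remaining generators are transported by isomorphisms of
monoidal superfunctors. -/
theorem HasFormulas.of_natIso (ha : ∀ x, (a x).hom ∈ gr (k := K) _ _ 0) (hG : HasFormulas G b)
    (η : MonoidalSuperNatIso F G) (hη : ∀ x : Arrow, (η.app ⟨[x]⟩).hom ≫ (b x).hom = (a x).hom) :
    HasFormulas F a := by
  have hpair : ∀ x y, toLin (η.app ⟨[x, y]⟩).hom ∘ₗ toLin (pairHom F a x y)
      = toLin (pairHom G b x y) := fun x y =>
    congrArg toLin (pairHom_comp ha (η.tensor ⟨[x]⟩ ⟨[y]⟩) (hη x) (hη y))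
  have hgen : ∀ {c d : List Arrow} (g : Gen c d),
      toLin (η.app ⟨d⟩).hom ∘ₗ genMap F g = genMap G g ∘ₗ toLin (η.app ⟨c⟩).hom := fun g =>
    congrArg toLin (η.naturality (QCat.diagram (.gen g)))
  have hunit : toLin (η.app ⟨[]⟩).hom ∘ₗ toLin F.ε.hom = toLin G.ε.hom := congrArg toLin η.unit
  have hinj : ∀ c : List Arrow, Function.Injective (toLin (η.app ⟨c⟩).hom) := fun c =>
    Function.LeftInverse.injective (g := toLin (η.app ⟨c⟩).inv)
      fun v => LinearMap.congr_fun (congrArg toLin (η.app ⟨c⟩).hom_inv_id) v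
  refine ⟨?_, ?_, ?_⟩
  · obtain ⟨T', h1, h2, h3⟩ := hG.negUp
    refine ⟨T', h1, h2, LinearMap.ext fun v => hinj _ ?_⟩
    refine (LinearMap.congr_fun (hgen .negUp) _).trans ?_
    refine (congrArg (genMap G .negUp) (LinearMap.congr_fun (hpair .up .up) v)).trans ?_
    exact (LinearMap.congr_fun h3 v).trans (LinearMap.congr_fun (hpair .up .up) (T' v)).symm
  · refine LinearMap.ext fun v => hinj _ ?_
    refine (LinearMap.congr_fun (hgen .leftCup) _).trans ?_
    refine (congrArg (genMap G .leftCup) (LinearMap.congr_fun hunit v)).trans ?_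
    exact (LinearMap.congr_fun hG.leftCup v).trans
      (LinearMap.congr_fun (hpair .up .down) (coev K n v)).symm
  · refine fun i j => hinj _ ?_
    refine (LinearMap.congr_fun (hgen .negRight) _).trans ?_
    refine (congrArg (genMap G .negRight) (LinearMap.congr_fun (hpair .up .down) _)).trans ?_
    exact (hG.negRight i j).trans (LinearMap.congr_fun (hpair .down .up) _).symm

end

/-! ### The incarnation superfunctor -/

variable (q n) in
/-- The incarnation superfunctor, sending a word to the corresponding iterated tensor product of `V`
and `V^*`. -/
def incarnation : MonoidalSuperfunctor K (QCat (zq q)) (SMod q n) :=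
  WordSystem.monoidalFunctor (W := wordSystem (objV q n)) (G := genHom q n) (z := zq q)
    genHom_mem interp_defRel

variable (q n) in
/-- The images of the generating objects are `V` and `V^*` on the nose. -/
theorem incarnation_obj (x : Arrow) : (incarnation q n).obj ⟨[x]⟩ = objV q n x := rfl

theorem pairHom_incarnation (x y : Arrow) :
    toLin (pairHom (incarnation q n) (fun x => eqToIso (incarnation_obj q n x)) x y)
      = LinearMap.id :=
  congrArg toLin ((congrArg (· ≫ 𝟙 (SMod.tensor (objV q n x) (objV q n y)))
    (tensor_id (k := K) (objV q n x) (objV q n y))).trans (Category.comp_id _))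

theorem isIncarnation_incarnation :
    IsIncarnation (incarnation q n) fun x => eqToIso (incarnation_obj q n x) where
  even x := id_mem (k := K) (objV q n x)
  posUp := by rw [pairHom_incarnation]; rfl
  leftCap := by rw [pairHom_incarnation]; rfl
  tok := rfl

theorem hasFormulas_incarnation :
    HasFormulas (incarnation q n) fun x => eqToIso (incarnation_obj q n x) where
  negUp := ⟨opTInv q n, opTInv_mul_opT, opT_mul_opTInv, by rw [pairHom_incarnation]; rfl⟩
  leftCup := by rw [pairHom_incarnation]; rfl
  negRight i j := by
    rw [pairHom_incarnation, pairHom_incarnation]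
    exact opN_vec_covec i j

end

end Isomeric

end

theorem mainTheorem3 (n : ℕ) :
    (∃ (F : MonoidalSuperfunctor (RatFunc ℂ) (QCat (zq qVar)) (SMod qVar n))
        (h : ∀ x : Isomeric.Arrow, F.obj ⟨[x]⟩ = objV qVar n x), IsIncarnation F fun x => eqToIso (h x)) ∧
    ∀ (F : MonoidalSuperfunctor (RatFunc ℂ) (QCat (zq qVar)) (SMod qVar n))
      (a : ∀ x : Isomeric.Arrow, F.obj ⟨[x]⟩ ≅ objV qVar n x), IsIncarnation F a →
      HasFormulas F a ∧
      ∀ (G : MonoidalSuperfunctor (RatFunc ℂ) (QCat (zq qVar)) (SMod qVar n))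
        (b : ∀ x : Isomeric.Arrow, G.obj ⟨[x]⟩ ≅ objV qVar n x), IsIncarnation G b →
        ∃! η : MonoidalSuperNatIso F G, ∀ x : Isomeric.Arrow,
          (η.app ⟨[x]⟩).hom ≫ (b x).hom = (a x).hom := by
  refine ⟨⟨incarnation qVar n, incarnation_obj qVar n, isIncarnation_incarnation⟩,
    fun F a hF => ⟨?_, fun G b hG => hF.existsUnique_natIso hG⟩⟩
  obtain ⟨η, hη, -⟩ := hF.existsUnique_natIso isIncarnation_incarnation
  exact hasFormulas_incarnation.of_natIso hF.even η hη
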